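/- Let $n\ge 3$, let $(U,g)$ be a compact smooth $n$-dimensional Riemannian manifold with or without boundary, with volume measure $dv_g$, and let $1\le k\le n$. For a metric $h$ let $A_h=\frac{1}{n-2}\big(\mathrm{Ric}_h-\frac{1}{2(n-1)}R_h\,h\big)$ be its Schouten tensor and $\lambda(A_h)$ the eigenvalues of $A_h$ with respect to $h$; let $\sigma_k$ be the $k$-th elementary symmetric function. For a positive function $u$ put $g_u=u^{\frac{4}{n-2}}g$; if $u\in C^1\cap W^{2,k}$ is not smooth, $A_{g_u}$ is defined almost everywhere by the formula (valid for smooth $u$) $$A_{g_u}=-\tfrac{2}{n-2}u^{-1}\nabla^2u+\tfrac{2n}{(n-2)^2}u^{-2}\,du\otimes du-\tfrac{2}{(n-2)^2}u^{-2}|du|_g^2\,g+A_g ,$$ where $\nabla^2u$ is the weak covariant Hessian with respect to $g$. Let $0<\alpha<1$ and let $\{u_j\}$ be a sequence of smooth positive functions on $U$ which converges in $C^{1,\alpha}(U,g)$ and weakly in $W^{2,k}(U,g)$ to a positive function $u\in C^{1,\alpha}(U,g)\cap W^{2,k}(U,g)$. Then for every $\varphi\in C^0(U)$ with $\varphi=0$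 on $\partial U$, $$\lim_{j\to\infty}\int_U\sigma_k(\lambda(A_{g_{u_j}}))\,\varphi\,dv_g=\int_U\sigma_k(\lambda(A_{g_u}))\,\varphi\,dv_g ,$$ and, more generally, for every $\gamma\in\mathbb R$, $$\lim_{j\to\infty}\int_U u_j^{\gamma}\,\sigma_k(\lambda(A_{g_{u_j}}))\,\varphi\,dv_g=\int_U u^{\gamma}\,\sigma_k(\lambda(A_{g_u}))\,\varphi\,dv_g ,$$ all the integrands being integrable. -/

import Mathlib

open Set Filter Topology MeasureTheory Bundle
open scoped Manifold ContDiff ENNReal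

namespace SchoutenSigma

noncomputable section

/-- The model vector space `ℝⁿ`. -/
abbrev Eucl (n : ℕ) : Type := EuclideanSpace ℝ (Fin n)

/-- The `i`-th standard basis vector of `ℝⁿ`. -/
def basisVec {n : ℕ} (i : Fin n) : Eucl n := EuclideanSpace.single i (1 : ℝ)

/-! ### Levi-Civita connection and curvature of a metric in coordinates

`G : ℝⁿ → (ℝⁿ →L ℝⁿ →L ℝ)` is a metric written in coordinates and `s ⊆ ℝⁿ` is the set along which
derivatives are taken (the range of the model with corners, so that derivatives are one-sided at
boundary points). -/

section Coordinates

variable {n : ℕ}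

/-- Christoffel symbols: `Γ(v, w)` is the vector with
`2 G(Γ(v, w), z) = (D_v G)(w, z) + (D_w G)(v, z) - (D_z G)(v, w)` for all `z`. -/
def christoffel (G : Eucl n → Eucl n →L[ℝ] Eucl n →L[ℝ] ℝ) (s : Set (Eucl n))
    (y v w : Eucl n) : Eucl n :=
  (G y).inverse ((1 / 2 : ℝ) •
    (fderivWithin ℝ G s y v w + fderivWithin ℝ G s y w v
      - ((fderivWithin ℝ G s y).flip v).flip w))

/-- Riemann curvature `R(a, v) w = D_a Γ(v, w) - D_v Γ(a, w) + Γ(a, Γ(v, w)) - Γ(v, Γ(a, w))`. -/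
def riemannCoord (G : Eucl n → Eucl n →L[ℝ] Eucl n →L[ℝ] ℝ) (s : Set (Eucl n))
    (y a v w : Eucl n) : Eucl n :=
  fderivWithin ℝ (fun z => christoffel G s z v w) s y a
    - fderivWithin ℝ (fun z => christoffel G s z a w) s y v
    + christoffel G s y a (christoffel G s y v w)
    - christoffel G s y v (christoffel G s y a w)

/-- Ricci curvature: `Ric(v, w)` is the trace of `a ↦ R(a, v) w`. -/
def ricciCoord (G : Eucl n → Eucl n →L[ℝ] Eucl n →L[ℝ] ℝ) (s : Set (Eucl n))
    (y v w : Eucl n) : ℝ :=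
  ∑ i : Fin n, (riemannCoord G s y (basisVec i) v w) i

/-- Scalar curvature `G^{ij} Ric_{ij}`. -/
def scalarCoord (G : Eucl n → Eucl n →L[ℝ] Eucl n →L[ℝ] ℝ) (s : Set (Eucl n))
    (y : Eucl n) : ℝ :=
  ∑ i : Fin n, ricciCoord G s y (basisVec i) ((G y).inverse (EuclideanSpace.proj i))

/-- Schouten tensor `(1 / (n - 2)) (Ric - R / (2 (n - 1)) G)`. -/
def schoutenCoord (G : Eucl n → Eucl n →L[ℝ] Eucl n →L[ℝ] ℝ) (s : Set (Eucl n))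
    (y v w : Eucl n) : ℝ :=
  1 / ((n : ℝ) - 2) *
    (ricciCoord G s y v w - scalarCoord G s y / (2 * ((n : ℝ) - 1)) * G y v w)

/-- Eigenvalues, with multiplicity, of the bilinear form `A` with respect to the inner product `G`,
that is, of the `(1,1)`-tensor `G^{il} A_{lj}`. -/
def eigenvaluesRel (G A : Eucl n → Eucl n → ℝ) : Multiset ℝ :=
  ((Matrix.of fun i j : Fin n => G (basisVec i) (basisVec j))⁻¹ *
    (Matrix.of fun i j : Fin n => A (basisVec i) (basisVec j))).charpoly.roots

end Coordinates

section Manifold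

variable {n : ℕ} {H : Type*} [TopologicalSpace H] (I : ModelWithCorners ℝ (Eucl n) H)
  {M : Type*} [TopologicalSpace M] [ChartedSpace H M]

variable (M) in
/-- Covector fields (with no regularity imposed). -/
abbrev CovField : Type _ := ∀ p : M, TangentSpace I p →L[ℝ] ℝ

variable (M) in
/-- Fields of bilinear forms on the tangent spaces (with no regularity imposed). -/
abbrev BilinField : Type _ := ∀ p : M, TangentSpace I p →L[ℝ] TangentSpace I p →L[ℝ] ℝ

/-- The derivative at `y` of the inverse of the chart at `x`; it sends the `i`-th basis vector to
the coordinate vector `∂_i`. -/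
def coordFrame (x : M) (y : Eucl n) : Eucl n →L[ℝ] TangentSpace I ((extChartAt I x).symm y) :=
  mfderivWithin 𝓘(ℝ, Eucl n) I (extChartAt I x).symm (range I) y

/-- Coordinate expression of a covector field in the chart at `x`. -/
def coordCov (D : CovField I M) (x : M) (y : Eucl n) : Eucl n →L[ℝ] ℝ :=
  (D ((extChartAt I x).symm y)).comp (coordFrame I x y)

/-- Coordinate expression of a field of bilinear forms in the chart at `x`. -/
def coordBilin (B : BilinField I M) (x : M) (y : Eucl n) : Eucl n →L[ℝ] Eucl n →L[ℝ] ℝ :=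
  ContinuousLinearMap.bilinearComp (E := Eucl n) (F := Eucl n)
    (B ((extChartAt I x).symm y)) (coordFrame I x y) (coordFrame I x y)

/-- The Schouten tensor at `p` of a (smooth) metric `h` on `M`. It is computed in the chart at `p`,
through which `TangentSpace I p` is identified with `ℝⁿ` by definition. -/
def schouten (h : BilinField I M) (p : M) (v w : TangentSpace I p) : ℝ :=
  schoutenCoord (coordBilin I h p) (range I) (extChartAt I p p) v w

/-- `σ_k(λ(A))` at the point `p`: the `k`-th elementary symmetric function of the eigenvalues of the
bilinear form `A` on `T_p M` with respect to the metric `h`. -/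
def sigma (k : ℕ) (h : BilinField I M) (p : M)
    (A : TangentSpace I p → TangentSpace I p → ℝ) : ℝ :=
  (eigenvaluesRel (n := n) (fun v w => h p v w) A).esymm k

section Metric

variable [IsManifold I ∞ M] (g : ContMDiffRiemannianMetric I ∞ (Eucl n) (TangentSpace I (M := M)))

/-- The conformal metric `g_u = u^{4/(n-2)} g`. -/
def conformalMetric (u : M → ℝ) : BilinField I M :=
  fun p => (u p ^ (4 / ((n : ℝ) - 2))) • g.inner p

/-- `σ_k(λ(A_{g_u}))` for a smooth positive function `u`: here `A_{g_u}` is the Schouten tensor of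
the smooth metric `g_u` and eigenvalues are taken with respect to `g_u`. -/
def sigmaSchouten (k : ℕ) (u : M → ℝ) (p : M) : ℝ :=
  sigma I k (conformalMetric I g u) p (schouten I (conformalMetric I g u) p)

/-- The inner product of covectors induced by `g`. -/
def covInner (p : M) (a b : TangentSpace I p →L[ℝ] ℝ) : ℝ :=
  a ((g.inner p).inverse b)

/-- The inner product `g^{ia} g^{jb} A_{ij} B_{ab}` of bilinear forms induced by `g`. -/
def bilinInner (p : M) (A B : TangentSpace I p →L[ℝ] TangentSpace I p →L[ℝ] ℝ) : ℝ :=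
  ∑ i : Fin n, A ((g.inner p).inverse (EuclideanSpace.proj i : Eucl n →L[ℝ] ℝ))
    ((g.inner p).inverse (B (basisVec i : Eucl n)))

/-- The Schouten tensor `A_{g_u}` at `p` of `g_u`, for `u` with (weak) gradient `du` and (weak)
covariant Hessian `Hu` with respect to `g`:
`A_{g_u} = - 2/(n-2) u⁻¹ ∇²u + 2n/(n-2)² u⁻² du ⊗ du - 2/(n-2)² u⁻² |du|² g + A_g`. -/
def weakSchouten (u : M → ℝ) (du : CovField I M) (Hu : BilinField I M) (p : M)
    (v w : TangentSpace I p) : ℝ :=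
  -(2 / ((n : ℝ) - 2)) * (u p)⁻¹ * Hu p v w
    + 2 * (n : ℝ) / ((n : ℝ) - 2) ^ 2 * ((u p)⁻¹) ^ 2 * (du p v * du p w)
    - 2 / ((n : ℝ) - 2) ^ 2 * ((u p)⁻¹) ^ 2 * covInner I g p (du p) (du p) * g.inner p v w
    + schouten I g.inner p v w

/-- `σ_k(λ(A_{g_u}))` for a positive function `u` with weak gradient `du` and weak covariant
Hessian `Hu`; eigenvalues are taken with respect to `g_u`. -/
def sigmaWeakSchouten (k : ℕ) (u : M → ℝ) (du : CovField I M) (Hu : BilinField I M) (p : M) : ℝ :=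
  sigma I k (conformalMetric I g u) p (weakSchouten I g u du Hu p)

variable [MeasurableSpace M]

/-- The measure `√(det g_{ij}) dy` on the domain of the chart at `x`. -/
def chartVolume (x : M) : Measure M :=
  ((volume.restrict (extChartAt I x).target).withDensity (fun y =>
    ENNReal.ofReal (Real.sqrt (Matrix.det (Matrix.of fun i j : Fin n =>
      coordBilin I g.inner x y (basisVec i) (basisVec j)))))).map (extChartAt I x).symm

/-- The Riemannian volume measure `dv_g`. The measures `√(det g_{ij}) dy` of any two charts agree on
the overlap, so the smallest measure that dominates all of them restricts to `√(det g_{ij}) dy` on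
each chart. -/
def riemannianVolume : Measure M :=
  ⨆ x : M, chartVolume I g x

/-- `L^q` covector fields. -/
def MemLpCov (q : ℝ≥0∞) (D : CovField I M) : Prop :=
  (∀ x : M, AEStronglyMeasurable (coordCov I D x) (volume.restrict (extChartAt I x).target)) ∧
    MemLp (fun p => Real.sqrt (covInner I g p (D p) (D p))) q (riemannianVolume I g)

/-- `L^q` fields of bilinear forms. -/
def MemLpBilin (q : ℝ≥0∞) (B : BilinField I M) : Prop :=
  (∀ x : M, AEStronglyMeasurable (coordBilin I B x) (volume.restrict (extChartAt I x).target)) ∧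
    MemLp (fun p => Real.sqrt (bilinInner I g p (B p) (B p))) q (riemannianVolume I g)

/-- `u ∈ W^{2,q}(M, g)` with weak gradient `du` and weak covariant Hessian `Hu`. Weak derivatives are
tested, in the interior of each chart, against smooth functions with compact support; in coordinates
`∂_w ∂_v u = Hu(w, v) + du(Γ(w, v))`. -/
structure HasWeakHessian (q : ℝ≥0∞) (u : M → ℝ) (du : CovField I M) (Hu : BilinField I M) :
    Prop where
  memLp : MemLp u q (riemannianVolume I g)
  memLp_grad : MemLpCov I g q du
  memLp_hess : MemLpBilin I g q Hu
  weak_grad : ∀ (x : M) (η : Eucl n → ℝ), ContDiff ℝ ∞ η → HasCompactSupport η →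
    tsupport η ⊆ interior (extChartAt I x).target → ∀ v : Eucl n,
      ∫ y, u ((extChartAt I x).symm y) * fderiv ℝ η y v
        = -∫ y, coordCov I du x y v * η y
  weak_hess : ∀ (x : M) (η : Eucl n → ℝ), ContDiff ℝ ∞ η → HasCompactSupport η →
    tsupport η ⊆ interior (extChartAt I x).target → ∀ v w : Eucl n,
      ∫ y, coordCov I du x y v * fderiv ℝ η y w
        = -∫ y, (coordBilin I Hu x y w v
            + coordCov I du x y (christoffel (coordBilin I g.inner x) (range I) y w v)) * η y

/-- The Sobolev space `W^{2,q}(M, g)`. -/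
def MemW2 (q : ℝ≥0∞) (u : M → ℝ) : Prop :=
  ∃ (du : CovField I M) (Hu : BilinField I M), HasWeakHessian I g q u du Hu

/-- Weak convergence in `W^{2,q}(M, g)`: the functions, their weak gradients and their weak Hessians
converge weakly in `L^q`, i.e. when tested against `L^r` with `1/q + 1/r = 1`. -/
def TendstoWeaklyW2 (q : ℝ≥0∞) (v : ℕ → M → ℝ) (u : M → ℝ) : Prop :=
  (∀ j, MemW2 I g q (v j)) ∧ MemW2 I g q u ∧
  ∀ (dv : ℕ → CovField I M) (Hv : ℕ → BilinField I M) (du : CovField I M) (Hu : BilinField I M),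
    (∀ j, HasWeakHessian I g q (v j) (dv j) (Hv j)) → HasWeakHessian I g q u du Hu →
    ∀ r : ℝ≥0∞, ENNReal.HolderConjugate q r →
      (∀ f : M → ℝ, MemLp f r (riemannianVolume I g) →
        Tendsto (fun j => ∫ p, v j p * f p ∂(riemannianVolume I g)) atTop
          (𝓝 (∫ p, u p * f p ∂(riemannianVolume I g)))) ∧
      (∀ T : CovField I M, MemLpCov I g r T →
        Tendsto (fun j => ∫ p, covInner I g p (dv j p) (T p) ∂(riemannianVolume I g)) atTop
          (𝓝 (∫ p, covInner I g p (du p) (T p) ∂(riemannianVolume I g)))) ∧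
      (∀ T : BilinField I M, MemLpBilin I g r T →
        Tendsto (fun j => ∫ p, bilinInner I g p (Hv j p) (T p) ∂(riemannianVolume I g)) atTop
          (𝓝 (∫ p, bilinInner I g p (Hu p) (T p) ∂(riemannianVolume I g))))

end Metric

/-- The derivative of `u` in the coordinates of the chart at `x`. -/
def coordDeriv (u : M → ℝ) (x : M) (y : Eucl n) : Eucl n →L[ℝ] ℝ :=
  fderivWithin ℝ (fun z => u ((extChartAt I x).symm z)) (range I) y

/-- `u ∈ C^{1,α}(M)` (`M` compact): `u` is `C¹` up to the boundary, and its first derivatives in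
charts are `α`-Hölder continuous on compact subsets of the chart. -/
def MemC1Holder (α : ℝ) (u : M → ℝ) : Prop :=
  ContMDiff I 𝓘(ℝ, ℝ) 1 u ∧
  ∀ (x : M) (K : Set (Eucl n)), IsCompact K → K ⊆ (extChartAt I x).target →
    ∃ C : ℝ, ∀ y ∈ K, ∀ z ∈ K, ‖coordDeriv I u x y - coordDeriv I u x z‖ ≤ C * ‖y - z‖ ^ α

/-- Convergence in `C^{1,α}(M)` (`M` compact): in each chart and on each compact subset of it, the
functions and their first derivatives converge uniformly, and the `α`-Hölder seminorms of the
differences of the first derivatives tend to `0`. -/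
def TendstoC1Holder (α : ℝ) (v : ℕ → M → ℝ) (u : M → ℝ) : Prop :=
  ∀ (x : M) (K : Set (Eucl n)), IsCompact K → K ⊆ (extChartAt I x).target →
    ∀ ε : ℝ, 0 < ε → ∀ᶠ j in atTop,
      (∀ y ∈ K, |v j ((extChartAt I x).symm y) - u ((extChartAt I x).symm y)| ≤ ε) ∧
      (∀ y ∈ K, ‖coordDeriv I (v j) x y - coordDeriv I u x y‖ ≤ ε) ∧
      (∀ y ∈ K, ∀ z ∈ K, ‖(coordDeriv I (v j) x y - coordDeriv I u x y)
        - (coordDeriv I (v j) x z - coordDeriv I u x z)‖ ≤ ε * ‖y - z‖ ^ α)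

end Manifold

end

end SchoutenSigma

open SchoutenSigma

open Set Filter Topology MeasureTheory Bundle
open scoped Manifold ContDiff ENNReal

/-! In a chart, the Schouten tensor of `u^(4/(n-2)) g` is a scalar multiple of the coordinate
Hessian of `u` plus terms depending continuously on the position, on `u` and on `du`. Expanding
`σ_k` by multilinearity of the determinant turns it into a finite sum of such continuous
coefficients times determinants `nullLagr r (hess u)`, whose rows are unit vectors or rows of the
Hessian, at most `k` of the latter. `C¹` convergence makes the coefficients converge uniformly on
compact parts of the chart. The difficulty is that the determinants are nonlinear in a quantity
which converges only weakly.

These determinants are null Lagrangians. Every Hessian row is a gradient, so the cofactors along any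
row are divergence free (`sum_pderiv_cofactor_eq_zero`). If the rows of one Hessian are exchanged
for those of another one at a time, each resulting term can be integrated by parts: what remains is
a difference of first derivatives, a derivative of the test function, and the other rows. Hence
`abs_integral_nullLagr_sub_le`: against a smooth test function, two such integrals differ by at most
the uniform distance of the gradients times a bound involving the `k`-th powers of the Hessians. The
first factor tends to zero by `C¹` convergence. The second stays bounded because a weakly convergent
sequence is bounded in `L^k`, by Banach–Steinhaus (`exists_integral_abs_pow_le`,
`exists_integral_hess_pow_le`); boundedness is all that is needed, so `k = 1` is not special here.

The limit `u` has only a weak Hessian. Mollification together with Jensen's inequality carries the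
estimate over to it (`abs_integral_nullLagr_sub_weak_le`). The coefficients are only continuous, but
they vanish on the boundary together with `φ`, so they are uniform limits of smooth functions with
compact support in the interior, and the `L^k` bound absorbs the error
(`tendsto_integral_mul_nullLagr`).

The remainder is geometry. `sigmaSchouten` is defined by the curvature of `g_u`, so the conformal
transformation law (`IsMetricOn.schoutenForm_rpow_smul`) and the invariance under changes of
coordinates (`IsPullback.schoutenForm_eq`) have to be established, and the Riemannian measure has to
be identified in each chart (`restrict_riemannianVolume`). A partition of unity subordinate to the
charts then assembles the local statements. -/

namespace SchoutenSigma

set_option linter.unusedSectionVars false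

/-! ### Cofactor identities and integration by parts for determinants with gradient rows. -/

section NullLagrangian

variable {n : ℕ}

/-- Partial derivative in the `i`-th coordinate direction. -/
noncomputable def pderiv (i : Fin n) (f : Eucl n → ℝ) (y : Eucl n) : ℝ :=
  fderiv ℝ f y (basisVec i)

/-- The determinant as a continuous multilinear function of the rows. -/
noncomputable def detRows (n : ℕ) :
    ContinuousMultilinearMap ℝ (fun _ : Fin n => Fin n → ℝ) ℝ :=
  { (Matrix.detRowAlternating (R := ℝ) (n := Fin n)).toMultilinearMap with
    cont := by
      change Continuous fun M : Matrix (Fin n) (Fin n) ℝ => M.det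
      exact continuous_id.matrix_det }

theorem detRows_apply (R : Fin n → Fin n → ℝ) : detRows n R = Matrix.det (Matrix.of R) := rfl

/-- Laplace expansion along row `a`: the determinants with a unit vector in that row are the
cofactors. -/
theorem detRows_update_eq_sum (R : Fin n → Fin n → ℝ) (a : Fin n) (r : Fin n → ℝ) :
    detRows n (Function.update R a r)
      = ∑ b, r b * detRows n (Function.update R a (Pi.single b 1)) := by
  have h := map_sum ((detRows n).toContinuousLinearMap R a) (fun b => r b • Pi.single b (1 : ℝ))
    Finset.univ
  rw [← pi_eq_sum_univ' r] at h
  refine h.trans (Finset.sum_congr rfl fun b _ => ?_)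
  rw [map_smul, smul_eq_mul]
  rfl

/-- The two matrices differ by a transposition of the rows `a` and `i`. This antisymmetry is what
cancels second derivatives in the Piola identity. -/
theorem detRows_update_comm (R : Fin n → Fin n → ℝ) {a i : Fin n} (h : i ≠ a) (r s : Fin n → ℝ) :
    detRows n (Function.update (Function.update R a r) i s)
      = - detRows n (Function.update (Function.update R a s) i r) := by
  have := (Matrix.detRowAlternating (R := ℝ) (n := Fin n)).map_swap
    (Function.update (Function.update R a s) i r) h
  rw [← neg_eq_iff_eq_neg] at this
  change _ = -((Matrix.detRowAlternating (R := ℝ) (n := Fin n))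
    (Function.update (Function.update R a s) i r))
  rw [← this, neg_neg]
  change (Matrix.detRowAlternating (R := ℝ) (n := Fin n)) _ = _
  congr 1
  funext j
  by_cases hji : j = i
  · subst hji; simp [h.symm]
  · by_cases hja : j = a
    · subst hja; simp [hji]
    · simp [hji, hja, Equiv.swap_apply_of_ne_of_ne]

/-- Nothing is known about `P` outside `V`, but the product vanishes near every point outside the
support of `η`. -/
theorem continuous_mul_of_tsupport_subset {V : Set (Eucl n)} (hV : IsOpen V) {η P : Eucl n → ℝ}
    (hη : Continuous η) (hηV : tsupport η ⊆ V) (hP : ContinuousOn P V) :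
    Continuous (fun y => η y * P y) := by
  rw [continuous_iff_continuousAt]
  intro y
  by_cases hy : y ∈ tsupport η
  · exact hη.continuousAt.mul (hP.continuousAt (hV.mem_nhds (hηV hy)))
  · have : (fun y => η y * P y) =ᶠ[𝓝 y] fun _ => 0 := by
      filter_upwards [(isClosed_tsupport η).isOpen_compl.mem_nhds hy] with z hz
      rw [image_eq_zero_of_notMem_tsupport hz, zero_mul]
    exact continuousAt_const.congr this.symm

theorem contDiff_mul_of_tsupport_subset {V : Set (Eucl n)} (hV : IsOpen V) {η P : Eucl n → ℝ}
    (hη : ContDiff ℝ 1 η) (hηV : tsupport η ⊆ V) (hP : ContDiffOn ℝ 1 P V) :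
    ContDiff ℝ 1 (fun y => η y * P y) := by
  rw [contDiff_iff_contDiffAt]
  intro y
  by_cases hy : y ∈ tsupport η
  · exact hη.contDiffAt.mul (hP.contDiffAt (hV.mem_nhds (hηV hy)))
  · have : (fun y => η y * P y) =ᶠ[𝓝 y] fun _ => 0 := by
      filter_upwards [(isClosed_tsupport η).isOpen_compl.mem_nhds hy] with z hz
      rw [image_eq_zero_of_notMem_tsupport hz, zero_mul]
    exact contDiffAt_const.congr_of_eventuallyEq this

theorem integrable_mul_of_tsupport_subset {V : Set (Eucl n)} (hV : IsOpen V) {η P : Eucl n → ℝ}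
    (hη : Continuous η) (hc : HasCompactSupport η) (hηV : tsupport η ⊆ V) (hP : ContinuousOn P V) :
    Integrable (fun y => η y * P y) :=
  (continuous_mul_of_tsupport_subset hV hη hηV hP).integrable_of_hasCompactSupport hc.mul_right

theorem continuousOn_pderiv {V : Set (Eucl n)} (hV : IsOpen V) {f : Eucl n → ℝ}
    (hf : ContDiffOn ℝ 1 f V) (b : Fin n) : ContinuousOn (pderiv b f) V :=
  (hf.continuousOn_fderiv_of_isOpen hV le_rfl).clm_apply continuousOn_const

theorem tsupport_pderiv_subset (b : Fin n) (η : Eucl n → ℝ) :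
    tsupport (pderiv b η) ⊆ tsupport η :=
  closure_minimal (fun y hy => by
    by_contra h
    have : fderiv ℝ η y = 0 := by
      by_contra h'
      exact h (support_fderiv_subset ℝ h')
    exact hy (by rw [pderiv, this]; rfl)) (isClosed_tsupport _)

theorem hasCompactSupport_pderiv {η : Eucl n → ℝ} (hc : HasCompactSupport η) (b : Fin n) :
    HasCompactSupport (pderiv b η) :=
  hc.of_isClosed_subset (isClosed_tsupport _) (tsupport_pderiv_subset b η)

theorem integral_mul_pderiv {V : Set (Eucl n)} (hV : IsOpen V) {f ψ : Eucl n → ℝ}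
    (hf : ContDiffOn ℝ 1 f V) (hψ : ContDiff ℝ 1 ψ) (hc : HasCompactSupport ψ)
    (hψV : tsupport ψ ⊆ V) (b : Fin n) :
    ∫ y, ψ y * pderiv b f y = -∫ y, f y * pderiv b ψ y := by
  have h1 : Integrable (fun y => pderiv b f y * ψ y) := by
    simpa only [mul_comm] using integrable_mul_of_tsupport_subset hV hψ.continuous hc hψV
      (continuousOn_pderiv hV hf b)
  have h2 : Integrable (fun y => f y * pderiv b ψ y) := by
    simpa only [mul_comm] using integrable_mul_of_tsupport_subset hV
      (continuousOn_univ.1 (continuousOn_pderiv isOpen_univ hψ.contDiffOn b))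
      (hasCompactSupport_pderiv hc b) ((tsupport_pderiv_subset b ψ).trans hψV) hf.continuousOn
  have h3 : Integrable (fun y => f y * ψ y) := by
    simpa only [mul_comm] using
      integrable_mul_of_tsupport_subset hV hψ.continuous hc hψV hf.continuousOn
  have := integral_mul_fderiv_eq_neg_fderiv_mul_of_integrable (μ := volume) (v := basisVec b)
    h1 h2 h3
    (fun y hy => (hf.contDiffAt (hV.mem_nhds (hψV hy))).differentiableAt one_ne_zero)
    (fun y _ => (hψ.differentiable one_ne_zero) y)
  simp only [pderiv] at this ⊢
  rw [this, neg_neg]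
  simp only [mul_comm]

/-- Product rule over the rows. Row `a` is constant, hence contributes nothing; the derivative of
every other row is expanded in unit vectors. -/
theorem hasFDerivAt_detRows {R : Eucl n → Fin n → Fin n → ℝ} {y : Eucl n}
    (hR : ∀ i b, DifferentiableAt ℝ (fun z => R z i b) y) (a b : Fin n) :
    pderiv b (fun z => detRows n (Function.update (R z) a (Pi.single b 1))) y
      = ∑ i ∈ Finset.univ.erase a, ∑ c, pderiv b (fun z => R z i c) y *
          detRows n (Function.update (Function.update (R y) a (Pi.single b 1)) i
            (Pi.single c 1)) := by
  have hg : ∀ i, HasFDerivAt (fun z => Function.update (R z) a (Pi.single b 1) i)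
      (if i = a then 0 else ContinuousLinearMap.pi fun c => fderiv ℝ (fun z => R z i c) y) y := by
    intro i
    by_cases h : i = a
    · subst h
      simpa using hasFDerivAt_const (𝕜 := ℝ) (Pi.single b (1 : ℝ) : Fin n → ℝ) y
    · simp only [Function.update_of_ne h, if_neg h]
      exact hasFDerivAt_pi.2 fun c => (hR i c).hasFDerivAt
  have h := ((detRows n).hasFDerivAt _).comp y (hasFDerivAt_pi.2 hg)
  rw [pderiv]
  erw [h.fderiv]
  rw [ContinuousLinearMap.comp_apply, ContinuousMultilinearMap.linearDeriv_apply,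
    ← Finset.add_sum_erase _ _ (Finset.mem_univ a)]
  rw [(detRows n).map_coord_zero a (by simp), zero_add]
  refine Finset.sum_congr rfl fun i hi => ?_
  rw [detRows_update_eq_sum]
  have := Finset.ne_of_mem_erase hi
  simp [this, pderiv]

/-- The Piola identity: cofactors of a matrix with closed rows are divergence free. -/
theorem sum_pderiv_cofactor_eq_zero {R : Eucl n → Fin n → Fin n → ℝ} {y : Eucl n}
    (hR : ∀ i b, DifferentiableAt ℝ (fun z => R z i b) y) (a : Fin n)
    (hcl : ∀ i, i ≠ a → ∀ b c,
      pderiv c (fun z => R z i b) y = pderiv b (fun z => R z i c) y) :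
    ∑ b, pderiv b (fun z => detRows n (Function.update (R z) a (Pi.single b 1))) y = 0 := by
  simp_rw [hasFDerivAt_detRows hR a]
  rw [Finset.sum_comm]
  refine Finset.sum_eq_zero fun i hi => ?_
  have hia := Finset.ne_of_mem_erase hi
  -- For fixed `i` the double sum over `b`, `c` pairs a symmetric factor (closedness of row `i`)
  -- with an antisymmetric one (interchange of rows), so exchanging `b` and `c` shows that it equals
  -- its own negative.
  have h : ∀ s : ℝ, s = -s → s = 0 := fun s hs => by linarith
  apply h
  conv_lhs => rw [Finset.sum_comm]
  rw [← Finset.sum_neg_distrib]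
  refine Finset.sum_congr rfl fun b _ => ?_
  rw [← Finset.sum_neg_distrib]
  refine Finset.sum_congr rfl fun c _ => ?_
  rw [detRows_update_comm _ hia, hcl i hia b c]
  ring

/-- Row `a` is the gradient of `f`, so the determinant is the pairing of that gradient with a
cofactor field. This field is divergence free, because the other rows are closed, so integration by
parts only differentiates `η`, and the outcome is again a determinant, with the gradient of `η` in
row `a`. -/
theorem integral_mul_detRows {V : Set (Eucl n)} (hV : IsOpen V) {R : Eucl n → Fin n → Fin n → ℝ}
    (hR : ∀ i b, ContDiffOn ℝ 1 (fun z => R z i b) V) (a : Fin n)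
    (hcl : ∀ i, i ≠ a → ∀ b c, ∀ y ∈ V,
      pderiv c (fun z => R z i b) y = pderiv b (fun z => R z i c) y)
    {f : Eucl n → ℝ} (hf : ContDiffOn ℝ 1 f V) (hRf : ∀ y ∈ V, ∀ b, R y a b = pderiv b f y)
    {η : Eucl n → ℝ} (hη : ContDiff ℝ 1 η) (hc : HasCompactSupport η) (hηV : tsupport η ⊆ V) :
    ∫ y, η y * detRows n (R y)
      = -∫ y, f y * detRows n (Function.update (R y) a fun b => pderiv b η y) := by
  set P : Fin n → Eucl n → ℝ := fun b z =>
    detRows n (Function.update (R z) a (Pi.single b 1)) with hP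
  have hPd : ∀ b, ContDiffOn ℝ 1 (P b) V := by
    intro b
    refine (detRows n).contDiff.comp_contDiffOn (contDiffOn_pi.2 fun i => ?_)
    by_cases h : i = a
    · subst h
      simpa using contDiffOn_const
    · simp only [Function.update_of_ne h]
      exact contDiffOn_pi.2 fun c => hR i c
  have hηP : ∀ b, ContDiff ℝ 1 (fun y => η y * P b y) := fun b =>
    contDiff_mul_of_tsupport_subset hV hη hηV (hPd b)
  have hsub : ∀ b, tsupport (fun y => η y * P b y) ⊆ tsupport η := fun b =>
    tsupport_mul_subset_left
  have hcs : ∀ b, HasCompactSupport (fun y => η y * P b y) := fun b => hc.mul_right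
  have h1 : ∀ y, η y * detRows n (R y) = ∑ b, (η y * P b y) * pderiv b f y := by
    intro y
    by_cases hy : y ∈ V
    · have : detRows n (R y) = ∑ b, R y a b * P b y := by
        conv_lhs => rw [← Function.update_eq_self a (R y)]
        exact detRows_update_eq_sum _ _ _
      rw [this, Finset.mul_sum]
      exact Finset.sum_congr rfl fun b _ => by rw [hRf y hy]; ring
    · have : η y = 0 := image_eq_zero_of_notMem_tsupport fun h => hy (hηV h)
      simp [this]
  have h2 : ∀ y, f y * detRows n (Function.update (R y) a fun b => pderiv b η y)
      = ∑ b, f y * pderiv b (fun z => η z * P b z) y := by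
    intro y
    rw [detRows_update_eq_sum, ← Finset.mul_sum]
    congr 1
    by_cases hy : y ∈ V
    · have hd : ∀ b, pderiv b (fun z => η z * P b z) y
          = pderiv b η y * P b y + η y * pderiv b (P b) y := by
        intro b
        have := ((hη.differentiable one_ne_zero) y).hasFDerivAt.mul
          (((hPd b).contDiffAt (hV.mem_nhds hy)).differentiableAt one_ne_zero).hasFDerivAt
        rw [pderiv]
        erw [this.fderiv]
        simp [pderiv]
        ring
      simp_rw [hd]
      -- The Piola identity removes the terms in which the derivative falls on a cofactor.
      rw [Finset.sum_add_distrib, ← Finset.mul_sum,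
        sum_pderiv_cofactor_eq_zero
          (fun i b => ((hR i b).contDiffAt (hV.mem_nhds hy)).differentiableAt one_ne_zero) a
          (fun i hi b c => hcl i hi b c y hy), mul_zero, add_zero]
    · have hy' : y ∉ tsupport η := fun h => hy (hηV h)
      have e1 : ∀ b, pderiv b η y = 0 := fun b =>
        image_eq_zero_of_notMem_tsupport fun h => hy' (tsupport_pderiv_subset b η h)
      have e2 : ∀ b, pderiv b (fun z => η z * P b z) y = 0 := fun b =>
        image_eq_zero_of_notMem_tsupport fun h => hy' (hsub b (tsupport_pderiv_subset b _ h))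
      simp [e1, e2]
  simp_rw [h1, h2]
  rw [integral_finsetSum, integral_finsetSum, ← Finset.sum_neg_distrib]
  · exact Finset.sum_congr rfl fun b _ =>
      integral_mul_pderiv hV hf (hηP b) (hcs b) ((hsub b).trans hηV) b
  · intro b _
    simpa only [mul_comm] using integrable_mul_of_tsupport_subset hV
      (continuousOn_univ.1 (continuousOn_pderiv isOpen_univ (hηP b).contDiffOn b))
      (hasCompactSupport_pderiv (hcs b) b)
      ((tsupport_pderiv_subset b _).trans ((hsub b).trans hηV)) hf.continuousOn
  · intro b _
    exact integrable_mul_of_tsupport_subset hV (hηP b).continuous (hcs b) ((hsub b).trans hηV)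
      (continuousOn_pderiv hV hf b)

end NullLagrangian

/-! ### Determinants of Hessian rows and their stability under small changes of the gradient. -/

section Hessian

variable {n : ℕ}

/-- The matrix of second partial derivatives. -/
noncomputable def hess (f : Eucl n → ℝ) (y : Eucl n) : Fin n → Fin n → ℝ :=
  fun a b => pderiv b (pderiv a f) y

/-- A row of the matrix `A`, or a constant unit row. -/
def baseRow (A : Fin n → Fin n → ℝ) : Fin n ⊕ Fin n → Fin n → ℝ
  | Sum.inl l => A l
  | Sum.inr b => Pi.single b 1

/-- The determinant of a matrix composed of rows of `A` and unit rows; applied to Hessians it is a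
null Lagrangian. -/
noncomputable def nullLagr (r : Fin n → Fin n ⊕ Fin n) (A : Fin n → Fin n → ℝ) : ℝ :=
  detRows n fun a => baseRow A (r a)

/-- The number of rows of `A` that enter `nullLagr r A`. -/
def rowDeg (r : Fin n → Fin n ⊕ Fin n) : ℕ := (Finset.univ.filter fun a => (r a).isLeft).card

theorem norm_baseRow_le (A : Fin n → Fin n → ℝ) (t : Fin n ⊕ Fin n) {m : ℝ}
    (hA : ‖A‖ ≤ m) : ‖baseRow A t‖ ≤ if t.isLeft then m else 1 := by
  rcases t with l | b
  · simpa [baseRow] using (norm_le_pi_norm A l).trans hA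
  · simp only [baseRow, Sum.isLeft_inr, Bool.false_eq_true, if_false]
    refine (pi_norm_le_iff_of_nonneg zero_le_one).2 fun c => ?_
    by_cases h : c = b
    · subst h; simp
    · simp [h]

/-- Unit rows contribute a factor at most one and at most `k` rows come from the Hessian. Since
there may be fewer than `k`, the bound `m` has to be at least one. -/
theorem prod_norm_le_pow {r : Fin n → Fin n ⊕ Fin n} {k : ℕ} (hr : rowDeg r ≤ k)
    (R : Fin n → Fin n → ℝ) {m : ℝ} (h1 : 1 ≤ m) (s : Finset (Fin n))
    (hR : ∀ a ∈ s, ‖R a‖ ≤ if (r a).isLeft then m else 1) :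
    ∏ a ∈ s, ‖R a‖ ≤ m ^ k := by
  calc ∏ a ∈ s, ‖R a‖ ≤ ∏ a ∈ s, (if (r a).isLeft then m else 1) :=
        Finset.prod_le_prod (fun _ _ => norm_nonneg _) hR
    _ = m ^ (s.filter fun a => (r a).isLeft).card := by
        rw [← Finset.prod_filter, Finset.prod_const]
    _ ≤ m ^ k := pow_le_pow_right₀ h1
        ((Finset.card_le_card (Finset.filter_subset_filter _ (Finset.subset_univ _))).trans hr)

theorem max_pow_le {a b : ℝ} (ha : 0 ≤ a) (hb : 0 ≤ b) (k : ℕ) :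
    (max 1 (max a b)) ^ k ≤ 1 + a ^ k + b ^ k := by
  rcases max_choice 1 (max a b) with h | h
  · rw [h, one_pow]; linarith [pow_nonneg ha k, pow_nonneg hb k]
  · rw [h]
    rcases max_choice a b with h | h <;> rw [h] <;> linarith [pow_nonneg ha k, pow_nonneg hb k]

/-- Growth of order `k`: this is why a Hessian in `L^k` makes the determinants integrable on bounded
sets. -/
theorem abs_nullLagr_le {r : Fin n → Fin n ⊕ Fin n} {k : ℕ} (hr : rowDeg r ≤ k)
    (A : Fin n → Fin n → ℝ) : |nullLagr r A| ≤ ‖detRows n‖ * (1 + ‖A‖ ^ k) := by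
  have h := (detRows n).le_opNorm fun a => baseRow A (r a)
  refine h.trans (mul_le_mul_of_nonneg_left ?_ (norm_nonneg _))
  refine (prod_norm_le_pow hr _ (le_max_left 1 ‖A‖) _
    fun a _ => norm_baseRow_le A _ (le_max_right _ _)).trans ?_
  rcases max_choice 1 ‖A‖ with h | h
  · rw [h, one_pow]; linarith [pow_nonneg (norm_nonneg A) k]
  · rw [h]; linarith

theorem continuous_baseRow (t : Fin n ⊕ Fin n) :
    Continuous fun A : Fin n → Fin n → ℝ => baseRow A t := by
  rcases t with l | b
  · exact continuous_apply l
  · exact continuous_const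

theorem continuous_nullLagr (r : Fin n → Fin n ⊕ Fin n) : Continuous (nullLagr r) :=
  (detRows n).cont.comp (continuous_pi fun a => continuous_baseRow (r a))

theorem contDiffOn_pderiv {V : Set (Eucl n)} (hV : IsOpen V) {f : Eucl n → ℝ} {m : ℕ}
    (hf : ContDiffOn ℝ (m + 1 : ℕ) f V) (b : Fin n) : ContDiffOn ℝ m (pderiv b f) V :=
  ((hf.fderiv_of_isOpen hV (by norm_cast)).clm_apply contDiffOn_const)

theorem pderiv_comm {V : Set (Eucl n)} (hV : IsOpen V) {f : Eucl n → ℝ}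
    (hf : ContDiffOn ℝ 2 f V) {y : Eucl n} (hy : y ∈ V) (b c : Fin n) :
    pderiv c (pderiv b f) y = pderiv b (pderiv c f) y := by
  have h2 := hf.contDiffAt (hV.mem_nhds hy)
  have hd : DifferentiableAt ℝ (fderiv ℝ f) y :=
    (h2.fderiv_right (m := 1) le_rfl).differentiableAt one_ne_zero
  have e : ∀ b c : Fin n, pderiv c (pderiv b f) y
      = fderiv ℝ (fderiv ℝ f) y (basisVec c) (basisVec b) := by
    intro b c
    have h := hd.hasFDerivAt.clm_apply (hasFDerivAt_const (basisVec b : Eucl n) y)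
    rw [pderiv]
    erw [h.fderiv]
    simp
  rw [e, e]
  exact (h2.isSymmSndFDerivAt (by simp)).eq _ _

theorem contDiffOn_hess {V : Set (Eucl n)} (hV : IsOpen V) {f : Eucl n → ℝ} {m : ℕ}
    (hf : ContDiffOn ℝ (m + 2 : ℕ) f V) (a b : Fin n) :
    ContDiffOn ℝ m (fun y => hess f y a b) V :=
  contDiffOn_pderiv hV (contDiffOn_pderiv hV hf a) b

theorem continuousOn_hess {V : Set (Eucl n)} (hV : IsOpen V) {f : Eucl n → ℝ}
    (hf : ContDiffOn ℝ 2 f V) : ContinuousOn (hess f) V :=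
  continuousOn_pi.2 fun a => continuousOn_pi.2 fun b =>
    (contDiffOn_hess hV (m := 0) (by exact_mod_cast hf) a b).continuousOn

/-- The difference telescopes over the rows. In each term one row is the gradient of `∂_l f - ∂_l
g`, and integrating it by parts replaces it by the small function itself times the gradient of `η`;
the remaining rows are bounded by powers of the two Hessians. Three derivatives are required so that
the Hessian rows are `C¹` and closed. -/
theorem abs_integral_nullLagr_sub_le {V : Set (Eucl n)} (hV : IsOpen V) {f g : Eucl n → ℝ}
    (hf : ContDiffOn ℝ 3 f V) (hg : ContDiffOn ℝ 3 g V) {r : Fin n → Fin n ⊕ Fin n} {k : ℕ}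
    (hr : rowDeg r ≤ k) {η : Eucl n → ℝ} (hη : ContDiff ℝ 1 η) (hc : HasCompactSupport η)
    (hηV : tsupport η ⊆ V) {D δ : ℝ} (hD : ∀ y b, |pderiv b η y| ≤ D)
    (hδ : ∀ y ∈ tsupport η, ∀ l, |pderiv l f y - pderiv l g y| ≤ δ) (hδ0 : 0 ≤ δ) :
    |∫ y, η y * (nullLagr r (hess f y) - nullLagr r (hess g y))|
      ≤ n * (δ * (‖detRows n‖ * D) *
        ∫ y in tsupport η, (1 + ‖hess f y‖ ^ k + ‖hess g y‖ ^ k)) := by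
  set F : Fin n → Eucl n → Fin n → ℝ := fun a y => baseRow (hess f y) (r a) with hF
  set G : Fin n → Eucl n → Fin n → ℝ := fun a y => baseRow (hess g y) (r a) with hG
  -- The `i`-th telescoping matrix: rows of `f` above `i`, the difference in row `i`, rows of `g`
  -- below.
  set R : Fin n → Eucl n → Fin n → Fin n → ℝ := fun i y j =>
    if j < i then F j y else if j = i then F j y - G j y else G j y with hR
  have htel : ∀ y, nullLagr r (hess f y) - nullLagr r (hess g y) = ∑ i, detRows n (R i y) := by
    intro y
    have := (detRows n).toMultilinearMap.map_piecewise_sub_map_piecewise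
      (fun a => F a y) (fun a => G a y) 0 Finset.univ
    simpa [nullLagr, Finset.piecewise_univ, hR] using this
  have hf2 : ContDiffOn ℝ 2 f V := hf.of_le (by norm_num)
  have hg2 : ContDiffOn ℝ 2 g V := hg.of_le (by norm_num)
  have hcF : ∀ {h : Eucl n → ℝ}, ContDiffOn ℝ 3 h V → ∀ a b,
      ContDiffOn ℝ 1 (fun y => baseRow (hess h y) (r a) b) V := by
    intro h hh a b
    rcases r a with l | c
    · exact contDiffOn_hess hV (m := 1) (by exact_mod_cast hh) l b
    · exact contDiffOn_const
  have hcl : ∀ {h : Eucl n → ℝ}, ContDiffOn ℝ 3 h V → ∀ a b c, ∀ y ∈ V,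
      pderiv c (fun z => baseRow (hess h z) (r a) b) y
        = pderiv b (fun z => baseRow (hess h z) (r a) c) y := by
    intro h hh a b c y hy
    rcases r a with l | d
    · exact pderiv_comm hV (contDiffOn_pderiv hV (m := 2) (by exact_mod_cast hh) l) hy b c
    · simp [baseRow, pderiv]
  have hRc : ∀ i j b, ContDiffOn ℝ 1 (fun y => R i y j b) V := by
    intro i j b
    simp only [hR]
    split_ifs
    · exact hcF hf j b
    · exact (hcF hf j b).sub (hcF hg j b)
    · exact hcF hg j b
  have hRC : ∀ i, ContinuousOn (fun y => detRows n (R i y)) V := fun i =>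
    (detRows n).cont.comp_continuousOn
      (continuousOn_pi.2 fun j => continuousOn_pi.2 fun b => (hRc i j b).continuousOn)
  have hbound : ∀ i, |∫ y, η y * detRows n (R i y)| ≤ δ * (‖detRows n‖ * D) *
      ∫ y in tsupport η, (1 + ‖hess f y‖ ^ k + ‖hess g y‖ ^ k) := by
    intro i
    have hD0 : 0 ≤ D := (abs_nonneg _).trans (hD 0 i)
    have hint : IntegrableOn (fun y => 1 + ‖hess f y‖ ^ k + ‖hess g y‖ ^ k) (tsupport η) :=
      ContinuousOn.integrableOn_compact hc
        (((continuousOn_const.add ((continuousOn_hess hV hf2).norm.pow k)).add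
          ((continuousOn_hess hV hg2).norm.pow k)).mono hηV)
    rcases hri : r i with l | b
    · have hibp := integral_mul_detRows hV (R := R i) (hRc i) i
        (fun j hj b c y hy => by
          simp only [hR]
          rcases lt_or_gt_of_ne hj with h | h
          · simp only [h, if_true]; exact hcl hf j b c y hy
          · simp only [h.not_gt, if_false, hj]; exact hcl hg j b c y hy)
        (f := fun y => pderiv l f y - pderiv l g y)
        (((contDiffOn_pderiv hV (m := 2) (by exact_mod_cast hf) l).of_le (by norm_num)).sub
          ((contDiffOn_pderiv hV (m := 2) (by exact_mod_cast hg) l).of_le (by norm_num)))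
        (fun y hy b => by
          have e1 := ((contDiffOn_pderiv hV (m := 1) (by exact_mod_cast hf2) l).contDiffAt
            (hV.mem_nhds hy)).differentiableAt (by norm_num)
          have e2 := ((contDiffOn_pderiv hV (m := 1) (by exact_mod_cast hg2) l).contDiffAt
            (hV.mem_nhds hy)).differentiableAt (by norm_num)
          rw [pderiv]
          erw [(e1.hasFDerivAt.sub e2.hasFDerivAt).fderiv]
          simp [hR, hF, hG, hri, baseRow, hess, pderiv])
        hη hc hηV
      rw [hibp, abs_neg, ← Real.norm_eq_abs]
      -- Outside the support of `η` row `i` is zero after the integration by parts, so only the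
      -- integral over this compact set has to be estimated.
      have hz : ∀ y ∉ tsupport η, (pderiv l f y - pderiv l g y) *
          detRows n (Function.update (R i y) i fun b => pderiv b η y) = 0 := by
        intro y hy
        have : (fun b => pderiv b η y) = 0 := funext fun b =>
          image_eq_zero_of_notMem_tsupport fun h => hy (tsupport_pderiv_subset b η h)
        rw [this, (detRows n).map_coord_zero i (by simp), mul_zero]
      rw [← setIntegral_eq_integral_of_forall_compl_eq_zero hz, ← integral_const_mul]
      refine norm_integral_le_of_norm_le (hint.const_mul _) ?_
      filter_upwards [ae_restrict_mem (isClosed_tsupport η).measurableSet] with y hy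
      rw [norm_mul, mul_assoc]
      refine mul_le_mul (hδ y hy l) ?_ (norm_nonneg _) hδ0
      refine ((detRows n).le_opNorm _).trans ?_
      rw [mul_assoc]
      refine mul_le_mul_of_nonneg_left ?_ (norm_nonneg _)
      rw [← Finset.mul_prod_erase _ _ (Finset.mem_univ i)]
      refine mul_le_mul ?_ ?_ (Finset.prod_nonneg fun _ _ => norm_nonneg _) hD0
      · rw [Function.update_self]
        exact (pi_norm_le_iff_of_nonneg hD0).2 fun b => hD y b
      · refine (prod_norm_le_pow hr (fun j => Function.update (R i y) i _ j)
          (le_max_left 1 (max ‖hess f y‖ ‖hess g y‖)) _ fun j hj => ?_).trans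
          (max_pow_le (norm_nonneg _) (norm_nonneg _) k)
        have hji := Finset.ne_of_mem_erase hj
        rw [Function.update_of_ne hji]
        simp only [hR]
        rcases lt_or_gt_of_ne hji with h | h
        · simp only [h, if_true]
          exact norm_baseRow_le _ _
            ((le_max_left _ _).trans (le_max_right _ _))
        · simp only [h.not_gt, if_false, hji]
          exact norm_baseRow_le _ _
            ((le_max_right _ _).trans (le_max_right _ _))
    -- A unit row is the same for `f` and `g`, so the difference row vanishes.
    · have : ∀ y, detRows n (R i y) = 0 := fun y =>
        (detRows n).map_coord_zero i (by simp [hR, hF, hG, hri, baseRow])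
      simp only [this, mul_zero, integral_zero, abs_zero]
      have : 0 ≤ ∫ y in tsupport η, (1 + ‖hess f y‖ ^ k + ‖hess g y‖ ^ k) :=
        integral_nonneg fun y => by positivity
      positivity
  simp_rw [htel, Finset.mul_sum]
  rw [integral_finsetSum _ fun i _ =>
    integrable_mul_of_tsupport_subset hV hη.continuous hc hηV (hRC i)]
  refine (Finset.abs_sum_le_sum_abs _ _).trans ((Finset.sum_le_sum fun i _ => hbound i).trans ?_)
  simp

end Hessian

/-! ### A dominated convergence theorem with moving bounds. -/

section DominatedConvergence

variable {X : Type*} [MeasurableSpace X] {μ : Measure X}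

/-- Dominated convergence with a converging sequence of dominating functions. -/
theorem tendsto_integral_of_dominated_sequence {F G : ℕ → X → ℝ} {f g : X → ℝ}
    (hF : ∀ m, AEStronglyMeasurable (F m) μ) (hG : ∀ m, Integrable (G m) μ) (hg : Integrable g μ)
    (hFG : ∀ m, ∀ᵐ x ∂μ, |F m x| ≤ G m x)
    (hFf : ∀ᵐ x ∂μ, Tendsto (fun m => F m x) atTop (𝓝 (f x)))
    (hGg : ∀ᵐ x ∂μ, Tendsto (fun m => G m x) atTop (𝓝 (g x)))
    (hint : Tendsto (fun m => ∫ x, G m x ∂μ) atTop (𝓝 (∫ x, g x ∂μ))) :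
    Tendsto (fun m => ∫ x, F m x ∂μ) atTop (𝓝 (∫ x, f x ∂μ)) := by
  have hG0 : ∀ᵐ x ∂μ, ∀ m, 0 ≤ G m x := by
    filter_upwards [ae_all_iff.2 hFG] with x hx m using (abs_nonneg _).trans (hx m)
  have hfg : ∀ᵐ x ∂μ, |f x| ≤ g x := by
    filter_upwards [ae_all_iff.2 hFG, hFf, hGg] with x h1 h2 h3
    exact le_of_tendsto_of_tendsto' h2.abs h3 h1
  -- Truncating `F m` to the interval `[-g, g]` brings it under the fixed bound `g`, where ordinary
  -- dominated convergence applies. The error of the truncation is at most the positive part of `G m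
  -- - g`.
  set T : ℕ → X → ℝ := fun m x => max (-g x) (min (g x) (F m x)) with hT
  have hTm : ∀ m, AEStronglyMeasurable (T m) μ := fun m =>
    (hg.aestronglyMeasurable.neg).sup (hg.aestronglyMeasurable.inf (hF m))
  have hTb : ∀ m, ∀ᵐ x ∂μ, ‖T m x‖ ≤ g x := by
    intro m
    filter_upwards [hfg] with x hx
    have : 0 ≤ g x := (abs_nonneg _).trans hx
    rw [Real.norm_eq_abs, abs_le]
    exact ⟨le_max_left _ _, max_le (by linarith) (min_le_left _ _)⟩
  have h1 : Tendsto (fun m => ∫ x, T m x ∂μ) atTop (𝓝 (∫ x, f x ∂μ)) := by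
    refine tendsto_integral_of_dominated_convergence g hTm hg hTb ?_
    filter_upwards [hFf, hfg] with x hx hx'
    have := (tendsto_const_nhds (x := -g x)).max ((tendsto_const_nhds (x := g x)).min hx)
    rwa [min_eq_right (abs_le.1 hx').2, max_eq_right (abs_le.1 hx').1] at this
  have h2 : Tendsto (fun m => ∫ x, max (g x - G m x) 0 ∂μ) atTop (𝓝 0) := by
    have : Tendsto (fun m => ∫ x, max (g x - G m x) 0 ∂μ) atTop (𝓝 (∫ _, (0 : ℝ) ∂μ)) := by
      refine tendsto_integral_of_dominated_convergence g
        (fun m => (hg.sub (hG m)).aestronglyMeasurable.sup aestronglyMeasurable_const) hg ?_ ?_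
      · intro m
        filter_upwards [hG0, hfg] with x hx hx'
        have h0 : 0 ≤ g x := (abs_nonneg _).trans hx'
        rw [Real.norm_eq_abs, abs_of_nonneg (le_max_right _ _)]
        exact max_le (by linarith [hx m]) h0
      · filter_upwards [hGg] with x hx
        simpa using ((tendsto_const_nhds (x := g x)).sub hx).max (tendsto_const_nhds (x := (0 : ℝ)))
    simpa using this
  -- The integrand is the positive part of `G m - g`. Its integral tends to zero because the
  -- negative part is dominated by `g` and the integrals of `G m - g` themselves tend to zero.
  have h3 : Tendsto (fun m => ∫ x, (max (g x - G m x) 0 + (G m x - g x)) ∂μ) atTop (𝓝 0) := by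
    have h4 : ∀ m, ∫ x, (max (g x - G m x) 0 + (G m x - g x)) ∂μ
        = ∫ x, max (g x - G m x) 0 ∂μ + (∫ x, G m x ∂μ - ∫ x, g x ∂μ) := by
      intro m
      rw [← integral_sub (hG m) hg]
      exact integral_add (hg.sub (hG m)).pos_part ((hG m).sub hg)
    simp_rw [h4]
    simpa using h2.add (hint.sub_const (∫ x, g x ∂μ))
  have hFi : ∀ m, Integrable (F m) μ := fun m => (hG m).mono' (hF m) (hFG m)
  have hTi : ∀ m, Integrable (T m) μ := fun m => hg.mono' (hTm m) (hTb m)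
  have h5 : Tendsto (fun m => ∫ x, F m x ∂μ - ∫ x, T m x ∂μ) atTop (𝓝 0) := by
    refine squeeze_zero_norm (fun m => ?_) h3
    rw [← integral_sub (hFi m) (hTi m)]
    refine norm_integral_le_of_norm_le
      ((hg.sub (hG m)).pos_part.add ((hG m).sub hg)) ?_
    filter_upwards [hFG m, hfg] with x hx hx'
    have h0 : 0 ≤ g x := (abs_nonneg _).trans hx'
    have hx2 := abs_le.1 hx
    rw [Real.norm_eq_abs]
    simp only [hT]
    rcases le_total (g x) (F m x) with h | h
    · rw [min_eq_left h, max_eq_right (by linarith), abs_of_nonneg (by linarith)]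
      linarith [le_max_right (g x - G m x) 0]
    · rw [min_eq_right h]
      rcases le_total (-g x) (F m x) with h' | h'
      · rw [max_eq_right h', sub_self, abs_zero]
        linarith [le_max_left (g x - G m x) 0]
      · rw [max_eq_left h', abs_of_nonpos (by linarith)]
        linarith [le_max_right (g x - G m x) 0]
  simpa using h5.add h1

end DominatedConvergence

/-! ### Convolution with bump functions, Jensen's inequality and weak derivatives. -/

section Mollification

variable {n : ℕ} {X : Type*} [NormedAddCommGroup X] [NormedSpace ℝ X]

/-- Convolution with a normalized bump function. -/
noncomputable def mollify (ρ : ContDiffBump (0 : Eucl n)) (F : Eucl n → X) : Eucl n → X :=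
  MeasureTheory.convolution (ρ.normed volume) F (ContinuousLinearMap.lsmul ℝ ℝ) volume

theorem mollify_apply (ρ : ContDiffBump (0 : Eucl n)) (F : Eucl n → X) (y : Eucl n) :
    mollify ρ F y = ∫ t, ρ.normed volume (y - t) • F t :=
  convolution_lsmul_swap

theorem integrable_mollify_integrand (ρ : ContDiffBump (0 : Eucl n)) {F : Eucl n → X}
    (hF : LocallyIntegrable F) (y : Eucl n) :
    Integrable fun t => ρ.normed volume (y - t) • F t := by
  refine hF.integrable_smul_left_of_hasCompactSupport
    (ρ.continuous_normed.comp (continuous_const.sub continuous_id)) ?_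
  exact ρ.hasCompactSupport_normed.comp_homeomorph (Homeomorph.subLeft y)

/-- The graph of a convex power lies above its tangent at `c`. In the induction step, multiplication
by `x` produces the next tangent line plus the nonnegative term `(k + 1) c^k (x - c)²`. -/
theorem pow_tangent_le {x c : ℝ} (hx : 0 ≤ x) (hc : 0 ≤ c) (k : ℕ) :
    c ^ (k + 1) + (k + 1) * c ^ k * (x - c) ≤ x ^ (k + 1) := by
  induction k with
  | zero => simp
  | succ k ih =>
    have h1 := mul_le_mul_of_nonneg_left ih hx
    have h2 : 0 ≤ (k + 1) * c ^ k * (x - c) ^ 2 := by positivity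
    push_cast
    have e1 : x ^ (k + 1 + 1) = x * x ^ (k + 1) := by ring
    have e2 : c ^ (k + 1 + 1) + ((k : ℝ) + 1 + 1) * c ^ (k + 1) * (x - c)
      = x * (c ^ (k + 1) + (k + 1) * c ^ k * (x - c)) - (k + 1) * c ^ k * (x - c) ^ 2 := by ring
    linarith

/-- Jensen's inequality for the probability density `ρ(y - ·)`: integrate the tangent inequality at
the mean `c` of `‖F‖`; the linear term integrates to zero. -/
theorem norm_mollify_pow_le (ρ : ContDiffBump (0 : Eucl n)) {F : Eucl n → X}
    (hF : Integrable F) {k : ℕ} (hk : 1 ≤ k) (hFk : Integrable fun y => ‖F y‖ ^ k)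
    (y : Eucl n) : ‖mollify ρ F y‖ ^ k ≤ mollify ρ (fun z => ‖F z‖ ^ k) y := by
  obtain ⟨k, rfl⟩ : ∃ l, k = l + 1 := ⟨k - 1, by omega⟩
  set c := ∫ t, ρ.normed volume (y - t) • ‖F t‖ with hc
  have hρ : ∀ t, 0 ≤ ρ.normed volume (y - t) := fun t => ρ.nonneg_normed _
  have hc0 : 0 ≤ c := integral_nonneg fun t => smul_nonneg (hρ t) (norm_nonneg _)
  have h1 : ‖mollify ρ F y‖ ≤ c := by
    rw [mollify_apply]
    refine (norm_integral_le_integral_norm _).trans_eq (integral_congr_ae (ae_of_all _ fun t => ?_))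
    simp only [norm_smul, smul_eq_mul]
    rw [Real.norm_of_nonneg (hρ t)]
  refine (pow_le_pow_left₀ (norm_nonneg _) h1 _).trans ?_
  rw [mollify_apply]
  have i1 := integrable_mollify_integrand ρ hF.norm.locallyIntegrable y
  have i2 := integrable_mollify_integrand ρ hFk.locallyIntegrable y
  have i3 : Integrable fun t => ρ.normed volume (y - t) :=
    ρ.integrable_normed.comp_sub_left y
  have i3' : ∫ t, ρ.normed volume (y - t) = 1 := by
    rw [integral_sub_left_eq_self (fun t => ρ.normed volume t) volume y]
    exact ρ.integral_normed
  have key : ∫ t, (c ^ (k + 1) * ρ.normed volume (y - t)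
      + (k + 1) * c ^ k * (ρ.normed volume (y - t) • ‖F t‖ - c * ρ.normed volume (y - t)))
      ≤ ∫ t, ρ.normed volume (y - t) • ‖F t‖ ^ (k + 1) := by
    refine integral_mono ((i3.const_mul _).add ((i1.sub (i3.const_mul _)).const_mul _)) i2
      fun t => ?_
    have := mul_le_mul_of_nonneg_left (pow_tangent_le (norm_nonneg (F t)) hc0 k) (hρ t)
    simp only [smul_eq_mul]
    linarith
  have i4 : Integrable fun t => ρ.normed volume (y - t) • ‖F t‖ - c * ρ.normed volume (y - t) :=
    i1.sub (i3.const_mul _)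
  rw [integral_add (i3.const_mul _) (i4.const_mul _),
    integral_const_mul, integral_const_mul, integral_sub i1 (i3.const_mul _),
    integral_const_mul, i3', ← hc] at key
  simpa using key

theorem integral_mollify [CompleteSpace X] (ρ : ContDiffBump (0 : Eucl n)) {F : Eucl n → X} (hF : Integrable F) :
    ∫ y, mollify ρ F y = ∫ y, F y := by
  unfold mollify
  rw [integral_convolution _ ρ.integrable_normed hF, ρ.integral_normed]
  simp

theorem integrable_mollify (ρ : ContDiffBump (0 : Eucl n)) {F : Eucl n → X} (hF : Integrable F) :
    Integrable (mollify ρ F) :=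
  ρ.integrable_normed.integrable_convolution _ hF

theorem contDiff_mollify (ρ : ContDiffBump (0 : Eucl n)) {F : Eucl n → X} [CompleteSpace X]
    (hF : LocallyIntegrable F) : ContDiff ℝ ∞ (mollify ρ F) :=
  ρ.hasCompactSupport_normed.contDiff_convolution_left _ ρ.contDiff_normed hF

theorem mollify_pi_apply {ι : Type*} [Fintype ι] (ρ : ContDiffBump (0 : Eucl n))
    {F : Eucl n → ι → X} [CompleteSpace X]
    (hF : LocallyIntegrable F) (y : Eucl n) (i : ι) :
    mollify ρ F y i = mollify ρ (fun z => F z i) y := by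
  rw [mollify_apply, mollify_apply]
  have := (ContinuousLinearMap.proj (R := ℝ) (φ := fun _ : ι => X) i).integral_comp_comm
    (integrable_mollify_integrand ρ hF y)
  exact this.symm

/-- `g` is the weak derivative of `f` in the `b`-th direction on `V`. -/
def HasWeakPDeriv (V : Set (Eucl n)) (b : Fin n) (f g : Eucl n → ℝ) : Prop :=
  ∀ η : Eucl n → ℝ, ContDiff ℝ ∞ η → HasCompactSupport η → tsupport η ⊆ V →
    ∫ y, f y * pderiv b η y = -∫ y, g y * η y

theorem hasWeakPDeriv_pderiv {V : Set (Eucl n)} (hV : IsOpen V) {f : Eucl n → ℝ}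
    (hf : ContDiffOn ℝ 1 f V) (b : Fin n) : HasWeakPDeriv V b f (pderiv b f) := by
  intro η hη hc hηV
  have := integral_mul_pderiv hV hf (hη.of_le (by exact_mod_cast le_top)) hc hηV b
  simp only [mul_comm _ (η _), this, neg_neg]

/-- The derivative falls on the kernel, and `t ↦ ρ(y - t)` is an admissible test function for the
weak derivative because its support lies in a ball contained in `V`. -/
theorem pderiv_mollify {V : Set (Eucl n)} {b : Fin n} {f g : Eucl n → ℝ}
    (hV : IsOpen V) (hf : IntegrableOn f V) (hfg : HasWeakPDeriv V b f g)
    (ρ : ContDiffBump (0 : Eucl n)) {y : Eucl n} (hy : Metric.closedBall y ρ.rOut ⊆ V) :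
    pderiv b (mollify ρ (V.indicator f)) y = mollify ρ (V.indicator g) y := by
  have hfi : LocallyIntegrable (V.indicator f) :=
    ((integrable_indicator_iff hV.measurableSet).2 hf).locallyIntegrable
  -- The factors are interchanged so that the differentiation theorem applies with the smooth kernel
  -- on the right.
  have e1 : mollify ρ (V.indicator f) = MeasureTheory.convolution (V.indicator f)
      (ρ.normed volume) (ContinuousLinearMap.mul ℝ ℝ) volume := by
    funext z
    rw [mollify_apply, convolution_mul]
    simp only [smul_eq_mul, mul_comm]
  have hd := ρ.hasCompactSupport_normed.hasFDerivAt_convolution_right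
    (ContinuousLinearMap.mul ℝ ℝ) hfi (ρ.contDiff_normed (μ := volume) (n := 1)) y
  rw [pderiv, e1, hd.fderiv, convolution_precompR_apply _ hfi
    (ρ.hasCompactSupport_normed.fderiv ℝ)
    ((ρ.contDiff_normed (μ := volume) (n := 1)).continuous_fderiv one_ne_zero),
    convolution_mul, mollify_apply]
  set η : Eucl n → ℝ := fun t => ρ.normed volume (y - t) with hη
  have hηs : ContDiff ℝ ∞ η := ρ.contDiff_normed.comp (contDiff_const.sub contDiff_id)
  have hηc : HasCompactSupport η := ρ.hasCompactSupport_normed.comp_homeomorph (Homeomorph.subLeft y)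
  have hηt : tsupport η ⊆ V := by
    refine (closure_minimal (fun t ht => ?_) Metric.isClosed_closedBall).trans hy
    have : y - t ∈ Function.support (ρ.normed volume) := ht
    rw [ρ.support_normed_eq] at this
    rw [Metric.mem_closedBall, dist_comm, dist_eq_norm]
    simpa using (mem_ball_zero_iff.1 this).le
  have hηd : ∀ t, pderiv b η t = -fderiv ℝ (ρ.normed volume) (y - t) (basisVec b) := by
    intro t
    have h1 := ((ρ.contDiff_normed (μ := volume) (n := 1)).differentiable one_ne_zero
      (y - t)).hasFDerivAt.comp t ((hasFDerivAt_const y t).sub (hasFDerivAt_id t))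
    rw [pderiv]
    erw [h1.fderiv]
    simp
  have h2 := hfg η hηs hηc hηt
  have h3 : ∀ t, V.indicator f t * fderiv ℝ (ρ.normed volume) (y - t) (basisVec b)
      = -(f t * pderiv b η t) := by
    intro t
    by_cases ht : t ∈ V
    · rw [indicator_of_mem ht, hηd]; ring
    · have : pderiv b η t = 0 := image_eq_zero_of_notMem_tsupport fun h =>
        ht (hηt (tsupport_pderiv_subset b η h))
      rw [indicator_of_notMem ht, this]; simp
  have h4 : ∀ t, η t • V.indicator g t = g t * η t := by
    intro t
    by_cases ht : t ∈ V
    · rw [indicator_of_mem ht, smul_eq_mul, mul_comm]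
    · rw [indicator_of_notMem ht, image_eq_zero_of_notMem_tsupport fun h => ht (hηt h)]
      simp
  rw [integral_congr_ae (ae_of_all _ h3), integral_congr_ae (ae_of_all _ h4), integral_neg, h2,
    neg_neg]

end Mollification

/-! ### Null Lagrangians of functions with a weak Hessian. -/

section WeakHessian

variable {n : ℕ}

/-- A sequence of bump functions shrinking to the origin. -/
noncomputable def shrinkingBump (n : ℕ) (m : ℕ) : ContDiffBump (0 : Eucl n) where
  rIn := 1 / ((m : ℝ) + 1)
  rOut := 2 * (1 / ((m : ℝ) + 1))
  rIn_pos := by positivity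
  rIn_lt_rOut := by
    have : 0 < 1 / ((m : ℝ) + 1) := by positivity
    linarith

theorem tendsto_shrinkingBump_rOut (n : ℕ) :
    Tendsto (fun m => (shrinkingBump n m).rOut) atTop (𝓝 0) := by
  have := (tendsto_one_div_add_atTop_nhds_zero_nat (𝕜 := ℝ)).const_mul 2
  simpa [shrinkingBump] using this

theorem ae_tendsto_mollify {X : Type*} [NormedAddCommGroup X] [NormedSpace ℝ X] [CompleteSpace X]
    {F : Eucl n → X} (hF : LocallyIntegrable F) :
    ∀ᵐ y, Tendsto (fun m => mollify (shrinkingBump n m) F y) atTop (𝓝 (F y)) :=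
  ContDiffBump.ae_convolution_tendsto_right_of_locallyIntegrable (K := 2)
    (tendsto_shrinkingBump_rOut n) (Eventually.of_forall fun m => by simp [shrinkingBump]) hF

theorem le_one_add_pow {x : ℝ} (hx : 0 ≤ x) {k : ℕ} (hk : 1 ≤ k) : x ≤ 1 + x ^ k := by
  rcases le_total x 1 with h | h
  · linarith [pow_nonneg hx k]
  · have : x ^ 1 ≤ x ^ k := pow_le_pow_right₀ h hk
    linarith [pow_one x]

/-- Data of a `C¹` function on `V` with weak Hessian in `L^k`. -/
structure HasWeakHess (V : Set (Eucl n)) (k : ℕ) (w : Eucl n → ℝ)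
    (h : Eucl n → Fin n → Fin n → ℝ) : Prop where
  contDiffOn : ContDiffOn ℝ 1 w V
  integrableOn : IntegrableOn w V
  integrableOn_pderiv : ∀ a, IntegrableOn (pderiv a w) V
  aestronglyMeasurable : AEStronglyMeasurable h (volume.restrict V)
  integrableOn_pow : IntegrableOn (fun y => ‖h y‖ ^ k) V
  weak : ∀ a b, HasWeakPDeriv V b (pderiv a w) fun y => h y a b

variable {V : Set (Eucl n)} {k : ℕ} {w : Eucl n → ℝ} {h : Eucl n → Fin n → Fin n → ℝ}

theorem HasWeakHess.integrableOn_norm (H : HasWeakHess V k w h) (hk : 1 ≤ k)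
    (hVf : volume V ≠ ⊤) : IntegrableOn h V := by
  have : IsFiniteMeasure (volume.restrict V) := ⟨by simpa using hVf.lt_top⟩
  exact ((integrable_const (1 : ℝ)).add H.integrableOn_pow).mono' H.aestronglyMeasurable
    (ae_of_all _ fun y => le_one_add_pow (norm_nonneg _) hk)

theorem indicator_norm_pow (hk : 1 ≤ k) (y : Eucl n) :
    ‖V.indicator h y‖ ^ k = V.indicator (fun z => ‖h z‖ ^ k) y := by
  by_cases hy : y ∈ V
  · simp [hy]
  · simp [hy]; omega

/-- Two differentiations, hence twice the radius: the formula for the first derivative is needed on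
a whole ball of radius `ρ.rOut` around `y` before it can be differentiated again. -/
theorem HasWeakHess.hess_mollify (H : HasWeakHess V k w h) (hV : IsOpen V) (hk : 1 ≤ k)
    (hVf : volume V ≠ ⊤) (ρ : ContDiffBump (0 : Eucl n)) {y : Eucl n}
    (hy : Metric.closedBall y (2 * ρ.rOut) ⊆ V) :
    hess (mollify ρ (V.indicator w)) y = mollify ρ (V.indicator h) y := by
  have hi : LocallyIntegrable (V.indicator h) := ((integrable_indicator_iff hV.measurableSet).2
    (H.integrableOn_norm hk hVf)).locallyIntegrable
  have hi' : ∀ a, LocallyIntegrable fun z => V.indicator h z a := fun a => by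
    have := ((ContinuousLinearMap.proj (R := ℝ) (φ := fun _ : Fin n => Fin n → ℝ) a).integrable_comp
      ((integrable_indicator_iff hV.measurableSet).2 (H.integrableOn_norm hk hVf)))
    exact this.locallyIntegrable
  have hr := ρ.rOut_pos
  funext a b
  rw [mollify_pi_apply ρ hi y a, mollify_pi_apply ρ (hi' a) y b]
  have e1 : pderiv a (mollify ρ (V.indicator w)) =ᶠ[𝓝 y]
      mollify ρ (V.indicator (pderiv a w)) := by
    filter_upwards [Metric.ball_mem_nhds y hr] with z hz
    refine pderiv_mollify hV H.integrableOn (hasWeakPDeriv_pderiv hV H.contDiffOn a) ρ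
      ((Metric.closedBall_subset_closedBall' ?_).trans hy)
    linarith [Metric.mem_ball.1 hz]
  have e2 : (fun z => V.indicator h z a b) = V.indicator fun z => h z a b := by
    funext z
    by_cases hz : z ∈ V <;> simp [hz]
  rw [e2]
  change fderiv ℝ (pderiv a (mollify ρ (V.indicator w))) y (basisVec b) = _
  rw [e1.fderiv_eq]
  exact pderiv_mollify hV (H.integrableOn_pderiv a) (H.weak a b) ρ
    ((Metric.closedBall_subset_closedBall (by linarith)).trans hy)

theorem eventually_closedBall_subset {K : Set (Eucl n)} (hV : IsOpen V) (hK : IsCompact K)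
    (hKV : K ⊆ V) : ∀ᶠ m in atTop, ∀ y ∈ K,
      Metric.closedBall y (2 * (shrinkingBump n m).rOut) ⊆ V := by
  obtain ⟨δ, hδ, hδV⟩ := hK.exists_cthickening_subset_open hV hKV
  have h2 : Tendsto (fun m => 2 * (shrinkingBump n m).rOut) atTop (𝓝 0) := by
    simpa using (tendsto_shrinkingBump_rOut n).const_mul 2
  filter_upwards [h2.eventually (gt_mem_nhds hδ)] with m hm y hy
  exact ((Metric.closedBall_subset_closedBall hm.le).trans
    (Metric.closedBall_subset_cthickening hy δ)).trans hδV

/-- The mollified derivative averages `pderiv a w` over small balls, and `pderiv a w` is uniformly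
continuous on a compact thickening of `K`. -/
theorem eventually_pderiv_mollify_close {K : Set (Eucl n)} (hV : IsOpen V) (hK : IsCompact K)
    (hKV : K ⊆ V) (H : HasWeakHess V k w h) {ε : ℝ} (hε : 0 < ε) (a : Fin n) :
    ∀ᶠ m in atTop, ∀ y ∈ K,
      |pderiv a (mollify (shrinkingBump n m) (V.indicator w)) y - pderiv a w y| ≤ ε := by
  obtain ⟨δ, hδ, hδV⟩ := hK.exists_cthickening_subset_open hV hKV
  have huc := (hK.cthickening (r := δ)).uniformContinuousOn_of_continuous
    ((continuousOn_pderiv hV H.contDiffOn a).mono hδV)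
  obtain ⟨δ', hδ', huc⟩ := Metric.uniformContinuousOn_iff.1 huc ε hε
  filter_upwards [eventually_closedBall_subset hV hK hKV,
    (tendsto_shrinkingBump_rOut n).eventually (gt_mem_nhds hδ),
    (tendsto_shrinkingBump_rOut n).eventually (gt_mem_nhds hδ')] with m h1 h2 h3 y hy
  have hr := (shrinkingBump n m).rOut_pos
  rw [pderiv_mollify hV H.integrableOn (hasWeakPDeriv_pderiv hV H.contDiffOn a) _
    ((Metric.closedBall_subset_closedBall (by linarith)).trans (h1 y hy)),
    ← Real.dist_eq]
  have hyV : V.indicator (pderiv a w) y = pderiv a w y := indicator_of_mem (hKV hy) _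
  rw [← hyV]
  refine ContDiffBump.dist_normed_convolution_le
    ((integrable_indicator_iff hV.measurableSet).2 (H.integrableOn_pderiv a)).aestronglyMeasurable
    fun z hz => ?_
  have hzK : z ∈ Metric.cthickening δ K :=
    Metric.closedBall_subset_cthickening hy δ
      (Metric.mem_closedBall.2 ((Metric.mem_ball.1 hz).le.trans h2.le))
  rw [hyV, indicator_of_mem (hδV hzK)]
  exact (huc z hzK y (Metric.self_subset_cthickening K hy) ((Metric.mem_ball.1 hz).trans h3)).le

/-- The mollified Hessians converge almost everywhere. By Jensen the integrands are bounded by a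
constant times the indicator of the support plus the mollification of `‖h‖^k`; this bound moves with
`m`, but its integral does not, which is the situation of `tendsto_integral_of_dominated_sequence`.
-/
theorem tendsto_integral_nullLagr_mollify (hV : IsOpen V) (hVf : volume V ≠ ⊤) (hk : 1 ≤ k)
    (H : HasWeakHess V k w h) {r : Fin n → Fin n ⊕ Fin n} (hr : rowDeg r ≤ k) {η : Eucl n → ℝ}
    (hη : Continuous η) (hc : HasCompactSupport η) (hηV : tsupport η ⊆ V) :
    Tendsto (fun m => ∫ y, η y * nullLagr r (hess (mollify (shrinkingBump n m) (V.indicator w)) y))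
      atTop (𝓝 (∫ y, η y * nullLagr r (h y))) := by
  have hi : Integrable (V.indicator h) := (integrable_indicator_iff hV.measurableSet).2
    (H.integrableOn_norm hk hVf)
  have hik : Integrable fun y => ‖V.indicator h y‖ ^ k := by
    simp_rw [indicator_norm_pow hk]
    exact (integrable_indicator_iff hV.measurableSet).2 H.integrableOn_pow
  obtain ⟨B, hB⟩ := hη.bounded_above_of_compact_support hc
  have hB0 : 0 ≤ B := (norm_nonneg _).trans (hB 0)
  set C := ‖detRows n‖ with hC
  have hC0 : 0 ≤ C := norm_nonneg _
  have hKm : MeasurableSet (tsupport η) := (isClosed_tsupport η).measurableSet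
  have h1K : Integrable ((tsupport η).indicator fun _ => (1 : ℝ)) :=
    (integrable_indicator_iff hKm).2 (integrableOn_const hc.measure_lt_top.ne)
  have key : Tendsto (fun m => ∫ y, η y * nullLagr r (mollify (shrinkingBump n m) (V.indicator h) y))
      atTop (𝓝 (∫ y, η y * nullLagr r (V.indicator h y))) := by
    refine tendsto_integral_of_dominated_sequence
      (G := fun m y => B * C * ((tsupport η).indicator (fun _ => (1 : ℝ)) y
        + mollify (shrinkingBump n m) (fun z => ‖V.indicator h z‖ ^ k) y))
      (g := fun y => B * C * ((tsupport η).indicator (fun _ => (1 : ℝ)) y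
        + ‖V.indicator h y‖ ^ k)) ?_ ?_ ?_ ?_ ?_ ?_ ?_
    · intro m
      exact (hη.mul ((continuous_nullLagr r).comp
        (contDiff_mollify _ hi.locallyIntegrable).continuous)).aestronglyMeasurable
    · exact fun m => (h1K.add (integrable_mollify _ hik)).const_mul _
    · exact (h1K.add hik).const_mul _
    · refine fun m => ae_of_all _ fun y => ?_
      have hm := norm_mollify_pow_le (shrinkingBump n m) hi hk hik y
      have hm0 : 0 ≤ mollify (shrinkingBump n m) (fun z => ‖V.indicator h z‖ ^ k) y :=
        (pow_nonneg (norm_nonneg _) _).trans hm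
      by_cases hy : y ∈ tsupport η
      · rw [indicator_of_mem hy, abs_mul, mul_assoc]
        refine mul_le_mul (hB y) ((abs_nullLagr_le hr _).trans ?_) (abs_nonneg _) hB0
        exact mul_le_mul_of_nonneg_left (by linarith) hC0
      · rw [image_eq_zero_of_notMem_tsupport hy, indicator_of_notMem hy]
        simp only [zero_mul, abs_zero, zero_add]
        positivity
    · filter_upwards [ae_tendsto_mollify hi.locallyIntegrable] with y hy
      exact (((continuous_nullLagr r).tendsto _).comp hy).const_mul _
    · filter_upwards [ae_tendsto_mollify hik.locallyIntegrable] with y hy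
      exact (hy.const_add _).const_mul _
    · refine tendsto_const_nhds.congr fun m => ?_
      rw [integral_const_mul, integral_const_mul, integral_add h1K hik,
        integral_add h1K (integrable_mollify _ hik), integral_mollify _ hik]
  have e1 : ∀ y, η y * nullLagr r (V.indicator h y) = η y * nullLagr r (h y) := by
    intro y
    by_cases hy : y ∈ V
    · rw [indicator_of_mem hy]
    · rw [image_eq_zero_of_notMem_tsupport fun hh => hy (hηV hh), zero_mul, zero_mul]
  simp_rw [e1] at key
  refine key.congr' ?_
  filter_upwards [eventually_closedBall_subset hV hc hηV] with m hm
  refine integral_congr_ae (ae_of_all _ fun y => ?_)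
  by_cases hy : y ∈ tsupport η
  · simp only [H.hess_mollify hV hk hVf _ (hm y hy)]
  · simp only [image_eq_zero_of_notMem_tsupport hy, zero_mul]

/-- Apply the smooth estimate to `f` and the mollifications of `w`, let the mollification parameter
tend to zero, and then remove the slack `ε` in the gradients. -/
theorem abs_integral_nullLagr_sub_weak_le (hV : IsOpen V) (hVf : volume V ≠ ⊤) (hk : 1 ≤ k)
    (H : HasWeakHess V k w h) {r : Fin n → Fin n ⊕ Fin n} (hr : rowDeg r ≤ k) {η : Eucl n → ℝ}
    (hη : ContDiff ℝ 1 η) (hc : HasCompactSupport η) (hηV : tsupport η ⊆ V)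
    {D δ : ℝ} (hD : ∀ y b, |pderiv b η y| ≤ D) (hδ0 : 0 ≤ δ)
    {f : Eucl n → ℝ} (hf : ContDiffOn ℝ 3 f V)
    (hδ : ∀ y ∈ tsupport η, ∀ l, |pderiv l f y - pderiv l w y| ≤ δ) :
    |(∫ y, η y * nullLagr r (hess f y)) - ∫ y, η y * nullLagr r (h y)|
      ≤ n * (δ * (‖detRows n‖ * D) * ((∫ y in tsupport η, (1 + ‖hess f y‖ ^ k))
        + ∫ y in V, ‖h y‖ ^ k)) := by
  set W : ℕ → Eucl n → ℝ := fun m => mollify (shrinkingBump n m) (V.indicator w) with hW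
  have hWs : ∀ m, ContDiff ℝ ∞ (W m) := fun m => contDiff_mollify _
    ((integrable_indicator_iff hV.measurableSet).2 H.integrableOn).locallyIntegrable
  have hWs3 : ∀ m, ContDiffOn ℝ 3 (W m) V := fun m =>
    (contDiff_infty.1 (hWs m) 3).contDiffOn
  have hlim := (tendsto_integral_nullLagr_mollify hV hVf hk H hr hη.continuous hc hηV).const_sub
    (∫ y, η y * nullLagr r (hess f y))
  have hf2 : ContDiffOn ℝ 2 f V := hf.of_le (by norm_num)
  have hif : IntegrableOn (fun y => 1 + ‖hess f y‖ ^ k) (tsupport η) :=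
    ContinuousOn.integrableOn_compact hc
      ((continuousOn_const.add ((continuousOn_hess hV hf2).norm.pow k)).mono hηV)
  have hik : Integrable fun y => ‖V.indicator h y‖ ^ k := by
    simp_rw [indicator_norm_pow hk]
    exact (integrable_indicator_iff hV.measurableSet).2 H.integrableOn_pow
  have hi : Integrable (V.indicator h) := (integrable_indicator_iff hV.measurableSet).2
    (H.integrableOn_norm hk hVf)
  have hpt : ∀ ε : ℝ, 0 < ε → |(∫ y, η y * nullLagr r (hess f y)) - ∫ y, η y * nullLagr r (h y)|
      ≤ n * ((δ + ε) * (‖detRows n‖ * D) * ((∫ y in tsupport η, (1 + ‖hess f y‖ ^ k))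
        + ∫ y in V, ‖h y‖ ^ k)) := by
    intro ε hε
    refine le_of_tendsto hlim.abs ?_
    filter_upwards [eventually_all.2 fun a => eventually_pderiv_mollify_close hV hc hηV H hε a,
      eventually_closedBall_subset hV hc hηV] with m hm hm'
    -- The sign of `D` is forced only if there is a coordinate direction; for `n = 0` the factor `n`
    -- in the bound takes over.
    have hD0 : n = 0 ∨ 0 ≤ D := by
      rcases Nat.eq_zero_or_pos n with h0 | h0
      · exact Or.inl h0
      · exact Or.inr ((abs_nonneg _).trans (hD 0 ⟨0, h0⟩))
    have hest := abs_integral_nullLagr_sub_le hV hf (hWs3 m) hr hη hc hηV hD (δ := δ + ε)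
      (fun y hy l => by
        have h1 := hδ y hy l
        have h2 := hm l y hy
        rw [abs_sub_comm] at h2
        calc |pderiv l f y - pderiv l (W m) y|
            = |(pderiv l f y - pderiv l w y) + (pderiv l w y - pderiv l (W m) y)| := by ring_nf
          _ ≤ _ := (abs_add_le _ _).trans (add_le_add h1 h2)) (by linarith)
    have hiη : ∀ {g : Eucl n → ℝ}, ContDiffOn ℝ 3 g V →
        Integrable fun y => η y * nullLagr r (hess g y) := fun {g} hg =>
      integrable_mul_of_tsupport_subset hV hη.continuous hc hηV
        ((continuous_nullLagr r).comp_continuousOn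
          (continuousOn_hess hV (hg.of_le (by norm_num))))
    simp_rw [mul_sub] at hest
    rw [integral_sub (hiη hf) (hiη (hWs3 m))] at hest
    refine hest.trans ?_
    rcases hD0 with h0 | hD0
    · simp [h0]
    have hiW : IntegrableOn (fun y => ‖hess (W m) y‖ ^ k) (tsupport η) :=
      ContinuousOn.integrableOn_compact hc (((continuousOn_hess hV
        ((hWs3 m).of_le (by norm_num))).norm.pow k).mono hηV)
    -- Jensen's inequality and the conservation of mass under mollification give a bound independent
    -- of `m`.
    have hle : ∫ y in tsupport η, ‖hess (W m) y‖ ^ k ≤ ∫ y in V, ‖h y‖ ^ k := by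
      calc ∫ y in tsupport η, ‖hess (W m) y‖ ^ k
          ≤ ∫ y in tsupport η, mollify (shrinkingBump n m) (fun z => ‖V.indicator h z‖ ^ k) y := by
            refine setIntegral_mono_on hiW (integrable_mollify _ hik).integrableOn
              (isClosed_tsupport η).measurableSet fun y hy => ?_
            rw [H.hess_mollify hV hk hVf _ (hm' y hy)]
            exact norm_mollify_pow_le _ hi hk hik y
        _ ≤ ∫ y, mollify (shrinkingBump n m) (fun z => ‖V.indicator h z‖ ^ k) y :=
            setIntegral_le_integral (integrable_mollify _ hik) (ae_of_all _ fun y =>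
              (pow_nonneg (norm_nonneg _) _).trans (norm_mollify_pow_le _ hi hk hik y))
        _ = ∫ y, ‖V.indicator h y‖ ^ k := integral_mollify _ hik
        _ = _ := by
            simp_rw [indicator_norm_pow hk]
            exact integral_indicator hV.measurableSet
    rw [integral_add hif hiW]
    gcongr
  have hcont : Tendsto (fun ε : ℝ => n * ((δ + ε) * (‖detRows n‖ * D) *
      ((∫ y in tsupport η, (1 + ‖hess f y‖ ^ k)) + ∫ y in V, ‖h y‖ ^ k))) (𝓝[>] 0)
      (𝓝 (n * ((δ + 0) * (‖detRows n‖ * D) *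
      ((∫ y in tsupport η, (1 + ‖hess f y‖ ^ k)) + ∫ y in V, ‖h y‖ ^ k)))) :=
    (Continuous.tendsto (by fun_prop) 0).mono_left nhdsWithin_le_nhds
  rw [add_zero] at hcont
  exact ge_of_tendsto hcont (by filter_upwards [self_mem_nhdsWithin] with ε hε using hpt ε hε)

end WeakHessian

/-! ### Weak continuity of null Lagrangians with variable coefficients. -/

section WeakContinuity

variable {n : ℕ} {V : Set (Eucl n)} {k : ℕ}

/-- Removing the values of `c` of size at most `ε / 2` confines the support to the closed set `{ε /
2 ≤ |c|}`, which lies inside `V`; the smoothing can be chosen without enlarging the support. -/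
theorem exists_smooth_approx_of_eq_zero_off (hVb : Bornology.IsBounded V) {c : Eucl n → ℝ}
    (hc : Continuous c) (hc0 : ∀ y ∉ V, c y = 0) {ε : ℝ} (hε : 0 < ε) :
    ∃ η : Eucl n → ℝ, ContDiff ℝ ∞ η ∧ HasCompactSupport η ∧ tsupport η ⊆ V ∧
      ∀ y, |η y - c y| ≤ ε := by
  set θ : Eucl n → ℝ := fun y => c y - max (-(ε / 2)) (min (ε / 2) (c y)) with hθ
  have hθc : Continuous θ := by fun_prop
  obtain ⟨η, h1, h2, h3⟩ := hθc.exists_contDiff_approx ⊤ (ε := fun _ => ε / 2)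
    continuous_const (fun _ => by linarith)
  have hts : tsupport η ⊆ {y | ε / 2 ≤ |c y|} := by
    refine closure_minimal (h3.trans fun y hy => ?_) (isClosed_le continuous_const hc.abs)
    by_contra hlt
    simp only [mem_ofPred_eq, not_le] at hlt
    have := abs_lt.1 hlt
    refine hy ?_
    simp only [hθ]
    rw [min_eq_right this.2.le, max_eq_right this.1.le, sub_self]
  have hsV : tsupport η ⊆ V := fun y hy => by
    by_contra hyV
    have := hts hy
    simp only [mem_ofPred_eq, hc0 y hyV, abs_zero] at this
    linarith
  refine ⟨η, h1, ?_, hsV, fun y => ?_⟩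
  · exact Metric.isCompact_of_isClosed_isBounded (isClosed_tsupport _) (hVb.subset hsV)
  · have h4 := (h2 y).le
    rw [Real.dist_eq] at h4
    have h5 : |θ y - c y| ≤ ε / 2 := by
      simp only [hθ]
      rw [sub_sub_cancel_left, abs_neg, abs_le]
      exact ⟨le_max_left _ _, max_le (by linarith) (min_le_left _ _)⟩
    calc |η y - c y| = |(η y - θ y) + (θ y - c y)| := by ring_nf
      _ ≤ ε / 2 + ε / 2 := (abs_add_le _ _).trans (add_le_add h4 h5)
      _ = ε := by ring

theorem integrableOn_mul_nullLagr (hV : MeasurableSet V) (hVf : volume V ≠ ⊤)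
    {r : Fin n → Fin n ⊕ Fin n} (hr : rowDeg r ≤ k) {A : Eucl n → Fin n → Fin n → ℝ}
    (hA : AEStronglyMeasurable A (volume.restrict V)) (hAk : IntegrableOn (fun y => ‖A y‖ ^ k) V)
    {c : Eucl n → ℝ} (hc : AEStronglyMeasurable c (volume.restrict V)) {B : ℝ}
    (hB : ∀ y ∈ V, |c y| ≤ B) :
    IntegrableOn (fun y => c y * nullLagr r (A y)) V ∧
      |∫ y in V, c y * nullLagr r (A y)|
        ≤ B * (‖detRows n‖ * (volume.real V + ∫ y in V, ‖A y‖ ^ k)) := by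
  have : IsFiniteMeasure (volume.restrict V) := ⟨by simpa using hVf.lt_top⟩
  have hi : IntegrableOn (fun y => B * (‖detRows n‖ * (1 + ‖A y‖ ^ k))) V :=
    (((integrable_const (1 : ℝ)).add hAk).const_mul _).const_mul _
  have hb : ∀ᵐ y ∂(volume.restrict V), ‖c y * nullLagr r (A y)‖
      ≤ B * (‖detRows n‖ * (1 + ‖A y‖ ^ k)) := by
    filter_upwards [ae_restrict_mem hV] with y hy
    rw [norm_mul]
    exact mul_le_mul (hB y hy) (abs_nullLagr_le hr _) (abs_nonneg _)
      ((abs_nonneg _).trans (hB y hy))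
  refine ⟨hi.mono' (hc.mul ((continuous_nullLagr r).comp_aestronglyMeasurable hA)) hb, ?_⟩
  refine (norm_integral_le_of_norm_le hi hb).trans_eq ?_
  rw [integral_const_mul, integral_const_mul, integral_add (integrable_const _) hAk]
  simp

/-- Replace both the moving coefficient `c' j` and the limit coefficient `c` by one smooth `η` with
compact support in `V`. The replacement errors are small uniformly in `j` by the `L^k` bounds, and
for the fixed `η` the gradient estimate applies. -/
theorem tendsto_integral_mul_nullLagr (hV : IsOpen V) (hVb : Bornology.IsBounded V) (hk : 1 ≤ k)
    {w : Eucl n → ℝ} {h : Eucl n → Fin n → Fin n → ℝ} (H : HasWeakHess V k w h)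
    {r : Fin n → Fin n ⊕ Fin n} (hr : rowDeg r ≤ k) {f : ℕ → Eucl n → ℝ}
    (hf : ∀ j, ContDiffOn ℝ 3 (f j) V)
    (hfw : ∀ ε : ℝ, 0 < ε → ∀ᶠ j in atTop, ∀ y ∈ V, ∀ l, |pderiv l (f j) y - pderiv l w y| ≤ ε)
    (hfi : ∀ j, IntegrableOn (fun y => ‖hess (f j) y‖ ^ k) V) {C : ℝ}
    (hfC : ∀ j, ∫ y in V, ‖hess (f j) y‖ ^ k ≤ C)
    {c : Eucl n → ℝ} (hc : Continuous c) (hc0 : ∀ y ∉ V, c y = 0)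
    {c' : ℕ → Eucl n → ℝ} (hc' : ∀ j, ContinuousOn (c' j) V)
    (hcc : ∀ ε : ℝ, 0 < ε → ∀ᶠ j in atTop, ∀ y ∈ V, |c' j y - c y| ≤ ε) :
    Tendsto (fun j => ∫ y in V, c' j y * nullLagr r (hess (f j) y)) atTop
      (𝓝 (∫ y in V, c y * nullLagr r (h y))) := by
  have hVf : volume V ≠ ⊤ := hVb.measure_lt_top.ne
  have hVm := hV.measurableSet
  have : IsFiniteMeasure (volume.restrict V) := ⟨by simpa using hVf.lt_top⟩
  set Q := ‖detRows n‖ * (volume.real V + C) with hQ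
  set Q' := ‖detRows n‖ * (volume.real V + ∫ y in V, ‖h y‖ ^ k) with hQ'
  have hC0 : 0 ≤ C := (integral_nonneg fun y => by positivity).trans (hfC 0)
  have hQ0 : 0 ≤ Q := by positivity
  have hQ0' : 0 ≤ Q' := mul_nonneg (norm_nonneg _)
    (add_nonneg (by positivity) (integral_nonneg fun y => by positivity))
  have hfm : ∀ j, AEStronglyMeasurable (hess (f j)) (volume.restrict V) := fun j =>
    (continuousOn_hess hV ((hf j).of_le (by norm_num))).aestronglyMeasurable hVm
  have hfV : ∀ j {b : Eucl n → ℝ} {B : ℝ}, AEStronglyMeasurable b (volume.restrict V) →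
      (∀ y ∈ V, |b y| ≤ B) → 0 ≤ B → IntegrableOn (fun y => b y * nullLagr r (hess (f j) y)) V ∧
      |∫ y in V, b y * nullLagr r (hess (f j) y)| ≤ B * Q := by
    intro j b B hb hB hB0
    obtain ⟨h1, h2⟩ := integrableOn_mul_nullLagr hVm hVf hr (hfm j) (hfi j) hb hB
    refine ⟨h1, h2.trans ?_⟩
    have := hfC j
    rw [hQ]
    gcongr
  have hcs : HasCompactSupport c := by
    refine Metric.isCompact_of_isClosed_isBounded (isClosed_tsupport _)
      (hVb.closure.subset (closure_mono fun y hy => ?_))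
    by_contra hyV
    exact hy (hc0 y hyV)
  obtain ⟨Bc, hBc⟩ := hc.bounded_above_of_compact_support hcs
  rw [Metric.tendsto_nhds]
  intro ε₀ hε₀
  -- The error budget: `ε Q` for `c' j - c`, `ε Q` and `ε Q'` for `η - c` against the sequence and
  -- against the limit, and `ε` for the comparison with coefficient `η`.
  obtain ⟨ε, hε, hεlt⟩ : ∃ ε : ℝ, 0 < ε ∧ ε * (2 * Q + Q' + 1) < ε₀ := by
    refine ⟨ε₀ / (2 * (2 * Q + Q' + 1)), by positivity, ?_⟩
    rw [div_mul_eq_mul_div, div_lt_iff₀ (by positivity)]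
    nlinarith [mul_pos hε₀ (show 0 < 2 * Q + Q' + 1 by positivity)]
  obtain ⟨η, hη, hηc, hηV, hηε⟩ := exists_smooth_approx_of_eq_zero_off hVb hc hc0 hε
  have hη1 : ContDiff ℝ 1 η := hη.of_le (by exact_mod_cast le_top)
  obtain ⟨D, hD⟩ : ∃ D, ∀ y (b : Fin n), |pderiv b η y| ≤ D := by
    have h1 : ∀ b : Fin n, ∃ D, ∀ y, |pderiv b η y| ≤ D := fun b =>
      (continuousOn_univ.1 (continuousOn_pderiv isOpen_univ hη1.contDiffOn b)).bounded_above_of_compact_support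
        (hasCompactSupport_pderiv hηc b)
    choose D hD using h1
    refine ⟨∑ b, |D b|, fun y b => (hD b y).trans ((le_abs_self _).trans ?_)⟩
    exact Finset.single_le_sum (f := fun b => |D b|) (fun _ _ => abs_nonneg _) (Finset.mem_univ b)
  have hηB : ∃ B, ∀ y, |η y| ≤ B := hη.continuous.bounded_above_of_compact_support hηc
  obtain ⟨B, hB⟩ := hηB
  have hB0 : 0 ≤ B := (abs_nonneg _).trans (hB 0)
  -- The tolerance for the gradients is fixed only after `η`, since it depends on the bound `D` for
  -- the derivatives of `η`.
  obtain ⟨δ, hδ, hδε⟩ : ∃ δ : ℝ, 0 < δ ∧ n * (δ * (‖detRows n‖ * |D|) * ((volume.real V + C)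
      + ∫ y in V, ‖h y‖ ^ k)) ≤ ε := by
    set P := n * (‖detRows n‖ * |D|) * ((volume.real V + C) + ∫ y in V, ‖h y‖ ^ k) with hP
    have hP0 : 0 ≤ P := mul_nonneg (by positivity)
      (add_nonneg (by positivity) (integral_nonneg fun y => by positivity))
    refine ⟨ε / (P + 1), by positivity, ?_⟩
    have : n * (ε / (P + 1) * (‖detRows n‖ * |D|) * ((volume.real V + C)
      + ∫ y in V, ‖h y‖ ^ k)) = ε * (P / (P + 1)) := by rw [hP]; ring
    rw [this]
    exact mul_le_of_le_one_right hε.le (div_le_one_of_le₀ (by linarith) (by linarith))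
  have hηint : ∀ F : Eucl n → ℝ, ∫ y, η y * F y = ∫ y in V, η y * F y := fun F =>
    (setIntegral_eq_integral_of_forall_compl_eq_zero fun y hy => by
      rw [image_eq_zero_of_notMem_tsupport fun hh => hy (hηV hh), zero_mul]).symm
  filter_upwards [hfw δ hδ, hcc ε hε] with j hj1 hj2
  have hcd : AEStronglyMeasurable (fun y => c' j y - c y) (volume.restrict V) :=
    ((hc' j).sub hc.continuousOn).aestronglyMeasurable hVm
  have hcη : AEStronglyMeasurable (fun y => η y - c y) (volume.restrict V) :=
    (hη.continuous.sub hc).aestronglyMeasurable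
  obtain ⟨i1, b1⟩ := hfV j hcd hj2 hε.le
  obtain ⟨i2, b2⟩ := hfV j hcη (fun y _ => hηε y) hε.le
  obtain ⟨i3, -⟩ := hfV j hη.continuous.aestronglyMeasurable (fun y _ => hB y) hB0
  obtain ⟨i4, b4⟩ := integrableOn_mul_nullLagr hVm hVf hr H.aestronglyMeasurable
    H.integrableOn_pow hcη (fun y _ => hηε y)
  obtain ⟨i5, -⟩ := integrableOn_mul_nullLagr hVm hVf hr H.aestronglyMeasurable
    H.integrableOn_pow (c := η) hη.continuous.aestronglyMeasurable (fun y _ => hB y)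
  have b6 := abs_integral_nullLagr_sub_weak_le hV hVf hk H hr hη1 hηc hηV
    (D := |D|) (fun y b => (hD y b).trans (le_abs_self _)) hδ.le (hf j)
    (fun y hy l => hj1 y (hηV hy) l)
  rw [hηint, hηint] at b6
  have b7 : |(∫ y in V, η y * nullLagr r (hess (f j) y)) - ∫ y in V, η y * nullLagr r (h y)| ≤ ε := by
    refine b6.trans (le_trans ?_ hδε)
    have hle : ∫ y in tsupport η, (1 + ‖hess (f j) y‖ ^ k) ≤ volume.real V + C := by
      calc ∫ y in tsupport η, (1 + ‖hess (f j) y‖ ^ k)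
          ≤ ∫ y in V, (1 + ‖hess (f j) y‖ ^ k) :=
            setIntegral_mono_set ((integrable_const _).add (hfi j))
              (ae_of_all _ fun y => by positivity) (ae_of_all _ hηV)
        _ = volume.real V + ∫ y in V, ‖hess (f j) y‖ ^ k := by
            rw [integral_add (integrable_const _) (hfi j)]; simp
        _ ≤ _ := by linarith [hfC j]
    gcongr
  have e1 : ∫ y in V, c' j y * nullLagr r (hess (f j) y)
      = (∫ y in V, (c' j y - c y) * nullLagr r (hess (f j) y))
        - (∫ y in V, (η y - c y) * nullLagr r (hess (f j) y))
        + ∫ y in V, η y * nullLagr r (hess (f j) y) := by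
    rw [← integral_sub i1 i2]
    refine Eq.trans ?_ (integral_add (i1.sub i2) i3)
    congr 1; funext y; ring
  have e2 : ∫ y in V, c y * nullLagr r (h y) = (∫ y in V, η y * nullLagr r (h y))
        - ∫ y in V, (η y - c y) * nullLagr r (h y) := by
    rw [← integral_sub i5 i4]
    congr 1; funext y; ring
  rw [Real.dist_eq, e1, e2]
  refine lt_of_le_of_lt ?_ hεlt
  rw [abs_le] at b1 b2 b4 b7 ⊢
  constructor <;> nlinarith [b1.1, b1.2, b2.1, b2.2, b4.1, b4.2, b7.1, b7.2]

end WeakContinuity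

/-! ### Elementary symmetric functions of relative eigenvalues as sums of minors. -/

section SymmetricFunctions

open scoped Matrix

variable {n : ℕ}

open scoped MatrixOrder in
theorem exists_isHermitian_sq_eq {G : Matrix (Fin n) (Fin n) ℝ} (hG : G.PosDef) :
    ∃ P : Matrix (Fin n) (Fin n) ℝ, P.IsHermitian ∧ P * P = G ∧ IsUnit P.det := by
  have h1 : CFC.sqrt G * CFC.sqrt G = G := CFC.sqrt_mul_sqrt_self G hG.posSemidef.nonneg
  refine ⟨CFC.sqrt G, (Matrix.nonneg_iff_posSemidef.1 (CFC.sqrt_nonneg G)).isHermitian, h1, ?_⟩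
  have h2 : IsUnit (CFC.sqrt G * CFC.sqrt G).det := by
    rw [h1]; exact hG.isUnit.map Matrix.detMonoidHom
  rw [Matrix.det_mul] at h2
  exact isUnit_of_mul_isUnit_left h2

/-- With a symmetric square root `P` of `G`, the matrix `G⁻¹ A` has the characteristic polynomial of
the symmetric matrix `P⁻¹ A P⁻¹`. Hence the real roots are all the eigenvalues, and Vieta's formulas
apply to them. -/
theorem splits_charpoly_inv_mul {G A : Matrix (Fin n) (Fin n) ℝ} (hG : G.PosDef)
    (hA : A.IsHermitian) : (G⁻¹ * A).charpoly.Splits := by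
  obtain ⟨P, hP, hPG, hu⟩ := exists_isHermitian_sq_eq hG
  have h1 : (G⁻¹ * A).charpoly = (P⁻¹ * A * P⁻¹).charpoly := by
    rw [Matrix.charpoly_mul_comm (P⁻¹ * A) P⁻¹, ← Matrix.mul_assoc, ← hPG, Matrix.mul_inv_rev]
  rw [h1]
  refine Matrix.IsHermitian.splits_charpoly ?_
  have := Matrix.isHermitian_conjTranspose_mul_mul P⁻¹ hA
  rwa [hP.inv.eq] at this

/-- Two expressions for one coefficient of the characteristic polynomial, by Vieta and by principal
minors; the signs `(-1)^k` cancel. Each minor is written as a full determinant with unit rows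
outside `S`, to which multilinearity in the rows applies. -/
theorem esymm_roots_charpoly {M : Matrix (Fin n) (Fin n) ℝ} (hM : M.charpoly.Splits) {k : ℕ}
    (hk : k ≤ n) : M.charpoly.roots.esymm k
      = ∑ S ∈ Finset.univ.powersetCard k, detRows n
          (S.piecewise (fun i c => M i c) fun i => Pi.single i 1) := by
  have hd : M.charpoly.natDegree = n := by simp [Matrix.charpoly_natDegree_eq_dim]
  have h1 := Polynomial.coeff_eq_esymm_roots_of_splits hM (k := n - k) (by omega)
  have h2 := Matrix.charpoly_coeff_eq_sum_minors M k (by simpa using hk)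
  rw [Fintype.card_fin] at h2
  rw [h2, hd, M.charpoly_monic.leadingCoeff, one_mul, Nat.sub_sub_self hk] at h1
  rw [← mul_left_cancel₀ (pow_ne_zero k (by norm_num)) h1]
  refine Finset.sum_congr rfl fun S _ => ?_
  rw [← Matrix.det_piecewise_one_eq_submatrix_det M S, detRows_apply]
  congr 2
  funext i c
  by_cases hi : i ∈ S
  · simp [hi]
  · have h := Finset.piecewise_eq_of_notMem S M.row (1 : Matrix (Fin n) (Fin n) ℝ).row hi
    refine (congrFun h c).trans ?_
    simp [hi, Matrix.row, Matrix.one_apply, Pi.single_apply, eq_comm]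

/-- Coefficients of the rows of `N (a H + F)` (for indices in `S`) and of unit rows (otherwise)
in terms of the rows of `H` and unit rows. -/
noncomputable def rowCoef (S : Finset (Fin n)) (N : Matrix (Fin n) (Fin n) ℝ)
    (F : Fin n → Fin n → ℝ) (a : ℝ) (i : Fin n) :
    Fin n ⊕ Fin n → ℝ
  | Sum.inl l => if i ∈ S then N i l * a else 0
  | Sum.inr b => if i ∈ S then ∑ l, N i l * F l b else if i = b then 1 else 0

/-- Every row is a combination of rows of `H` and unit rows, and the determinant is expanded
multilinearly. Rows outside `S` have no component along `H`, so by pigeonhole a choice with more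
than `S.card` Hessian rows has a zero coefficient. -/
theorem detRows_piecewise_eq (S : Finset (Fin n)) (N : Matrix (Fin n) (Fin n) ℝ)
    (F H : Fin n → Fin n → ℝ) (a : ℝ) :
    detRows n (S.piecewise (fun i c => ∑ l, N i l * (a * H l c + F l c))
        fun i => Pi.single i 1)
      = ∑ r ∈ Finset.univ.filter (fun r => rowDeg r ≤ S.card),
          (∏ i, rowCoef S N F a i (r i)) * nullLagr r H := by
  have h1 : (S.piecewise (fun i c => ∑ l, N i l * (a * H l c + F l c))
      fun i => Pi.single i 1) = fun i => ∑ t, rowCoef S N F a i t • baseRow H t := by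
    funext i c
    rw [Fintype.sum_sum_type]
    simp only [Pi.add_apply, Finset.sum_apply, Pi.smul_apply, smul_eq_mul, rowCoef, baseRow]
    by_cases hi : i ∈ S
    · rw [Finset.piecewise_eq_of_mem _ _ _ hi]
      simp only [hi, if_true, Pi.single_apply, mul_ite, mul_one, mul_zero, Finset.sum_ite_eq,
        Finset.mem_univ]
      rw [← Finset.sum_add_distrib]
      exact Finset.sum_congr rfl fun l _ => by ring
    · rw [Finset.piecewise_eq_of_notMem _ _ _ hi]
      simp [hi, Pi.single_apply, eq_comm]
  rw [h1]
  have h2 := (detRows n).toMultilinearMap.map_sum (fun i t => rowCoef S N F a i t • baseRow H t)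
  have h3 : ∀ r : Fin n → Fin n ⊕ Fin n,
      (detRows n).toMultilinearMap (fun i => rowCoef S N F a i (r i) • baseRow H (r i))
        = (∏ i, rowCoef S N F a i (r i)) * nullLagr r H := fun r =>
    (detRows n).toMultilinearMap.map_smul_univ _ _
  refine h2.trans ?_
  simp_rw [h3]
  refine (Finset.sum_subset (Finset.filter_subset _ _) fun r _ hr => ?_).symm
  simp only [Finset.mem_filter, Finset.mem_univ, true_and, not_le] at hr
  obtain ⟨i, hi, hiS⟩ := Finset.exists_mem_notMem_of_card_lt_card hr
  have : rowCoef S N F a i (r i) = 0 := by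
    rw [Finset.mem_filter] at hi
    rcases hri : r i with l | b
    · simp [rowCoef, hiS]
    · simp [hri] at hi
  rw [Finset.prod_eq_zero (Finset.mem_univ i) this, zero_mul]

/-- The matrix of a bilinear form in the standard basis. -/
noncomputable def gramMatrix (B : Eucl n → Eucl n → ℝ) : Matrix (Fin n) (Fin n) ℝ :=
  Matrix.of fun i j => B (basisVec i) (basisVec j)

theorem esymm_eigenvaluesRel {G A : Eucl n → Eucl n → ℝ} (hG : (gramMatrix G).PosDef)
    (hA : (gramMatrix A).IsHermitian) {k : ℕ} (hk : k ≤ n) {H F : Fin n → Fin n → ℝ} {a : ℝ}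
    (hAH : ∀ i j, A (basisVec i) (basisVec j) = a * H i j + F i j) :
    (eigenvaluesRel G A).esymm k
      = ∑ S ∈ Finset.univ.powersetCard k, ∑ r ∈ Finset.univ.filter (fun r => rowDeg r ≤ k),
          (∏ i, rowCoef S (gramMatrix G)⁻¹ F a i (r i)) * nullLagr r H := by
  have h := esymm_roots_charpoly (splits_charpoly_inv_mul hG hA) hk
  refine h.trans (Finset.sum_congr rfl fun S hS => ?_)
  rw [← (Finset.mem_powersetCard.1 hS).2, ← detRows_piecewise_eq]
  congr 2
  funext i c
  rw [Matrix.mul_apply]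
  exact Finset.sum_congr rfl fun l _ => by rw [gramMatrix, gramMatrix, Matrix.of_apply, hAH]

theorem gramMatrix_comp (B : Eucl n →ₗ[ℝ] Eucl n →ₗ[ℝ] ℝ) (J : Eucl n →ₗ[ℝ] Eucl n) :
    gramMatrix (fun v w => B (J v) (J w))
      = (Matrix.of fun i j => J (basisVec j) i)ᵀ * gramMatrix (fun v w => B v w)
        * (Matrix.of fun i j => J (basisVec j) i) := by
  have hv : ∀ v : Eucl n, v = ∑ i, v i • (basisVec i : Eucl n) := fun v => by
    ext j
    simp [basisVec, Pi.single_apply]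
  ext i j
  rw [Matrix.mul_apply]
  simp_rw [Matrix.mul_apply]
  simp only [gramMatrix, Matrix.of_apply, Matrix.transpose_apply]
  conv_lhs => rw [hv (J (basisVec i)), hv (J (basisVec j))]
  simp only [map_sum, map_smul, LinearMap.sum_apply, LinearMap.smul_apply, smul_eq_mul,
    Finset.mul_sum, Finset.sum_mul]
  exact Finset.sum_congr rfl fun a _ => Finset.sum_congr rfl fun b _ => by ring

/-- A congruence by `P` of both forms conjugates `G⁻¹ A` by `P`, so the eigenvalues do not depend on
the frame and may be computed in any chart. -/
theorem eigenvaluesRel_comp (G A : Eucl n →ₗ[ℝ] Eucl n →ₗ[ℝ] ℝ) (J : Eucl n ≃ₗ[ℝ] Eucl n) :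
    eigenvaluesRel (fun v w => G (J v) (J w)) (fun v w => A (J v) (J w))
      = eigenvaluesRel (fun v w => G v w) fun v w => A v w := by
  set P : Matrix (Fin n) (Fin n) ℝ := Matrix.of fun i j => J (basisVec j) i with hP
  have hPd : IsUnit P.det := by
    have h1 : P = LinearMap.toMatrix (EuclideanSpace.basisFun (Fin n) ℝ).toBasis
        (EuclideanSpace.basisFun (Fin n) ℝ).toBasis J.toLinearMap := by
      ext i j
      simp [hP, LinearMap.toMatrix_apply, basisVec]
    rw [h1, LinearMap.det_toMatrix]
    exact LinearEquiv.isUnit_det' J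
  have key : ∀ G A : Matrix (Fin n) (Fin n) ℝ,
      ((Pᵀ * G * P)⁻¹ * (Pᵀ * A * P)).charpoly = (G⁻¹ * A).charpoly := by
    intro G A
    rw [Matrix.mul_inv_rev, Matrix.mul_inv_rev, Matrix.charpoly_mul_comm]
    have h1 : Pᵀ * A * P * (P⁻¹ * (G⁻¹ * Pᵀ⁻¹)) = Pᵀ * (A * (P * P⁻¹) * G⁻¹) * Pᵀ⁻¹ := by
      simp only [Matrix.mul_assoc]
    rw [h1, Matrix.mul_nonsing_inv _ hPd, Matrix.mul_one, Matrix.charpoly_mul_comm,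
      ← Matrix.mul_assoc, Matrix.nonsing_inv_mul _ (by rwa [Matrix.det_transpose]),
      Matrix.one_mul, Matrix.charpoly_mul_comm]
  have h1 := gramMatrix_comp G J.toLinearMap
  have h2 := gramMatrix_comp A J.toLinearMap
  change ((gramMatrix fun v w => G (J v) (J w))⁻¹ *
    gramMatrix fun v w => A (J v) (J w)).charpoly.roots = ((gramMatrix fun v w => G v w)⁻¹ *
    gramMatrix fun v w => A v w).charpoly.roots
  rw [← key (gramMatrix fun v w => G v w)]
  exact congrArg _ (congrArg _ (by rw [← hP] at *; exact congrArg₂ _ (congrArg _ h1) h2))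

end SymmetricFunctions

/-! ### Positive definite forms, the Levi-Civita connection and its curvature in coordinates. -/

section

set_option maxSynthPendingDepth 3

theorem two_le_smooth : minSmoothness ℝ 2 ≤ ((⊤ : ℕ∞) : WithTop ℕ∞) := by
  rw [minSmoothness_of_isRCLikeNormedField]
  exact WithTop.coe_le_coe.2 le_top

section Forms

variable {E : Type*} [NormedAddCommGroup E] [NormedSpace ℝ E] [FiniteDimensional ℝ E]

/-- Positive definite symmetric bilinear forms. -/
structure IsPosForm (B : E →L[ℝ] E →L[ℝ] ℝ) : Prop where
  symm : ∀ v w, B v w = B w v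
  pos : ∀ v, v ≠ 0 → 0 < B v v

namespace IsPosForm

variable {B : E →L[ℝ] E →L[ℝ] ℝ}

/-- Positivity gives injectivity and a dimension count the rest. It ensures that `B.inverse` is a
true inverse rather than the default value zero. -/
theorem exists_equiv (hB : IsPosForm B) :
    ∃ e : E ≃L[ℝ] (E →L[ℝ] ℝ), (e : E →L[ℝ] (E →L[ℝ] ℝ)) = B := by
  have hinj : Function.Injective (B : E →ₗ[ℝ] (E →L[ℝ] ℝ)) := by
    rw [← LinearMap.ker_eq_bot, LinearMap.ker_eq_bot']
    intro v hv
    by_contra h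
    have := hB.pos v h
    have h2 : B v = 0 := hv
    rw [h2] at this
    exact lt_irrefl _ this
  have hfr : Module.finrank ℝ E = Module.finrank ℝ (E →L[ℝ] ℝ) := by
    rw [← (LinearMap.toContinuousLinearMap (𝕜 := ℝ) (E := E) (F' := ℝ)).finrank_eq]
    exact (Subspace.dual_finrank_eq (K := ℝ) (V := E)).symm
  refine ⟨(LinearEquiv.ofInjectiveOfFinrankEq _ hinj hfr).toContinuousLinearEquiv, ?_⟩
  ext v w
  rfl

theorem apply_inverse (hB : IsPosForm B) (ℓ : E →L[ℝ] ℝ) : B (B.inverse ℓ) = ℓ := by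
  obtain ⟨e, rfl⟩ := hB.exists_equiv
  simp

theorem inverse_apply (hB : IsPosForm B) (v : E) : B.inverse (B v) = v := by
  obtain ⟨e, rfl⟩ := hB.exists_equiv
  simp

theorem ext_right (hB : IsPosForm B) {v w : E} (h : ∀ x, B v x = B w x) : v = w := by
  rw [← hB.inverse_apply v, ← hB.inverse_apply w]
  congr 1
  exact ContinuousLinearMap.ext h

theorem inverse_symm (hB : IsPosForm B) (ℓ m : E →L[ℝ] ℝ) :
    ℓ (B.inverse m) = m (B.inverse ℓ) := by
  conv_lhs => rw [← hB.apply_inverse ℓ]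
  conv_rhs => rw [← hB.apply_inverse m]
  exact hB.symm _ _

theorem smul (hB : IsPosForm B) {c : ℝ} (hc : 0 < c) : IsPosForm (c • B) :=
  ⟨fun v w => by simp [hB.symm v w], fun v hv => by simpa using mul_pos hc (hB.pos v hv)⟩

theorem comp (hB : IsPosForm B) (J : E →L[ℝ] E) (hJ : Function.Injective J) :
    IsPosForm (B.bilinearComp J J) :=
  ⟨fun _ _ => hB.symm _ _, fun _ hv => hB.pos _ ((map_ne_zero_iff J hJ).2 hv)⟩

/-- A skew-adjoint endomorphism has trace zero. -/
theorem trace_eq_zero_of_skew (hB : IsPosForm B) (T : E →ₗ[ℝ] E)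
    (hT : ∀ v w, B (T v) w + B v (T w) = 0) : LinearMap.trace ℝ E T = 0 := by
  obtain ⟨e, he⟩ := hB.exists_equiv
  set e' : E ≃ₗ[ℝ] Module.Dual ℝ E :=
    e.toLinearEquiv.trans LinearMap.toContinuousLinearMap.symm with he'
  have h0 : ∀ v w, e' v w = B v w := fun v w => by rw [← he]; rfl
  -- Transported to the dual space by `B`, a skew endomorphism becomes minus its own transpose, so
  -- its trace equals its negative.
  have h1 : e'.conj T = -Module.Dual.transpose T := by
    ext ℓ w
    obtain ⟨v, rfl⟩ := e'.surjective ℓ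
    have := hT v w
    simp only [LinearEquiv.conj_apply, LinearMap.comp_apply, LinearEquiv.coe_coe,
      LinearEquiv.symm_apply_apply, LinearMap.neg_apply, Module.Dual.transpose_apply, h0]
    linarith
  have h2 := LinearMap.trace_conj' T e'
  rw [h1] at h2
  have h3 := (LinearMap.trace ℝ (Module.Dual ℝ E)).map_neg (Module.Dual.transpose T)
  rw [LinearMap.trace_transpose'] at h3
  linarith

end IsPosForm

end Forms

section Connection

variable {E : Type*} [NormedAddCommGroup E] [NormedSpace ℝ E] [FiniteDimensional ℝ E]

/-- A smooth Riemannian metric on an open subset of a finite-dimensional space. -/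
structure IsMetricOn (G : E → E →L[ℝ] E →L[ℝ] ℝ) (U : Set E) : Prop where
  isOpen : IsOpen U
  contDiffOn : ContDiffOn ℝ ∞ G U
  isPosForm : ∀ z ∈ U, IsPosForm (G z)

/-- The Christoffel symbols as a field of bilinear maps. -/
noncomputable def chris (G : E → E →L[ℝ] E →L[ℝ] ℝ) (z : E) :
    E →L[ℝ] E →L[ℝ] E :=
  (ContinuousLinearMap.compL ℝ E (E →L[ℝ] ℝ) E (G z).inverse).comp
    ((1 / 2 : ℝ) • (fderiv ℝ G z + (fderiv ℝ G z).flip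
      - ((ContinuousLinearMap.flipₗᵢ ℝ E E ℝ).toContinuousLinearEquiv :
          (E →L[ℝ] E →L[ℝ] ℝ) →L[ℝ] (E →L[ℝ] E →L[ℝ] ℝ)).comp
            (fderiv ℝ G z).flip))

variable {G : E → E →L[ℝ] E →L[ℝ] ℝ} {U : Set E}

namespace IsMetricOn

theorem contDiffAt (hG : IsMetricOn G U) {z : E} (hz : z ∈ U) : ContDiffAt ℝ ∞ G z :=
  hG.contDiffOn.contDiffAt (hG.isOpen.mem_nhds hz)

theorem contDiffOn_inverse (hG : IsMetricOn G U) :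
    ContDiffOn ℝ ∞ (fun z => (G z).inverse) U := by
  intro z hz
  obtain ⟨e, he⟩ := (hG.isPosForm z hz).exists_equiv
  have h1 : ContDiffAt ℝ ∞ ContinuousLinearMap.inverse (G z) := by
    rw [← he]; exact contDiffAt_map_inverse e
  exact (h1.comp z (hG.contDiffAt hz)).contDiffWithinAt

theorem contDiffOn_fderiv (hG : IsMetricOn G U) : ContDiffOn ℝ ∞ (fderiv ℝ G) U :=
  hG.contDiffOn.fderiv_of_isOpen hG.isOpen (by simp)

theorem contDiffOn_chris (hG : IsMetricOn G U) : ContDiffOn ℝ ∞ (chris G) U := by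
  have h1 := hG.contDiffOn_inverse
  have h2 := hG.contDiffOn_fderiv
  have h3 : ContDiffOn ℝ ∞ (fun z => (fderiv ℝ G z).flip) U :=
    (ContinuousLinearMap.flipₗᵢ ℝ E E
      (E →L[ℝ] ℝ)).toContinuousLinearEquiv.contDiff.comp_contDiffOn h2
  unfold chris
  exact ((ContinuousLinearMap.contDiff _).comp_contDiffOn h1).clm_comp
    (((h2.add h3).sub (contDiffOn_const.clm_comp h3)).const_smul (1 / 2 : ℝ))

theorem differentiableAt (hG : IsMetricOn G U) {z : E} (hz : z ∈ U) :
    DifferentiableAt ℝ G z := (hG.contDiffAt hz).differentiableAt (by simp)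

theorem differentiableAt_chris (hG : IsMetricOn G U) {z : E} (hz : z ∈ U) :
    DifferentiableAt ℝ (chris G) z :=
  (hG.contDiffOn_chris.contDiffAt (hG.isOpen.mem_nhds hz)).differentiableAt (by simp)

theorem fderiv_symm (hG : IsMetricOn G U) {z : E} (hz : z ∈ U) (a v w : E) :
    fderiv ℝ G z a v w = fderiv ℝ G z a w v := by
  have h1 : ∀ v w : E, HasFDerivAt (fun y => G y v w)
      (((ContinuousLinearMap.apply ℝ ℝ w).comp
        (ContinuousLinearMap.apply ℝ (E →L[ℝ] ℝ) v)).comp (fderiv ℝ G z)) z := fun v w =>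
    ((ContinuousLinearMap.apply ℝ ℝ w).comp
      (ContinuousLinearMap.apply ℝ (E →L[ℝ] ℝ) v)).hasFDerivAt.comp z
        (hG.differentiableAt hz).hasFDerivAt
  have h2 : (fun y => G y v w) =ᶠ[𝓝 z] fun y => G y w v := by
    filter_upwards [hG.isOpen.mem_nhds hz] with y hy using (hG.isPosForm y hy).symm v w
  have := (h1 v w).unique ((h1 w v).congr_of_eventuallyEq h2)
  exact congrArg (fun L : E →L[ℝ] ℝ => L a) this

/-- The Koszul formula. -/
theorem koszul (hG : IsMetricOn G U) {z : E} (hz : z ∈ U) (v w x : E) :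
    2 * G z (chris G z v w) x
      = fderiv ℝ G z v w x + fderiv ℝ G z w v x - fderiv ℝ G z x v w := by
  have : G z (chris G z v w) = (1 / 2 : ℝ) • (fderiv ℝ G z v w + fderiv ℝ G z w v
      - ((fderiv ℝ G z).flip v).flip w) := by
    exact (hG.isPosForm z hz).apply_inverse _
  rw [this]
  simp

theorem chris_symm (hG : IsMetricOn G U) {z : E} (hz : z ∈ U) (v w : E) :
    chris G z v w = chris G z w v := by
  refine (hG.isPosForm z hz).ext_right fun x => ?_
  have h1 := hG.koszul hz v w x
  have h2 := hG.koszul hz w v x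
  rw [hG.fderiv_symm hz x w v] at h2
  linarith

/-- Metric compatibility of the connection: in the sum of two Koszul formulas all terms but one
cancel. -/
theorem fderiv_eq (hG : IsMetricOn G U) {z : E} (hz : z ∈ U) (a v w : E) :
    fderiv ℝ G z a v w = G z (chris G z a v) w + G z v (chris G z a w) := by
  have h1 := hG.koszul hz a v w
  have h2 := hG.koszul hz a w v
  rw [hG.fderiv_symm hz a w v] at h2
  rw [hG.fderiv_symm hz v a w] at h1
  rw [hG.fderiv_symm hz w a v] at h2
  rw [hG.fderiv_symm hz w a v] at h1
  rw [hG.fderiv_symm hz v a w] at h2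
  rw [(hG.isPosForm z hz).symm v]
  linarith

/-- The Levi-Civita connection is the only torsion free metric connection. -/
theorem chris_unique (hG : IsMetricOn G U) {z : E} (hz : z ∈ U)
    {T : E → E → E} (hT : ∀ v w, T v w = T w v)
    (hTG : ∀ a v w, fderiv ℝ G z a v w = G z (T a v) w + G z v (T a w)) (v w : E) :
    chris G z v w = T v w := by
  refine (hG.isPosForm z hz).ext_right fun x => ?_
  have h1 := hG.koszul hz v w x
  have hs := (hG.isPosForm z hz).symm
  -- Compatibility and symmetry of `T` turn the right side of the Koszul formula into `2 G(T(v, w),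
  -- x)`.
  rw [hTG, hTG, hTG, hT w v, hT x v, hT x w, hs w (T v x), hs v (T w x)] at h1
  linarith

end IsMetricOn

/-- The map `a ↦ R(a, v) w` for the curvature of a connection in coordinates. -/
noncomputable def riemEnd (Γ : E → E →L[ℝ] E →L[ℝ] E) (z v w : E) : E →L[ℝ] E :=
  ((fderiv ℝ Γ z).flip v).flip w - (fderiv ℝ Γ z v).flip w + (Γ z).flip (Γ z v w)
    - (Γ z v).comp ((Γ z).flip w)

theorem riemEnd_apply (Γ : E → E →L[ℝ] E →L[ℝ] E) (z a v w : E) :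
    riemEnd Γ z v w a = fderiv ℝ Γ z a v w - fderiv ℝ Γ z v a w + Γ z a (Γ z v w)
      - Γ z v (Γ z a w) := rfl

/-- The Ricci curvature of a connection in coordinates. -/
noncomputable def ricForm (Γ : E → E →L[ℝ] E →L[ℝ] E) (z : E) : E →ₗ[ℝ] E →ₗ[ℝ] ℝ :=
  LinearMap.mk₂ ℝ (fun v w => LinearMap.trace ℝ E (riemEnd Γ z v w : E →ₗ[ℝ] E))
    (fun v v' w => by
      rw [← map_add]; congr 1; ext a; simp [riemEnd_apply]; abel)
    (fun c v w => by
      rw [← map_smul]; congr 1; ext a; simp [riemEnd_apply, smul_sub, smul_add])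
    (fun v w w' => by
      rw [← map_add]; congr 1; ext a; simp [riemEnd_apply]; abel)
    (fun c v w => by
      rw [← map_smul]; congr 1; ext a; simp [riemEnd_apply, smul_sub, smul_add])

theorem ricForm_apply (Γ : E → E →L[ℝ] E →L[ℝ] E) (z v w : E) :
    ricForm Γ z v w = LinearMap.trace ℝ E (riemEnd Γ z v w : E →ₗ[ℝ] E) := rfl

theorem hasFDerivAt_apply_apply {F : Type*} [NormedAddCommGroup F] [NormedSpace ℝ F]
    {Γ : E → E →L[ℝ] E →L[ℝ] F} {z : E}
    (h : DifferentiableAt ℝ Γ z) (v w : E) :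
    HasFDerivAt (fun y => Γ y v w) (((fderiv ℝ Γ z).flip v).flip w) z :=
  ((ContinuousLinearMap.apply ℝ F w).comp
    (ContinuousLinearMap.apply ℝ (E →L[ℝ] F) v)).hasFDerivAt.comp z h.hasFDerivAt

namespace IsMetricOn

theorem fderiv_chris_symm (hG : IsMetricOn G U) {z : E} (hz : z ∈ U) (a v w : E) :
    fderiv ℝ (chris G) z a v w = fderiv ℝ (chris G) z a w v := by
  have h2 : (fun y => chris G y v w) =ᶠ[𝓝 z] fun y => chris G y w v := by
    filter_upwards [hG.isOpen.mem_nhds hz] with y hy using hG.chris_symm hy v w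
  have := (hasFDerivAt_apply_apply (hG.differentiableAt_chris hz) v w).unique
    ((hasFDerivAt_apply_apply (hG.differentiableAt_chris hz) w v).congr_of_eventuallyEq h2)
  exact congrArg (fun L : E →L[ℝ] E => L a) this

/-- The curvature endomorphisms are skew-adjoint. -/
theorem curvature_skew (hG : IsMetricOn G U) {z : E} (hz : z ∈ U) (b a v w : E) :
    G z (riemEnd (chris G) z a v b) w + G z v (riemEnd (chris G) z a w b) = 0 := by
  have hd := hG.differentiableAt hz
  have hΓ := hG.differentiableAt_chris hz
  have key : ∀ a b, fderiv ℝ (fun y => fderiv ℝ G y a v w) z b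
      = fderiv ℝ G z b (chris G z a v) w + G z (fderiv ℝ (chris G) z b a v) w
        + (fderiv ℝ G z b v (chris G z a w) + G z v (fderiv ℝ (chris G) z b a w)) := by
    intro a b
    have h1 : (fun y => fderiv ℝ G y a v w)
        =ᶠ[𝓝 z] fun y => G y (chris G y a v) w + G y v (chris G y a w) := by
      filter_upwards [hG.isOpen.mem_nhds hz] with y hy using hG.fderiv_eq hy a v w
    have h2 := (hd.hasFDerivAt.clm_apply (hasFDerivAt_apply_apply hΓ a v)).clm_apply
      (hasFDerivAt_const w z)
    have h3 := (hd.hasFDerivAt.clm_apply (hasFDerivAt_const v z)).clm_apply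
      (hasFDerivAt_apply_apply hΓ a w)
    rw [h1.fderiv_eq]
    refine (congrArg (fun L : E →L[ℝ] ℝ => L b) (h2.add h3).fderiv).trans ?_
    simp
    ring
  -- Skewness comes from the symmetry of the second derivatives of `G`, both sides of which `key`
  -- expands by differentiating metric compatibility.
  have hs : fderiv ℝ (fun y => fderiv ℝ G y a v w) z b
      = fderiv ℝ (fun y => fderiv ℝ G y b v w) z a := by
    have h1 : ∀ a, fderiv ℝ (fun y => fderiv ℝ G y a v w) z
        = (((fderiv ℝ (fderiv ℝ G) z).flip a).flip v).flip w := by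
      intro a
      have h0 : DifferentiableAt ℝ (fderiv ℝ G) z :=
        (hG.contDiffOn_fderiv.contDiffAt (hG.isOpen.mem_nhds hz)).differentiableAt (by simp)
      have := (((ContinuousLinearMap.apply ℝ ℝ w).comp
        (ContinuousLinearMap.apply ℝ (E →L[ℝ] ℝ) v)).comp
        (ContinuousLinearMap.apply ℝ (E →L[ℝ] E →L[ℝ] ℝ) a)).hasFDerivAt.comp z h0.hasFDerivAt
      exact this.fderiv
    have h2 : IsSymmSndFDerivAt ℝ G z := (hG.contDiffAt hz).isSymmSndFDerivAt two_le_smooth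
    rw [h1, h1]
    exact congrArg (fun B : E →L[ℝ] E →L[ℝ] ℝ => B v w) (h2 b a)
  rw [key, key] at hs
  simp only [hG.fderiv_eq hz] at hs
  simp only [riemEnd_apply, map_add, map_sub, add_apply, sub_apply]
  linarith

/-- The Ricci curvature is symmetric. -/
theorem ricForm_symm (hG : IsMetricOn G U) {z : E} (hz : z ∈ U) (v w : E) :
    ricForm (chris G) z v w = ricForm (chris G) z w v := by
  have h := (hG.isPosForm z hz).trace_eq_zero_of_skew
    ((riemEnd (chris G) z w v : E →ₗ[ℝ] E) - (riemEnd (chris G) z v w : E →ₗ[ℝ] E)) ?_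
  · rw [map_sub] at h
    rw [ricForm_apply, ricForm_apply]
    linarith
  -- First Bianchi identity: `R(a, w) v - R(a, v) w = R(v, w) a`. The right side is skew-adjoint in
  -- `a`, so its trace vanishes.
  · have hB : ∀ a, ((riemEnd (chris G) z w v : E →ₗ[ℝ] E)
        - (riemEnd (chris G) z v w : E →ₗ[ℝ] E)) a = riemEnd (chris G) z w a v := by
      intro a
      rw [LinearMap.sub_apply, ContinuousLinearMap.coe_coe, ContinuousLinearMap.coe_coe,
        riemEnd_apply, riemEnd_apply, riemEnd_apply, hG.fderiv_chris_symm hz a w v,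
        hG.fderiv_chris_symm hz w a v, hG.fderiv_chris_symm hz v a w, hG.chris_symm hz a v,
        hG.chris_symm hz a w, hG.chris_symm hz w v]
      abel
    intro x y
    rw [hB, hB]
    exact hG.curvature_skew hz v w x y

end IsMetricOn

/-- The endomorphism of the tangent space which corresponds to the Ricci curvature. -/
noncomputable def ricEnd (G : E → E →L[ℝ] E →L[ℝ] ℝ) (z : E) : E →ₗ[ℝ] E :=
  ((G z).inverse : (E →L[ℝ] ℝ) →ₗ[ℝ] E) ∘ₗ
    (LinearMap.toContinuousLinearMap : (E →ₗ[ℝ] ℝ) ≃ₗ[ℝ] (E →L[ℝ] ℝ)).toLinearMap ∘ₗ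
      ricForm (chris G) z

/-- The scalar curvature. -/
noncomputable def scal (G : E → E →L[ℝ] E →L[ℝ] ℝ) (z : E) : ℝ :=
  LinearMap.trace ℝ E (ricEnd G z)

/-- The Schouten tensor. -/
noncomputable def schoutenForm (G : E → E →L[ℝ] E →L[ℝ] ℝ) (z : E) : E →ₗ[ℝ] E →ₗ[ℝ] ℝ :=
  LinearMap.mk₂ ℝ (fun v w => 1 / ((Module.finrank ℝ E : ℝ) - 2) *
      (ricForm (chris G) z v w - scal G z / (2 * ((Module.finrank ℝ E : ℝ) - 1)) * G z v w))
    (fun _ _ _ => by simp; ring) (fun _ _ _ => by simp; ring)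
    (fun _ _ _ => by simp; ring) (fun _ _ _ => by simp; ring)

theorem schoutenForm_apply (G : E → E →L[ℝ] E →L[ℝ] ℝ) (z v w : E) :
    schoutenForm G z v w = 1 / ((Module.finrank ℝ E : ℝ) - 2) *
      (ricForm (chris G) z v w
        - scal G z / (2 * ((Module.finrank ℝ E : ℝ) - 1)) * G z v w) := rfl

theorem IsMetricOn.schoutenForm_symm (hG : IsMetricOn G U) {z : E} (hz : z ∈ U) (v w : E) :
    schoutenForm G z v w = schoutenForm G z w v := by
  rw [schoutenForm_apply, schoutenForm_apply, hG.ricForm_symm hz, (hG.isPosForm z hz).symm v]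

theorem IsMetricOn.apply_ricEnd (hG : IsMetricOn G U) {z : E} (hz : z ∈ U) (v w : E) :
    G z (ricEnd G z v) w = ricForm (chris G) z v w :=
  congrArg (fun L : E →L[ℝ] ℝ => L w) ((hG.isPosForm z hz).apply_inverse _)

end Connection

end

/-! ### Invariance of the curvature under changes of coordinates. -/

section

set_option maxSynthPendingDepth 3

section Pullback

variable {E : Type*} [NormedAddCommGroup E] [NormedSpace ℝ E] [FiniteDimensional ℝ E]
  {G G' : E → E →L[ℝ] E →L[ℝ] ℝ} {U U' : Set E} {ψ : E → E}

/-- `G'` is the pullback of the metric `G` by `ψ`. -/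
structure IsPullback (G : E → E →L[ℝ] E →L[ℝ] ℝ) (U : Set E) (ψ : E → E)
    (G' : E → E →L[ℝ] E →L[ℝ] ℝ) (U' : Set E) : Prop where
  isMetricOn : IsMetricOn G U
  isMetricOn' : IsMetricOn G' U'
  contDiffOn : ContDiffOn ℝ ∞ ψ U'
  mapsTo : MapsTo ψ U' U
  apply_eq : ∀ z ∈ U', ∀ v w, G' z v w = G (ψ z) (fderiv ℝ ψ z v) (fderiv ℝ ψ z w)

namespace IsPullback

theorem injective (h : IsPullback G U ψ G' U') {z : E} (hz : z ∈ U') :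
    Function.Injective (fderiv ℝ ψ z) := by
  rw [injective_iff_map_eq_zero]
  intro v hv
  by_contra hv0
  have := (h.isMetricOn'.isPosForm z hz).pos v hv0
  rw [h.apply_eq z hz, hv] at this
  simp at this

theorem exists_equiv (h : IsPullback G U ψ G' U') {z : E} (hz : z ∈ U') :
    ∃ e : E ≃L[ℝ] E, (e : E →L[ℝ] E) = fderiv ℝ ψ z := by
  refine ⟨(LinearEquiv.ofInjectiveEndo (fderiv ℝ ψ z : E →ₗ[ℝ] E)
    (h.injective hz)).toContinuousLinearEquiv, ?_⟩
  ext v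
  rfl

theorem contDiffAt (h : IsPullback G U ψ G' U') {z : E} (hz : z ∈ U') : ContDiffAt ℝ ∞ ψ z :=
  h.contDiffOn.contDiffAt (h.isMetricOn'.isOpen.mem_nhds hz)

theorem contDiffOn_fderiv (h : IsPullback G U ψ G' U') : ContDiffOn ℝ ∞ (fderiv ℝ ψ) U' :=
  h.contDiffOn.fderiv_of_isOpen h.isMetricOn'.isOpen (by simp)

theorem differentiableAt (h : IsPullback G U ψ G' U') {z : E} (hz : z ∈ U') :
    DifferentiableAt ℝ ψ z := (h.contDiffAt hz).differentiableAt (by simp)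

theorem differentiableAt_fderiv (h : IsPullback G U ψ G' U') {z : E} (hz : z ∈ U') :
    DifferentiableAt ℝ (fderiv ℝ ψ) z :=
  (h.contDiffOn_fderiv.contDiffAt (h.isMetricOn'.isOpen.mem_nhds hz)).differentiableAt (by simp)

theorem differentiableAt_fderiv_fderiv (h : IsPullback G U ψ G' U') {z : E} (hz : z ∈ U') :
    DifferentiableAt ℝ (fderiv ℝ (fderiv ℝ ψ)) z :=
  ((h.contDiffOn_fderiv.fderiv_of_isOpen h.isMetricOn'.isOpen
    (m := ∞) (by simp)).contDiffAt (h.isMetricOn'.isOpen.mem_nhds hz)).differentiableAt (by simp)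

theorem hasFDerivAt_fderiv_apply (h : IsPullback G U ψ G' U') {z : E} (hz : z ∈ U') (v : E) :
    HasFDerivAt (fun y => fderiv ℝ ψ y v) ((fderiv ℝ (fderiv ℝ ψ) z).flip v) z :=
  (ContinuousLinearMap.apply ℝ E v).hasFDerivAt.comp z (h.differentiableAt_fderiv hz).hasFDerivAt

theorem fderiv_fderiv_symm (h : IsPullback G U ψ G' U') {z : E} (hz : z ∈ U') (v w : E) :
    fderiv ℝ (fderiv ℝ ψ) z v w = fderiv ℝ (fderiv ℝ ψ) z w v :=
  (h.contDiffAt hz).isSymmSndFDerivAt two_le_smooth v w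

/-- The transformation rule for the Christoffel symbols. -/
theorem fderiv_chris (h : IsPullback G U ψ G' U') {z : E} (hz : z ∈ U') (a v : E) :
    fderiv ℝ ψ z (chris G' z a v)
      = chris G (ψ z) (fderiv ℝ ψ z a) (fderiv ℝ ψ z v) + fderiv ℝ (fderiv ℝ ψ) z a v := by
  obtain ⟨e, he⟩ := h.exists_equiv hz
  have hJ : ∀ x, fderiv ℝ ψ z (e.symm x) = x := fun x => by rw [← he]; simp
  have hU := h.mapsTo hz
  -- The claimed formula, solved for the Christoffel symbols of `G'`, defines a torsion free and
  -- metric connection; uniqueness finishes the argument.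
  rw [h.isMetricOn'.chris_unique hz (T := fun a v => e.symm
    (chris G (ψ z) (fderiv ℝ ψ z a) (fderiv ℝ ψ z v) + fderiv ℝ (fderiv ℝ ψ) z a v)), hJ]
  · intro v w
    rw [h.isMetricOn.chris_symm hU, h.fderiv_fderiv_symm hz]
  · intro a v w
    have h1 : (fun y => G' y v w)
        =ᶠ[𝓝 z] fun y => G (ψ y) (fderiv ℝ ψ y v) (fderiv ℝ ψ y w) := by
      filter_upwards [h.isMetricOn'.isOpen.mem_nhds hz] with y hy using h.apply_eq y hy v w
    have h2 := (((h.isMetricOn.differentiableAt hU).hasFDerivAt.comp z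
      (h.differentiableAt hz).hasFDerivAt).clm_apply
        (h.hasFDerivAt_fderiv_apply hz v)).clm_apply (h.hasFDerivAt_fderiv_apply hz w)
    have h3 := (hasFDerivAt_apply_apply (h.isMetricOn'.differentiableAt hz) v w).unique
      (h2.congr_of_eventuallyEq h1)
    have h4 := congrArg (fun L : E →L[ℝ] ℝ => L a) h3
    simp only [ContinuousLinearMap.flip_apply, add_apply, ContinuousLinearMap.comp_apply,
      Function.comp_apply] at h4
    rw [h4, h.apply_eq z hz, h.apply_eq z hz, hJ, hJ, h.isMetricOn.fderiv_eq hU]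
    simp only [map_add, add_apply]
    ring

/-- The transformation rule for the curvature. -/
theorem fderiv_riemEnd (h : IsPullback G U ψ G' U') {z : E} (hz : z ∈ U') (a v b : E) :
    fderiv ℝ ψ z (riemEnd (chris G') z a v b)
      = riemEnd (chris G) (ψ z) (fderiv ℝ ψ z a) (fderiv ℝ ψ z v) (fderiv ℝ ψ z b) := by
  have hU := h.mapsTo hz
  -- The derivative of the transformation rule for the Christoffel symbols in the direction `b`.
  have key : ∀ a b, fderiv ℝ (fderiv ℝ ψ) z b (chris G' z a v)
      + fderiv ℝ ψ z (fderiv ℝ (chris G') z b a v)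
      = fderiv ℝ (chris G) (ψ z) (fderiv ℝ ψ z b) (fderiv ℝ ψ z a) (fderiv ℝ ψ z v)
        + chris G (ψ z) (fderiv ℝ (fderiv ℝ ψ) z b a) (fderiv ℝ ψ z v)
        + chris G (ψ z) (fderiv ℝ ψ z a) (fderiv ℝ (fderiv ℝ ψ) z b v)
        + fderiv ℝ (fderiv ℝ (fderiv ℝ ψ)) z b a v := by
    intro a b
    have h1 : (fun y => fderiv ℝ ψ y (chris G' y a v)) =ᶠ[𝓝 z] fun y =>
        chris G (ψ y) (fderiv ℝ ψ y a) (fderiv ℝ ψ y v) + fderiv ℝ (fderiv ℝ ψ) y a v := by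
      filter_upwards [h.isMetricOn'.isOpen.mem_nhds hz] with y hy using h.fderiv_chris hy a v
    have h2 := (h.differentiableAt_fderiv hz).hasFDerivAt.clm_apply
      (hasFDerivAt_apply_apply (h.isMetricOn'.differentiableAt_chris hz) a v)
    have h3 := (((h.isMetricOn.differentiableAt_chris hU).hasFDerivAt.comp z
      (h.differentiableAt hz).hasFDerivAt).clm_apply
        (h.hasFDerivAt_fderiv_apply hz a)).clm_apply (h.hasFDerivAt_fderiv_apply hz v)
    have h4 := h3.add (hasFDerivAt_apply_apply (h.differentiableAt_fderiv_fderiv hz) a v)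
    have h5 := congrArg (fun L : E →L[ℝ] E => L b) (h2.unique (h4.congr_of_eventuallyEq h1))
    simp only [ContinuousLinearMap.flip_apply, add_apply, ContinuousLinearMap.comp_apply,
      Function.comp_apply] at h5
    rw [add_comm, h5]
    abel
  -- The third derivatives of `ψ` are symmetric and drop out of the antisymmetrized expression.
  have hs : fderiv ℝ (fderiv ℝ (fderiv ℝ ψ)) z b a v = fderiv ℝ (fderiv ℝ (fderiv ℝ ψ)) z a b v :=
    congrArg (fun L : E →L[ℝ] E => L v)
      ((h.contDiffOn_fderiv.contDiffAt (h.isMetricOn'.isOpen.mem_nhds hz)).isSymmSndFDerivAt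
        two_le_smooth b a)
  have k1 := key a b
  have k2 := key b a
  rw [riemEnd_apply, riemEnd_apply]
  simp only [map_add, map_sub, h.fderiv_chris hz, h.fderiv_fderiv_symm hz a b] at k1 k2 ⊢
  rw [hs] at k1
  linear_combination (norm := module) k1 - k2

/-- The curvature endomorphisms are conjugate by the derivative of `ψ`, so they have the same trace.
-/
theorem ricForm_eq (h : IsPullback G U ψ G' U') {z : E} (hz : z ∈ U') (v w : E) :
    ricForm (chris G') z v w
      = ricForm (chris G) (ψ z) (fderiv ℝ ψ z v) (fderiv ℝ ψ z w) := by
  obtain ⟨e, he⟩ := h.exists_equiv hz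
  rw [ricForm_apply, ricForm_apply, ← LinearMap.trace_conj' _ e.toLinearEquiv]
  congr 1
  ext b
  have := h.fderiv_riemEnd hz v w (e.symm b)
  rw [← he] at this
  simp only [ContinuousLinearEquiv.coe_coe, ContinuousLinearEquiv.apply_symm_apply] at this
  rw [← he]
  exact this

theorem scal_eq (h : IsPullback G U ψ G' U') {z : E} (hz : z ∈ U') :
    scal G' z = scal G (ψ z) := by
  obtain ⟨e, he⟩ := h.exists_equiv hz
  rw [scal, scal, ← LinearMap.trace_conj' _ e.toLinearEquiv]
  congr 1
  ext b
  refine (h.isMetricOn.isPosForm _ (h.mapsTo hz)).ext_right fun x => ?_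
  rw [h.isMetricOn.apply_ricEnd (h.mapsTo hz)]
  have h1 := h.isMetricOn'.apply_ricEnd hz (e.symm b) (e.symm x)
  rw [h.apply_eq z hz, h.ricForm_eq hz, ← he] at h1
  simp only [ContinuousLinearEquiv.coe_coe, ContinuousLinearEquiv.apply_symm_apply] at h1
  exact h1

/-- The Schouten tensor is invariant under diffeomorphisms. -/
theorem schoutenForm_eq (h : IsPullback G U ψ G' U') {z : E} (hz : z ∈ U') (v w : E) :
    schoutenForm G' z v w
      = schoutenForm G (ψ z) (fderiv ℝ ψ z v) (fderiv ℝ ψ z w) := by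
  rw [schoutenForm_apply, schoutenForm_apply, h.ricForm_eq hz, h.scal_eq hz, h.apply_eq z hz]

end IsPullback

end Pullback

end

/-! ### The conformal transformation law for the Schouten tensor. -/

section

set_option maxSynthPendingDepth 3

section Conformal

variable {E : Type*} [NormedAddCommGroup E] [NormedSpace ℝ E] [FiniteDimensional ℝ E]
  {G : E → E →L[ℝ] E →L[ℝ] ℝ} {U : Set E} {f : E → ℝ}

/-- The gradient of `f` with respect to the metric `G`. -/
noncomputable def gradG (G : E → E →L[ℝ] E →L[ℝ] ℝ) (f : E → ℝ) (z : E) : E :=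
  (G z).inverse (fderiv ℝ f z)

/-- The covariant Hessian of `f` with respect to the metric `G`. -/
noncomputable def covHess (G : E → E →L[ℝ] E →L[ℝ] ℝ) (f : E → ℝ) (z : E) : E →L[ℝ] E →L[ℝ] ℝ :=
  fderiv ℝ (fderiv ℝ f) z
    - (ContinuousLinearMap.compL ℝ E E ℝ (fderiv ℝ f z)).comp (chris G z)

theorem covHess_apply (z v w : E) : covHess G f z v w
    = fderiv ℝ (fderiv ℝ f) z v w - fderiv ℝ f z (chris G z v w) := rfl

/-- The covariant derivative of the gradient. -/
noncomputable def covGrad (G : E → E →L[ℝ] E →L[ℝ] ℝ) (f : E → ℝ) (z : E) : E →L[ℝ] E :=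
  (G z).inverse.comp (covHess G f z)

namespace IsMetricOn

theorem apply_gradG (hG : IsMetricOn G U) {z : E} (hz : z ∈ U) (w : E) :
    G z (gradG G f z) w = fderiv ℝ f z w := by
  rw [gradG, (hG.isPosForm z hz).apply_inverse]

theorem apply_covGrad (hG : IsMetricOn G U) {z : E} (hz : z ∈ U) (v w : E) :
    G z (covGrad G f z v) w = covHess G f z v w :=
  congrArg (fun L : E →L[ℝ] ℝ => L w) ((hG.isPosForm z hz).apply_inverse _)

theorem contDiffOn_fderiv_fun (hG : IsMetricOn G U) (hf : ContDiffOn ℝ ∞ f U) :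
    ContDiffOn ℝ ∞ (fderiv ℝ f) U := hf.fderiv_of_isOpen hG.isOpen (by simp)

theorem differentiableAt_fderiv_fun (hG : IsMetricOn G U) (hf : ContDiffOn ℝ ∞ f U) {z : E}
    (hz : z ∈ U) : DifferentiableAt ℝ (fderiv ℝ f) z :=
  ((hG.contDiffOn_fderiv_fun hf).contDiffAt (hG.isOpen.mem_nhds hz)).differentiableAt (by simp)

theorem fderiv_fderiv_fun_symm (hG : IsMetricOn G U) (hf : ContDiffOn ℝ ∞ f U) {z : E}
    (hz : z ∈ U) (v w : E) : fderiv ℝ (fderiv ℝ f) z v w = fderiv ℝ (fderiv ℝ f) z w v :=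
  (hf.contDiffAt (hG.isOpen.mem_nhds hz)).isSymmSndFDerivAt two_le_smooth v w

theorem covHess_symm (hG : IsMetricOn G U) (hf : ContDiffOn ℝ ∞ f U) {z : E}
    (hz : z ∈ U) (v w : E) : covHess G f z v w = covHess G f z w v := by
  rw [covHess_apply, covHess_apply, hG.fderiv_fderiv_fun_symm hf hz, hG.chris_symm hz]

theorem hasFDerivAt_fderiv_fun_apply (hG : IsMetricOn G U) (hf : ContDiffOn ℝ ∞ f U) {z : E}
    (hz : z ∈ U) (v : E) :
    HasFDerivAt (fun y => fderiv ℝ f y v) ((fderiv ℝ (fderiv ℝ f) z).flip v) z :=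
  (ContinuousLinearMap.apply ℝ ℝ v).hasFDerivAt.comp z
    (hG.differentiableAt_fderiv_fun hf hz).hasFDerivAt

theorem differentiableAt_gradG (hG : IsMetricOn G U) (hf : ContDiffOn ℝ ∞ f U) {z : E}
    (hz : z ∈ U) : DifferentiableAt ℝ (gradG G f) z :=
  (((hG.contDiffOn_inverse.contDiffAt (hG.isOpen.mem_nhds hz)).differentiableAt
    (by simp)).clm_apply (hG.differentiableAt_fderiv_fun hf hz) :)

/-- Obtained by differentiating `G(grad f, w) = df(w)` for constant `w` and using metric
compatibility. -/
theorem fderiv_gradG (hG : IsMetricOn G U) (hf : ContDiffOn ℝ ∞ f U) {z : E} (hz : z ∈ U)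
    (b : E) : fderiv ℝ (gradG G f) z b = covGrad G f z b - chris G z b (gradG G f z) := by
  refine (hG.isPosForm z hz).ext_right fun w => ?_
  rw [map_sub, sub_apply, hG.apply_covGrad hz]
  have h1 : (fun y => G y (gradG G f y) w) =ᶠ[𝓝 z] fun y => fderiv ℝ f y w := by
    filter_upwards [hG.isOpen.mem_nhds hz] with y hy using hG.apply_gradG hy w
  have h2 := (((hG.differentiableAt hz).hasFDerivAt.clm_apply
    (hG.differentiableAt_gradG hf hz).hasFDerivAt).clm_apply (hasFDerivAt_const w z)).unique
      ((hG.hasFDerivAt_fderiv_fun_apply hf hz w).congr_of_eventuallyEq h1)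
  have h3 := congrArg (fun L : E →L[ℝ] ℝ => L b) h2
  simp only [ContinuousLinearMap.flip_apply, add_apply, ContinuousLinearMap.comp_apply,
    hG.fderiv_eq hz, hG.apply_gradG hz, zero_apply, map_zero, zero_add] at h3
  rw [covHess_apply]
  linarith

theorem conformal (hG : IsMetricOn G U) (hf : ContDiffOn ℝ ∞ f U) :
    IsMetricOn (fun z => Real.exp (2 * f z) • G z) U :=
  ⟨hG.isOpen, ((contDiffOn_const.mul hf).exp.smul hG.contDiffOn :),
    fun z hz => (hG.isPosForm z hz).smul (Real.exp_pos _)⟩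

/-- The Christoffel symbols of a conformal metric. -/
theorem chris_conformal (hG : IsMetricOn G U) (hf : ContDiffOn ℝ ∞ f U) {z : E} (hz : z ∈ U)
    (a v : E) : chris (fun z => Real.exp (2 * f z) • G z) z a v
      = chris G z a v + fderiv ℝ f z a • v + fderiv ℝ f z v • a - G z a v • gradG G f z := by
  have hs := (hG.isPosForm z hz).symm
  refine (hG.conformal hf).chris_unique hz (T := fun a v => chris G z a v + fderiv ℝ f z a • v
    + fderiv ℝ f z v • a - G z a v • gradG G f z) (fun v w => ?_) (fun a v w => ?_) a v
  · rw [hG.chris_symm hz, hs]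
    abel
  · have hfd : DifferentiableAt ℝ f z :=
      (hf.contDiffAt (hG.isOpen.mem_nhds hz)).differentiableAt (by simp)
    have h1 := ((hfd.hasFDerivAt.const_mul 2).exp.smul (hG.differentiableAt hz).hasFDerivAt)
    have h2 : fderiv ℝ (fun z => Real.exp (2 * f z) • G z) z = _ := h1.fderiv
    rw [h2]
    simp only [map_add, map_sub, map_smul, add_apply, sub_apply, smul_apply, smul_eq_mul,
      ContinuousLinearMap.smulRight_apply, hG.apply_gradG hz, hs v (gradG G f z),
      hG.fderiv_eq hz, hs v a]
    ring

/-- The curvature of a conformal metric. -/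
theorem riemEnd_conformal (hG : IsMetricOn G U) (hf : ContDiffOn ℝ ∞ f U) {z : E} (hz : z ∈ U)
    (b a v : E) : riemEnd (chris fun z => Real.exp (2 * f z) • G z) z a v b
      = riemEnd (chris G) z a v b + covHess G f z b v • a - covHess G f z a v • b
        - G z a v • covGrad G f z b + G z b v • covGrad G f z a
        - (fderiv ℝ f z b * fderiv ℝ f z v) • a + (fderiv ℝ f z a * fderiv ℝ f z v) • b
        - (fderiv ℝ f z (gradG G f z) * G z a v) • b
        + (fderiv ℝ f z (gradG G f z) * G z b v) • a
        - (fderiv ℝ f z a * G z b v) • gradG G f z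
        + (fderiv ℝ f z b * G z a v) • gradG G f z := by
  have hs := (hG.isPosForm z hz).symm
  have key : ∀ b a, fderiv ℝ (chris fun z => Real.exp (2 * f z) • G z) z b a v
      = fderiv ℝ (chris G) z b a v + fderiv ℝ (fderiv ℝ f) z b a • v
        + fderiv ℝ (fderiv ℝ f) z b v • a
        - (G z (chris G z b a) v + G z a (chris G z b v)) • gradG G f z
        - G z a v • (covGrad G f z b - chris G z b (gradG G f z)) := by
    intro b a
    have h1 : (fun y => chris (fun z => Real.exp (2 * f z) • G z) y a v) =ᶠ[𝓝 z] fun y =>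
        chris G y a v + fderiv ℝ f y a • v + fderiv ℝ f y v • a - G y a v • gradG G f y := by
      filter_upwards [hG.isOpen.mem_nhds hz] with y hy using hG.chris_conformal hf hy a v
    have h2 := (((hasFDerivAt_apply_apply (hG.differentiableAt_chris hz) a v).add
      ((hG.hasFDerivAt_fderiv_fun_apply hf hz a).smul_const v)).add
      ((hG.hasFDerivAt_fderiv_fun_apply hf hz v).smul_const a)).sub
      ((hasFDerivAt_apply_apply (hG.differentiableAt hz) a v).smul
        (hG.differentiableAt_gradG hf hz).hasFDerivAt)
    have h3 := (hasFDerivAt_apply_apply ((hG.conformal hf).differentiableAt_chris hz) a v).unique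
      (h2.congr_of_eventuallyEq h1)
    have h4 := congrArg (fun L : E →L[ℝ] E => L b) h3
    simp only [ContinuousLinearMap.flip_apply, add_apply, sub_apply, smul_apply,
      ContinuousLinearMap.smulRight_apply, hG.fderiv_gradG hf hz, hG.fderiv_eq hz] at h4
    rw [h4]
    abel
  rw [riemEnd_apply, riemEnd_apply, key, key]
  simp only [hG.chris_conformal hf hz, map_add, map_sub, map_smul, smul_eq_mul, hG.apply_gradG hz, hs _ (gradG G f z), covHess_apply,
    hG.fderiv_fderiv_fun_symm hf hz a b, hG.chris_symm hz a b, hs a b]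
  module

/-- The Ricci curvature of a conformal metric. -/
theorem ricForm_conformal (hG : IsMetricOn G U) (hf : ContDiffOn ℝ ∞ f U) {z : E} (hz : z ∈ U)
    (v w : E) : ricForm (chris fun z => Real.exp (2 * f z) • G z) z v w
      = ricForm (chris G) z v w
        - ((Module.finrank ℝ E : ℝ) - 2)
          * (covHess G f z v w - fderiv ℝ f z v * fderiv ℝ f z w)
        - (LinearMap.trace ℝ E (covGrad G f z : E →ₗ[ℝ] E)
          + ((Module.finrank ℝ E : ℝ) - 2) * fderiv ℝ f z (gradG G f z)) * G z v w := by
  have hs := (hG.isPosForm z hz).symm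
  -- As endomorphisms in `b`, the correction terms are multiples of the identity and of the
  -- covariant derivative of the gradient, or of rank one, so their traces can be read off.
  have key : (riemEnd (chris fun z => Real.exp (2 * f z) • G z) z v w : E →ₗ[ℝ] E)
      = (riemEnd (chris G) z v w : E →ₗ[ℝ] E)
        + ((covHess G f z).flip w : E →ₗ[ℝ] ℝ).smulRight v
        - covHess G f z v w • LinearMap.id
        - G z v w • (covGrad G f z : E →ₗ[ℝ] E)
        + ((G z).flip w : E →ₗ[ℝ] ℝ).smulRight (covGrad G f z v)
        - fderiv ℝ f z w • (fderiv ℝ f z : E →ₗ[ℝ] ℝ).smulRight v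
        + (fderiv ℝ f z v * fderiv ℝ f z w) • LinearMap.id
        - (fderiv ℝ f z (gradG G f z) * G z v w) • LinearMap.id
        + fderiv ℝ f z (gradG G f z) • ((G z).flip w : E →ₗ[ℝ] ℝ).smulRight v
        - fderiv ℝ f z v • ((G z).flip w : E →ₗ[ℝ] ℝ).smulRight (gradG G f z)
        + G z v w • (fderiv ℝ f z : E →ₗ[ℝ] ℝ).smulRight (gradG G f z) := by
    ext b
    simp only [ContinuousLinearMap.coe_coe, hG.riemEnd_conformal hf hz, LinearMap.add_apply,
      LinearMap.sub_apply, LinearMap.smul_apply, LinearMap.smulRight_apply,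
      ContinuousLinearMap.flip_apply, LinearMap.id_apply]
    module
  rw [ricForm_apply, ricForm_apply, key]
  simp only [map_add, map_sub, map_smul, LinearMap.trace_smulRight, LinearMap.trace_id,
    ContinuousLinearMap.coe_coe, ContinuousLinearMap.flip_apply, smul_eq_mul,
    hG.apply_gradG hz, hG.apply_covGrad hz]
  ring

/-- The scalar curvature of a conformal metric. -/
theorem scal_conformal (hG : IsMetricOn G U) (hf : ContDiffOn ℝ ∞ f U) {z : E} (hz : z ∈ U) :
    Real.exp (2 * f z) * scal (fun z => Real.exp (2 * f z) • G z) z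
      = scal G z - 2 * ((Module.finrank ℝ E : ℝ) - 1)
          * LinearMap.trace ℝ E (covGrad G f z : E →ₗ[ℝ] E)
        - ((Module.finrank ℝ E : ℝ) - 2) * ((Module.finrank ℝ E : ℝ) - 1)
          * fderiv ℝ f z (gradG G f z) := by
  -- The factor `exp (2 f)` cancels the one coming from raising an index with the inverse of the
  -- conformal metric.
  have key : Real.exp (2 * f z) • ricEnd (fun z => Real.exp (2 * f z) • G z) z
      = ricEnd G z - ((Module.finrank ℝ E : ℝ) - 2) • ((covGrad G f z : E →ₗ[ℝ] E)
          - (fderiv ℝ f z : E →ₗ[ℝ] ℝ).smulRight (gradG G f z))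
        - (LinearMap.trace ℝ E (covGrad G f z : E →ₗ[ℝ] E)
          + ((Module.finrank ℝ E : ℝ) - 2) * fderiv ℝ f z (gradG G f z)) • LinearMap.id := by
    refine LinearMap.ext fun v => (hG.isPosForm z hz).ext_right fun w => ?_
    have h1 := (hG.conformal hf).apply_ricEnd hz v w
    rw [hG.ricForm_conformal hf hz, ← hG.apply_ricEnd hz v w] at h1
    simp only [smul_apply, smul_eq_mul] at h1
    simp only [LinearMap.smul_apply, map_smul, map_sub, LinearMap.sub_apply, smul_apply, sub_apply,
      smul_eq_mul, h1, LinearMap.smulRight_apply, ContinuousLinearMap.coe_coe, LinearMap.id_apply,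
      hG.apply_covGrad hz, hG.apply_gradG hz]
  have h := congrArg (LinearMap.trace ℝ E) key
  simp only [map_sub, map_smul, LinearMap.trace_smulRight, LinearMap.trace_id,
    ContinuousLinearMap.coe_coe, smul_eq_mul] at h
  rw [scal, scal, h]
  ring

/-- The Schouten tensor of a conformal metric. -/
theorem schoutenForm_conformal (hn : 3 ≤ Module.finrank ℝ E) (hG : IsMetricOn G U)
    (hf : ContDiffOn ℝ ∞ f U) {z : E} (hz : z ∈ U) (v w : E) :
    schoutenForm (fun z => Real.exp (2 * f z) • G z) z v w
      = schoutenForm G z v w - covHess G f z v w + fderiv ℝ f z v * fderiv ℝ f z w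
        - 1 / 2 * fderiv ℝ f z (gradG G f z) * G z v w := by
  have hn' : (3 : ℝ) ≤ Module.finrank ℝ E := by exact_mod_cast hn
  have h1 : ((Module.finrank ℝ E : ℝ) - 1) ≠ 0 := by intro h; linarith
  have h2 : ((Module.finrank ℝ E : ℝ) - 2) ≠ 0 := by intro h; linarith
  have h3 := hG.scal_conformal hf hz
  rw [schoutenForm_apply, schoutenForm_apply, hG.ricForm_conformal hf hz]
  simp only [smul_apply, smul_eq_mul]
  have h4 : scal (fun z => Real.exp (2 * f z) • G z) z
      / (2 * ((Module.finrank ℝ E : ℝ) - 1)) * (Real.exp (2 * f z) * G z v w)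
      = (Real.exp (2 * f z) * scal (fun z => Real.exp (2 * f z) • G z) z)
        / (2 * ((Module.finrank ℝ E : ℝ) - 1)) * G z v w := by ring
  rw [h4, h3]
  field_simp
  ring

end IsMetricOn

/-- Locality of the connection: `u ^ (4 / (n - 2))` is an exponential only where `u` is known to be
positive, so the two metrics agree merely near each point of `U`. -/
theorem chris_congr {G' : E → E →L[ℝ] E →L[ℝ] ℝ} {z : E} (h : G =ᶠ[𝓝 z] G') :
    chris G =ᶠ[𝓝 z] chris G' := by
  filter_upwards [h.eventuallyEq_nhds] with y hy
  rw [chris, chris, hy.fderiv_eq, hy.eq_of_nhds]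

theorem riemEnd_congr {Γ Γ' : E → E →L[ℝ] E →L[ℝ] E} {z : E} (h : Γ =ᶠ[𝓝 z] Γ') (v w : E) :
    riemEnd Γ z v w = riemEnd Γ' z v w := by
  rw [riemEnd, riemEnd, h.fderiv_eq, h.eq_of_nhds]

theorem ricForm_congr {Γ Γ' : E → E →L[ℝ] E →L[ℝ] E} {z : E} (h : Γ =ᶠ[𝓝 z] Γ') :
    ricForm Γ z = ricForm Γ' z := by
  ext v w
  rw [ricForm_apply, ricForm_apply, riemEnd_congr h]

theorem schoutenForm_congr {G' : E → E →L[ℝ] E →L[ℝ] ℝ} {z : E} (h : G =ᶠ[𝓝 z] G') :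
    schoutenForm G z = schoutenForm G' z := by
  ext v w
  rw [schoutenForm_apply, schoutenForm_apply, scal, scal, ricEnd, ricEnd,
    ricForm_congr (chris_congr h), h.eq_of_nhds]

/-- The Schouten tensor of the metric `u ^ (4 / (n - 2)) G`. -/
theorem IsMetricOn.schoutenForm_rpow_smul (hn : 3 ≤ Module.finrank ℝ E) (hG : IsMetricOn G U)
    {u : E → ℝ} (hu : ContDiffOn ℝ ∞ u U) (hpos : ∀ z ∈ U, 0 < u z) {z : E} (hz : z ∈ U)
    (v w : E) :
    schoutenForm (fun z => (u z ^ (4 / ((Module.finrank ℝ E : ℝ) - 2))) • G z) z v w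
      = -(2 / ((Module.finrank ℝ E : ℝ) - 2)) * (u z)⁻¹ * covHess G u z v w
        + 2 * (Module.finrank ℝ E : ℝ) / ((Module.finrank ℝ E : ℝ) - 2) ^ 2 * ((u z)⁻¹) ^ 2
          * (fderiv ℝ u z v * fderiv ℝ u z w)
        - 2 / ((Module.finrank ℝ E : ℝ) - 2) ^ 2 * ((u z)⁻¹) ^ 2
          * fderiv ℝ u z (gradG G u z) * G z v w + schoutenForm G z v w := by
  have hn' : (3 : ℝ) ≤ Module.finrank ℝ E := by exact_mod_cast hn
  have h2 : ((Module.finrank ℝ E : ℝ) - 2) ≠ 0 := by intro h; linarith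
  -- With `f = 2 / (n - 2) · log u` one has `exp (2 f) = u ^ (4 / (n - 2))`.
  set c : ℝ := 2 / ((Module.finrank ℝ E : ℝ) - 2) with hc
  set f : E → ℝ := fun z => c * Real.log (u z) with hf
  have hfs : ContDiffOn ℝ ∞ f U :=
    contDiffOn_const.mul (hu.log fun z hz => (hpos z hz).ne')
  have hU := hG.isOpen.mem_nhds hz
  have hd : ∀ y ∈ U, DifferentiableAt ℝ u y := fun y hy =>
    (hu.contDiffAt (hG.isOpen.mem_nhds hy)).differentiableAt (by simp)
  have hG' : (fun z => (u z ^ (4 / ((Module.finrank ℝ E : ℝ) - 2))) • G z)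
      =ᶠ[𝓝 z] fun z => Real.exp (2 * f z) • G z := by
    filter_upwards [hU] with y hy
    rw [Real.rpow_def_of_pos (hpos y hy), hf, hc]
    congr 2
    ring
  have h1 : ∀ y ∈ U, fderiv ℝ f y = (c * (u y)⁻¹) • fderiv ℝ u y := fun y hy => by
    have := (((hd y hy).hasFDerivAt.log (hpos y hy).ne').const_mul c).fderiv
    rw [hf, mul_smul]
    exact this
  have h3 : fderiv ℝ (fderiv ℝ f) z v w
      = c * (u z)⁻¹ * fderiv ℝ (fderiv ℝ u) z v w
        - c * ((u z)⁻¹) ^ 2 * (fderiv ℝ u z v * fderiv ℝ u z w) := by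
    have h4 : fderiv ℝ f =ᶠ[𝓝 z] fun y => (c * (u y)⁻¹) • fderiv ℝ u y := by
      filter_upwards [hU] with y hy using h1 y hy
    have h5 := ((((hasDerivAt_inv (hpos z hz).ne').comp_hasFDerivAt z
      (hd z hz).hasFDerivAt).const_mul c).smul
        (hG.differentiableAt_fderiv_fun hu hz).hasFDerivAt).congr_of_eventuallyEq h4
    rw [h5.fderiv]
    simp only [Function.comp_apply, add_apply, smul_apply, ContinuousLinearMap.smulRight_apply,
      smul_eq_mul]
    ring
  rw [schoutenForm_congr hG', hG.schoutenForm_conformal hn hfs hz, covHess_apply, covHess_apply,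
    h3, gradG, h1 z hz, map_smul, ← gradG]
  simp only [smul_apply, map_smul, smul_eq_mul]
  rw [hc]
  field_simp
  ring

end Conformal

end

/-! ### Curvature through derivatives within a set, and its continuity up to the boundary. -/

section

set_option maxSynthPendingDepth 3

section CoordinateExpressions

variable {n : ℕ} {G : Eucl n → Eucl n →L[ℝ] Eucl n →L[ℝ] ℝ} {U s : Set (Eucl n)}

theorem eq_sum_basisVec (v : Eucl n) : v = ∑ i, v i • (basisVec i : Eucl n) := by
  ext j
  simp [basisVec, Pi.single_apply]

theorem IsPosForm.posDef_gramMatrix {B : Eucl n →L[ℝ] Eucl n →L[ℝ] ℝ} (hB : IsPosForm B) :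
    (gramMatrix fun v w => B v w).PosDef := by
  refine Matrix.PosDef.of_dotProduct_mulVec_pos ?_ fun x hx => ?_
  · ext i j
    simp [gramMatrix, hB.symm (basisVec j)]
  · have h2 := hB.pos (WithLp.toLp 2 x) (by simpa using hx)
    rw [eq_sum_basisVec (WithLp.toLp 2 x)] at h2
    simp only [map_sum, map_smul, sum_apply, smul_apply, smul_eq_mul] at h2
    simpa [gramMatrix, dotProduct, Matrix.mulVec, Finset.mul_sum, mul_assoc, mul_left_comm,
      mul_comm, hB.symm] using h2

/-- The trace of an endomorphism of `ℝⁿ` in the standard basis. -/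
theorem trace_eq_sum (T : Eucl n →ₗ[ℝ] Eucl n) :
    LinearMap.trace ℝ (Eucl n) T = ∑ i, (T (basisVec i)) i := by
  rw [LinearMap.trace_eq_matrix_trace ℝ (EuclideanSpace.basisFun (Fin n) ℝ).toBasis, Matrix.trace]
  refine Finset.sum_congr rfl fun i _ => ?_
  simp [LinearMap.toMatrix_apply, basisVec]

theorem christoffel_eq_chris {z : Eucl n} (hs : s ∈ 𝓝 z) (v w : Eucl n) :
    christoffel G s z v w = chris G z v w := by
  rw [christoffel, fderivWithin_of_mem_nhds hs, chris]
  rfl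

namespace IsMetricOn

/-- On an open set contained in `s`, derivatives within `s` are ordinary derivatives, also in a
neighbourhood, as the second differentiation requires. -/
theorem riemannCoord_eq (hG : IsMetricOn G U) {z : Eucl n} (hz : z ∈ U) (hs : U ⊆ s)
    (a v w : Eucl n) : riemannCoord G s z a v w = riemEnd (chris G) z v w a := by
  have hsz : s ∈ 𝓝 z := mem_of_superset (hG.isOpen.mem_nhds hz) hs
  have h1 : ∀ v w, (fun y => christoffel G s y v w) =ᶠ[𝓝 z] fun y => chris G y v w := by
    intro v w
    filter_upwards [hG.isOpen.mem_nhds hz] with y hy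
    exact christoffel_eq_chris (mem_of_superset (hG.isOpen.mem_nhds hy) hs) v w
  rw [riemannCoord, riemEnd_apply, fderivWithin_of_mem_nhds hsz, fderivWithin_of_mem_nhds hsz,
    (h1 v w).fderiv_eq, (h1 a w).fderiv_eq,
    (hasFDerivAt_apply_apply (hG.differentiableAt_chris hz) v w).fderiv,
    (hasFDerivAt_apply_apply (hG.differentiableAt_chris hz) a w).fderiv]
  simp only [christoffel_eq_chris hsz]
  rfl

theorem ricciCoord_eq (hG : IsMetricOn G U) {z : Eucl n} (hz : z ∈ U) (hs : U ⊆ s)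
    (v w : Eucl n) : ricciCoord G s z v w = ricForm (chris G) z v w := by
  rw [ricciCoord, ricForm_apply, trace_eq_sum]
  simp only [hG.riemannCoord_eq hz hs]
  rfl

theorem scalarCoord_eq (hG : IsMetricOn G U) {z : Eucl n} (hz : z ∈ U) (hs : U ⊆ s) :
    scalarCoord G s z = scal G z := by
  rw [scalarCoord, scal, trace_eq_sum]
  refine Finset.sum_congr rfl fun i _ => ?_
  rw [hG.ricciCoord_eq hz hs]
  exact (hG.isPosForm z hz).inverse_symm
    (LinearMap.toContinuousLinearMap (ricForm (chris G) z (basisVec i))) (EuclideanSpace.proj i)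

theorem schoutenCoord_eq (hG : IsMetricOn G U) {z : Eucl n} (hz : z ∈ U) (hs : U ⊆ s)
    (v w : Eucl n) : schoutenCoord G s z v w = schoutenForm G z v w := by
  rw [schoutenCoord, schoutenForm_apply, hG.ricciCoord_eq hz hs, hG.scalarCoord_eq hz hs,
    finrank_euclideanSpace_fin]

end IsMetricOn

section UpToBoundary

variable {z : Eucl n}

theorem contDiffWithinAt_inverse (hG : ContDiffWithinAt ℝ ∞ G s z) (hp : IsPosForm (G z)) :
    ContDiffWithinAt ℝ ∞ (fun y => (G y).inverse) s z := by
  obtain ⟨e, he⟩ := hp.exists_equiv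
  have h1 : ContDiffAt ℝ ∞ ContinuousLinearMap.inverse (G z) := by
    rw [← he]; exact contDiffAt_map_inverse e
  exact h1.comp_contDiffWithinAt z hG

/-- The arguments `V` and `W` may vary with the point, because the quadratic terms of the curvature
insert one Christoffel vector into another. -/
theorem contDiffWithinAt_christoffel (hs : UniqueDiffOn ℝ s) (hz : z ∈ s)
    (hG : ContDiffWithinAt ℝ ∞ G s z) (hp : IsPosForm (G z)) {V W : Eucl n → Eucl n}
    (hV : ContDiffWithinAt ℝ ∞ V s z) (hW : ContDiffWithinAt ℝ ∞ W s z) :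
    ContDiffWithinAt ℝ ∞ (fun y => christoffel G s y (V y) (W y)) s z := by
  have h1 : ContDiffWithinAt ℝ ∞ (fderivWithin ℝ G s) s z :=
    hG.fderivWithin_right hs (by simp) hz
  have hfl : ContDiffWithinAt ℝ ∞ (fun y => ((fderivWithin ℝ G s y).flip (V y)).flip (W y)) s z :=
    ((ContinuousLinearMap.flipₗᵢ ℝ (Eucl n) (Eucl n)
      ℝ).toContinuousLinearEquiv.contDiff.comp_contDiffWithinAt
      (((ContinuousLinearMap.flipₗᵢ ℝ (Eucl n) (Eucl n)
        (Eucl n →L[ℝ] ℝ)).toContinuousLinearEquiv.contDiff.comp_contDiffWithinAt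
          h1).clm_apply hV)).clm_apply hW
  exact (contDiffWithinAt_inverse hG hp).clm_apply
    (((((h1.clm_apply hV).clm_apply hW).add ((h1.clm_apply hW).clm_apply hV)).sub hfl).const_smul
      (1 / 2 : ℝ))

theorem contDiffWithinAt_riemannCoord (hs : UniqueDiffOn ℝ s) (hz : z ∈ s)
    (hG : ContDiffWithinAt ℝ ∞ G s z) (hp : IsPosForm (G z)) (a v w : Eucl n) :
    ContDiffWithinAt ℝ ∞ (fun y => riemannCoord G s y a v w) s z := by
  have hc := fun v : Eucl n => (contDiffWithinAt_const (c := v) : ContDiffWithinAt ℝ ∞ _ s z)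
  have h1 := fun v w => contDiffWithinAt_christoffel hs hz hG hp (hc v) (hc w)
  have h2 : ∀ a v w, ContDiffWithinAt ℝ ∞
      (fun y => fderivWithin ℝ (fun z => christoffel G s z v w) s y a) s z := fun a v w =>
    ((h1 v w).fderivWithin_right hs (by simp) hz).clm_apply (hc a)
  exact (((h2 a v w).sub (h2 v a w)).add
    (contDiffWithinAt_christoffel hs hz hG hp (hc a) (h1 v w))).sub
      (contDiffWithinAt_christoffel hs hz hG hp (hc v) (h1 a w))

theorem contDiffWithinAt_ricciCoord (hs : UniqueDiffOn ℝ s) (hz : z ∈ s)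
    (hG : ContDiffWithinAt ℝ ∞ G s z) (hp : IsPosForm (G z)) (v w : Eucl n) :
    ContDiffWithinAt ℝ ∞ (fun y => ricciCoord G s y v w) s z :=
  ContDiffWithinAt.sum fun i _ =>
    ((EuclideanSpace.proj i : Eucl n →L[ℝ] ℝ).contDiff.comp_contDiffWithinAt
      (contDiffWithinAt_riemannCoord hs hz hG hp (basisVec i) v w))

theorem christoffel_eq_sum (y v w : Eucl n) :
    christoffel G s y v w = ∑ j, w j • christoffel G s y v (basisVec j) := by
  have h : ∀ w, christoffel G s y v w = ((G y).inverse.comp ((1 / 2 : ℝ) •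
      (fderivWithin ℝ G s y v + (fderivWithin ℝ G s y).flip v
        - ((fderivWithin ℝ G s y).flip v).flip))) w := fun w => rfl
  simp only [h]
  conv_lhs => rw [eq_sum_basisVec w, map_sum]
  simp only [map_smul]

theorem riemannCoord_eq_sum (hs : UniqueDiffOn ℝ s) (hz : z ∈ s)
    (hG : ContDiffWithinAt ℝ ∞ G s z) (hp : IsPosForm (G z)) (a v w : Eucl n) :
    riemannCoord G s z a v w = ∑ j, w j • riemannCoord G s z a v (basisVec j) := by
  have hc := fun v : Eucl n => (contDiffWithinAt_const (c := v) : ContDiffWithinAt ℝ ∞ _ s z)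
  have h1 := fun v w => (contDiffWithinAt_christoffel hs hz hG hp (hc v)
    (hc w)).differentiableWithinAt (by simp)
  have h2 : ∀ a v, fderivWithin ℝ (fun y => christoffel G s y v w) s z a
      = ∑ j, w j • fderivWithin ℝ (fun y => christoffel G s y v (basisVec j)) s z a := by
    intro a v
    have h3 : (fun y => christoffel G s y v w)
        = fun y => ∑ j, w j • christoffel G s y v (basisVec j) :=
      funext fun y => christoffel_eq_sum y v w
    have h4 : HasFDerivWithinAt (fun y => ∑ j, w j • christoffel G s y v (basisVec j))
        (∑ j, w j • fderivWithin ℝ (fun y => christoffel G s y v (basisVec j)) s z) s z :=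
      HasFDerivWithinAt.fun_sum fun j _ =>
        ((h1 v (basisVec j)).hasFDerivWithinAt.const_smul (w j) :)
    rw [h3, h4.fderivWithin (hs z hz)]
    simp
  have h5 : ∀ a v, christoffel G s z a (christoffel G s z v w)
      = ∑ j, w j • christoffel G s z a (christoffel G s z v (basisVec j)) := by
    intro a v
    have h : ∀ w, christoffel G s z a w = ((G z).inverse.comp ((1 / 2 : ℝ) •
        (fderivWithin ℝ G s z a + (fderivWithin ℝ G s z).flip a
          - ((fderivWithin ℝ G s z).flip a).flip))) w := fun w => rfl
    rw [christoffel_eq_sum z v w, h, map_sum]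
    simp only [map_smul, h]
  simp only [riemannCoord, h2, h5, smul_sub, smul_add, Finset.sum_sub_distrib,
    Finset.sum_add_distrib]

/-- Scalar curvature contracts Ricci with vectors that depend on the point. Linearity in the last
slot reduces it to components in the constant basis, whose regularity is known. -/
theorem ricciCoord_eq_sum (hs : UniqueDiffOn ℝ s) (hz : z ∈ s)
    (hG : ContDiffWithinAt ℝ ∞ G s z) (hp : IsPosForm (G z)) (v w : Eucl n) :
    ricciCoord G s z v w = ∑ j, w j * ricciCoord G s z v (basisVec j) := by
  simp only [ricciCoord, riemannCoord_eq_sum hs hz hG hp _ v w, Finset.mul_sum]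
  rw [Finset.sum_comm]
  refine Finset.sum_congr rfl fun i _ => ?_
  simp

/-- The Schouten tensor is continuous up to the boundary. -/
theorem continuousWithinAt_schoutenCoord (hs : UniqueDiffOn ℝ s) (hz : z ∈ s)
    (hG : ∀ᶠ y in 𝓝[s] z, ContDiffWithinAt ℝ ∞ G s y ∧ IsPosForm (G y)) (v w : Eucl n) :
    ContinuousWithinAt (fun y => schoutenCoord G s y v w) s z := by
  have hG0 := hG.self_of_nhdsWithin hz
  have hsc : ContinuousWithinAt (fun y => scalarCoord G s y) s z := by
    have h1 : (fun y => scalarCoord G s y) =ᶠ[𝓝[s] z] fun y => ∑ i, ∑ j,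
        ((G y).inverse (EuclideanSpace.proj i)) j * ricciCoord G s y (basisVec i) (basisVec j) := by
      filter_upwards [hG, self_mem_nhdsWithin] with y hy hys
      exact Finset.sum_congr rfl fun i _ => ricciCoord_eq_sum hs hys hy.1 hy.2 _ _
    refine ContinuousWithinAt.congr_of_eventuallyEq ?_ h1 (h1.self_of_nhdsWithin hz)
    refine tendsto_finsetSum _ fun i _ => tendsto_finsetSum _ fun j _ => ?_
    have h2 : ContinuousWithinAt (fun y => (G y).inverse (EuclideanSpace.proj i) j) s z :=
      ((EuclideanSpace.proj j : Eucl n →L[ℝ] ℝ).contDiff.comp_contDiffWithinAt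
        ((contDiffWithinAt_inverse hG0.1 hG0.2).clm_apply contDiffWithinAt_const)).continuousWithinAt
    exact h2.mul (contDiffWithinAt_ricciCoord hs hz hG0.1 hG0.2 _ _).continuousWithinAt
  have h3 : ContinuousWithinAt (fun y => G y v w) s z :=
    ((hG0.1.clm_apply contDiffWithinAt_const).clm_apply contDiffWithinAt_const).continuousWithinAt
  exact continuousWithinAt_const.mul
    ((contDiffWithinAt_ricciCoord hs hz hG0.1 hG0.2 v w).continuousWithinAt.sub
      ((hsc.div_const _).mul h3))

end UpToBoundary

end CoordinateExpressions

end

/-! ### Charts, coordinate frames and coordinate expressions of tensors. -/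

section

set_option maxSynthPendingDepth 3

section Charts

variable {n : ℕ} {H : Type*} [TopologicalSpace H] {I : ModelWithCorners ℝ (Eucl n) H}
  {M : Type*} [TopologicalSpace M] [ChartedSpace H M] [IsManifold I ∞ M]

/-- The interior of the domain of the chart at `x`, in coordinates. -/
def chartInterior (I : ModelWithCorners ℝ (Eucl n) H) (x : M) : Set (Eucl n) :=
  interior (extChartAt I x).target

theorem isOpen_chartInterior (x : M) : IsOpen (chartInterior I x) := isOpen_interior

theorem chartInterior_subset_target (x : M) : chartInterior I x ⊆ (extChartAt I x).target :=
  interior_subset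

theorem chartInterior_subset_range (x : M) : chartInterior I x ⊆ range I :=
  (chartInterior_subset_target x).trans (extChartAt_target_subset_range x)

theorem range_mem_nhds {x : M} {y : Eucl n} (hy : y ∈ chartInterior I x) : range I ∈ 𝓝 y :=
  mem_of_superset ((isOpen_chartInterior x).mem_nhds hy) (chartInterior_subset_range x)

theorem isInvertible_coordFrame {x : M} {y : Eucl n} (hy : y ∈ (extChartAt I x).target) :
    (coordFrame I x y).IsInvertible :=
  isInvertible_mfderivWithin_extChartAt_symm hy

/-- The coordinate frame as a linear map of the model space, to which all tangent spaces are equal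
by definition. -/
noncomputable def frame (I : ModelWithCorners ℝ (Eucl n) H) (x : M) (y : Eucl n) :
    Eucl n →L[ℝ] Eucl n := coordFrame I x y

/-- A covector field as a function with values in a fixed space. -/
def rawCov (D : CovField I M) (p : M) : Eucl n →L[ℝ] ℝ := D p

/-- A field of bilinear forms as a function with values in a fixed space. -/
def rawBilin (B : BilinField I M) (p : M) : Eucl n →L[ℝ] Eucl n →L[ℝ] ℝ := B p

theorem coordBilin_apply (B : BilinField I M) (x : M) (y v w : Eucl n) :
    coordBilin I B x y v w
      = rawBilin B ((extChartAt I x).symm y) (frame I x y v) (frame I x y w) := rfl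

theorem coordBilin_eq_bilinearComp (B : BilinField I M) (x : M) (y : Eucl n) :
    coordBilin I B x y
      = (rawBilin B ((extChartAt I x).symm y)).bilinearComp (frame I x y) (frame I x y) := rfl

theorem exists_frame_equiv {x : M} {y : Eucl n} (hy : y ∈ (extChartAt I x).target) :
    ∃ e : Eucl n ≃L[ℝ] Eucl n, (e : Eucl n →L[ℝ] Eucl n) = frame I x y :=
  isInvertible_coordFrame hy

theorem injective_frame {x : M} {y : Eucl n} (hy : y ∈ (extChartAt I x).target) :
    Function.Injective (frame I x y) := by
  obtain ⟨e, he⟩ := exists_frame_equiv hy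
  rw [← he]
  exact e.injective

/-- `schouten` is defined in the chart centred at the point itself; there the coordinate frame is
the identity, and this links the definition to other charts. -/
theorem frame_self (x : M) : frame I x (extChartAt I x x) = ContinuousLinearMap.id ℝ (Eucl n) := by
  have := mfderivWithin_range_extChartAt_symm (I := I) (x := x)
  unfold frame coordFrame
  rw [this]
  rfl

theorem isInteriorPoint_iff_mem_chartInterior {x p : M} (hp : p ∈ (extChartAt I x).source) :
    I.IsInteriorPoint p ↔ extChartAt I x p ∈ chartInterior I x :=
  I.isInteriorPoint_iff_of_mem_atlas (n := ∞) (by simp) (chart_mem_atlas H x)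
    (by simpa using hp)

/-- The change of coordinates from the chart at `x` to the chart at `x'`. -/
noncomputable def transition (I : ModelWithCorners ℝ (Eucl n) H) (x x' : M) (y : Eucl n) : Eucl n :=
  extChartAt I x' ((extChartAt I x).symm y)

/-- The interior points of the chart at `x` which lie in the chart at `x'`. -/
def overlap (I : ModelWithCorners ℝ (Eucl n) H) (x x' : M) : Set (Eucl n) :=
  chartInterior I x ∩ (extChartAt I x).symm ⁻¹' (extChartAt I x').source

theorem isOpen_overlap (x x' : M) : IsOpen (overlap I x x') :=
  ((continuousOn_extChartAt_symm x).mono (chartInterior_subset_target x)).isOpen_inter_preimage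
    (isOpen_chartInterior x) (isOpen_extChartAt_source x')

theorem contDiffOn_transition (x x' : M) : ContDiffOn ℝ ∞ (transition I x x') (overlap I x x') := by
  have h1 : ContMDiffOn 𝓘(ℝ, Eucl n) 𝓘(ℝ, Eucl n) ∞ (transition I x x') (overlap I x x') :=
    (contMDiffOn_extChartAt (x := x')).comp
      ((contMDiffOn_extChartAt_symm x).mono fun y hy => chartInterior_subset_target x hy.1)
      fun y hy => by simpa using hy.2
  exact h1.contDiffOn

theorem symm_transition {x x' : M} {y : Eucl n} (hy : y ∈ overlap I x x') :
    (extChartAt I x').symm (transition I x x' y) = (extChartAt I x).symm y :=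
  (extChartAt I x').left_inv hy.2

theorem transition_mem_target {x x' : M} {y : Eucl n} (hy : y ∈ overlap I x x') :
    transition I x x' y ∈ (extChartAt I x').target :=
  (extChartAt I x').map_source hy.2

/-- Being an interior point of the manifold does not depend on the chart. -/
theorem transition_mem_chartInterior {x x' : M} {y : Eucl n} (hy : y ∈ overlap I x x') :
    transition I x x' y ∈ chartInterior I x' := by
  have hs : (extChartAt I x).symm y ∈ (extChartAt I x).source :=
    (extChartAt I x).map_target (chartInterior_subset_target x hy.1)
  refine (isInteriorPoint_iff_mem_chartInterior hy.2).1
    ((isInteriorPoint_iff_mem_chartInterior hs).2 ?_)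
  rw [(extChartAt I x).right_inv (chartInterior_subset_target x hy.1)]
  exact hy.1

theorem transition_transition {x x' : M} {y : Eucl n} (hy : y ∈ overlap I x x') :
    transition I x' x (transition I x x' y) = y := by
  rw [transition, symm_transition hy]
  exact (extChartAt I x).right_inv (chartInterior_subset_target x hy.1)

theorem injOn_transition (x x' : M) : InjOn (transition I x x') (overlap I x x') :=
  fun y hy z hz h => by rw [← transition_transition hy, h, transition_transition hz]

theorem differentiableAt_transition {x x' : M} {y : Eucl n} (hy : y ∈ overlap I x x') :
    DifferentiableAt ℝ (transition I x x') y :=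
  ((contDiffOn_transition x x').contDiffAt ((isOpen_overlap x x').mem_nhds hy)).differentiableAt
    (by simp)

/-- The coordinate frames of two charts are related by the derivative of the change of
coordinates. -/
theorem frame_eq {x x' : M} {y : Eucl n} (hy : y ∈ overlap I x x') :
    frame I x y
      = (frame I x' (transition I x x' y)).comp (fderiv ℝ (transition I x x') y) := by
  have ht := transition_mem_chartInterior hy
  have h1 : (extChartAt I x).symm =ᶠ[𝓝 y] (extChartAt I x').symm ∘ transition I x x' := by
    filter_upwards [(isOpen_overlap x x').mem_nhds hy] with z hz using (symm_transition hz).symm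
  have h2 : MDifferentiableAt 𝓘(ℝ, Eucl n) I (extChartAt I x').symm (transition I x x' y) :=
    (mdifferentiableWithinAt_extChartAt_symm (chartInterior_subset_target x' ht)).mdifferentiableAt
      (range_mem_nhds ht)
  have h3 : coordFrame I x y = mfderiv 𝓘(ℝ, Eucl n) I (extChartAt I x).symm y :=
    mfderivWithin_of_mem_nhds (range_mem_nhds hy.1)
  have h4 : coordFrame I x' (transition I x x' y)
      = mfderiv 𝓘(ℝ, Eucl n) I (extChartAt I x').symm (transition I x x' y) :=
    mfderivWithin_of_mem_nhds (range_mem_nhds ht)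
  have h5 := mfderiv_comp y h2 (differentiableAt_transition hy).mdifferentiableAt
  rw [mfderiv_eq_fderiv] at h5
  have h6 : (mfderiv 𝓘(ℝ, Eucl n) I (extChartAt I x).symm y : Eucl n →L[ℝ] Eucl n)
      = mfderiv 𝓘(ℝ, Eucl n) I ((extChartAt I x').symm ∘ transition I x x') y :=
    h1.mfderiv_eq
  unfold frame
  rw [h3, h4]
  exact h6.trans h5

theorem coordBilin_eq (B : BilinField I M) {x x' : M} {y : Eucl n} (hy : y ∈ overlap I x x')
    (v w : Eucl n) : coordBilin I B x y v w
      = coordBilin I B x' (transition I x x' y) (fderiv ℝ (transition I x x') y v)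
        (fderiv ℝ (transition I x x') y w) := by
  rw [coordBilin_apply, coordBilin_apply, symm_transition hy, frame_eq hy]
  rfl

/-- The Schouten tensor of a field of bilinear forms which is a smooth metric in each chart,
computed in an arbitrary chart. -/
theorem schouten_eq {h : BilinField I M}
    (hh : ∀ x, IsMetricOn (coordBilin I h x) (chartInterior I x)) {x : M} {y : Eucl n}
    (hy : y ∈ chartInterior I x) (v w : Eucl n) :
    schouten I h ((extChartAt I x).symm y) (frame I x y v) (frame I x y w)
      = schoutenForm (coordBilin I h x) y v w := by
  set p := (extChartAt I x).symm y with hp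
  have ho : y ∈ overlap I x p := ⟨hy, mem_extChartAt_source p⟩
  -- The coordinate metric of the chart at `x` is the pullback of that of the chart at `p`, the
  -- chart in which `schouten` is evaluated at `p`.
  have hP : IsPullback (coordBilin I h p) (chartInterior I p) (transition I x p)
      (coordBilin I h x) (overlap I x p) :=
    { isMetricOn := hh p
      isMetricOn' := ⟨isOpen_overlap x p, (hh x).contDiffOn.mono inter_subset_left,
        fun z hz => (hh x).isPosForm z hz.1⟩
      contDiffOn := contDiffOn_transition x p
      mapsTo := fun z hz => transition_mem_chartInterior hz
      apply_eq := fun z hz v w => coordBilin_eq h hz v w }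
  have ht : transition I x p y = extChartAt I p p := rfl
  have hf : frame I x y = fderiv ℝ (transition I x p) y := by
    rw [frame_eq ho, ht, frame_self]
    rfl
  rw [hP.schoutenForm_eq ho, ← hf, ht]
  exact (hh p).schoutenCoord_eq (transition_mem_chartInterior ho) (chartInterior_subset_range p) _ _

/-- Symmetric functions of the eigenvalues, computed in an arbitrary chart. -/
theorem sigma_eq {h : BilinField I M} (k : ℕ) {x : M} {y : Eucl n}
    (hy : y ∈ (extChartAt I x).target) (A : Eucl n → Eucl n → ℝ) (B : Eucl n →ₗ[ℝ] Eucl n →ₗ[ℝ] ℝ)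
    (hAB : ∀ v w, A (frame I x y v) (frame I x y w) = B v w) :
    sigma I k h ((extChartAt I x).symm y) A
      = (eigenvaluesRel (fun v w => coordBilin I h x y v w) fun v w => B v w).esymm k := by
  obtain ⟨e, he⟩ := exists_frame_equiv hy
  have hf : ∀ v, frame I x y (e.symm v) = v := fun v => by rw [← he]; simp
  have h1 := eigenvaluesRel_comp (LinearMap.mk₂ ℝ (fun v w => coordBilin I h x y v w)
    (by simp) (by simp) (by simp) (by simp)) B e.symm.toLinearEquiv
  have h2 : (fun v w : Eucl n => B (e.symm v) (e.symm w)) = A := by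
    funext v w
    rw [← hAB, hf, hf]
  have h3 : (fun v w : Eucl n => coordBilin I h x y (e.symm v) (e.symm w))
      = fun v w => rawBilin h ((extChartAt I x).symm y) v w := by
    funext v w
    rw [coordBilin_apply, hf, hf]
  simp only [ContinuousLinearEquiv.coe_toLinearEquiv, LinearMap.mk₂_apply, h2, h3] at h1
  rw [← h1]
  rfl

end Charts

section Metric

variable {n : ℕ} {H : Type*} [TopologicalSpace H] {I : ModelWithCorners ℝ (Eucl n) H}
  {M : Type*} [TopologicalSpace M] [ChartedSpace H M] [IsManifold I ∞ M]
  (g : ContMDiffRiemannianMetric I ∞ (Eucl n) (TangentSpace I (M := M)))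

/-- The tangent map of the inverse chart applied to a constant field. Tangent maps are smooth within
the target, while `coordFrame` differentiates within the range; unique differentiability makes the
two agree. -/
theorem contMDiffOn_coordFrame (x : M) (v : Eucl n) :
    ContMDiffOn 𝓘(ℝ, Eucl n) (I.prod 𝓘(ℝ, Eucl n)) ∞
      (fun y => TotalSpace.mk' (Eucl n) (E := TangentSpace I (M := M))
        ((extChartAt I x).symm y) (coordFrame I x y v)) (extChartAt I x).target := by
  have h1 : ContMDiffOn 𝓘(ℝ, Eucl n).tangent I.tangent ∞
      (tangentMapWithin 𝓘(ℝ, Eucl n) I (extChartAt I x).symm (extChartAt I x).target)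
      (π (Eucl n) (TangentSpace 𝓘(ℝ, Eucl n)) ⁻¹' (extChartAt I x).target) :=
    (contMDiffOn_extChartAt_symm (n := ∞) x).contMDiffOn_tangentMapWithin (by simp)
      (uniqueDiffOn_extChartAt_target x).uniqueMDiffOn
  have h2 : ContMDiffOn 𝓘(ℝ, Eucl n) 𝓘(ℝ, Eucl n).tangent ∞
      (fun y : Eucl n => (⟨y, v⟩ : TangentBundle 𝓘(ℝ, Eucl n) (Eucl n))) (extChartAt I x).target :=
    contMDiffOn_vectorSpace_iff_contDiffOn.2 contDiffOn_const
  refine (h1.comp h2 fun y hy => hy).congr fun y hy => ?_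
  have h3 : mfderivWithin 𝓘(ℝ, Eucl n) I (extChartAt I x).symm (extChartAt I x).target y
      = coordFrame I x y :=
    (mdifferentiableWithinAt_extChartAt_symm hy).mfderivWithin_mono
      ((uniqueDiffOn_extChartAt_target x).uniqueMDiffOn y hy) (extChartAt_target_subset_range x)
  change _ = TotalSpace.mk' (Eucl n) (E := TangentSpace I (M := M)) ((extChartAt I x).symm y)
    (mfderivWithin 𝓘(ℝ, Eucl n) I (extChartAt I x).symm (extChartAt I x).target y v)
  rw [h3]
  rfl

/-- Each matrix entry is the smooth metric section evaluated on two smooth frame fields, up to and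
including boundary points. -/
theorem contDiffOn_coordBilin (x : M) :
    ContDiffOn ℝ ∞ (coordBilin I g.inner x) (extChartAt I x).target := by
  refine contDiffOn_clm_apply.2 fun v => contDiffOn_clm_apply.2 fun w => ?_
  have h1 : ContMDiffOn 𝓘(ℝ, Eucl n) (I.prod 𝓘(ℝ, Eucl n →L[ℝ] Eucl n →L[ℝ] ℝ)) ∞
      (fun y => TotalSpace.mk' (Eucl n →L[ℝ] Eucl n →L[ℝ] ℝ)
        (E := fun p : M => TangentSpace I p →L[ℝ] TangentSpace I p →L[ℝ] ℝ)
        ((extChartAt I x).symm y) (g.inner ((extChartAt I x).symm y))) (extChartAt I x).target :=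
    g.contMDiff.comp_contMDiffOn (contMDiffOn_extChartAt_symm x)
  have h2 := ContMDiffOn.clm_bundle_apply₂ (F₃ := ℝ) (E₃ := Bundle.Trivial M ℝ)
    h1 (contMDiffOn_coordFrame x v) (contMDiffOn_coordFrame x w)
  intro y hy
  have h3 := (contMDiffWithinAt_totalSpace.1 (h2 y hy)).2
  exact h3.contDiffWithinAt

theorem isPosForm_rawBilin (p : M) : IsPosForm (rawBilin g.inner p) :=
  ⟨fun v w => g.symm p v w, fun v hv => g.pos p v hv⟩

theorem isPosForm_coordBilin {x : M} {y : Eucl n} (hy : y ∈ (extChartAt I x).target) :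
    IsPosForm (coordBilin I g.inner x y) := by
  rw [coordBilin_eq_bilinearComp]
  exact (isPosForm_rawBilin g _).comp _ (injective_frame hy)

theorem isMetricOn_coordBilin (x : M) :
    IsMetricOn (coordBilin I g.inner x) (chartInterior I x) :=
  ⟨isOpen_chartInterior x, (contDiffOn_coordBilin g x).mono (chartInterior_subset_target x),
    fun _ hz => isPosForm_coordBilin g (chartInterior_subset_target x hz)⟩

theorem contDiffWithinAt_coordBilin {x : M} {y : Eucl n} (hy : y ∈ (extChartAt I x).target) :
    ContDiffWithinAt ℝ ∞ (coordBilin I g.inner x) (range I) y :=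
  (contDiffOn_coordBilin g x y hy).mono_of_mem_nhdsWithin (extChartAt_target_mem_nhdsWithin_of_mem hy)

theorem coordBilin_conformalMetric (u : M → ℝ) (x : M) :
    coordBilin I (conformalMetric I g u) x = fun y =>
      (u ((extChartAt I x).symm y) ^ (4 / ((n : ℝ) - 2))) • coordBilin I g.inner x y := rfl

theorem contDiffOn_comp_symm {m : WithTop ℕ∞} [IsManifold I m M] {u : M → ℝ}
    (hu : ContMDiff I 𝓘(ℝ, ℝ) m u) (x : M) :
    ContDiffOn ℝ m (fun y => u ((extChartAt I x).symm y)) (extChartAt I x).target :=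
  (hu.comp_contMDiffOn (contMDiffOn_extChartAt_symm x)).contDiffOn

theorem isMetricOn_conformalMetric {u : M → ℝ} (hu : ContMDiff I 𝓘(ℝ, ℝ) ∞ u)
    (hpos : ∀ p, 0 < u p) (x : M) :
    IsMetricOn (coordBilin I (conformalMetric I g u) x) (chartInterior I x) := by
  rw [coordBilin_conformalMetric]
  have h := isMetricOn_coordBilin g x
  exact ⟨h.isOpen, ((((contDiffOn_comp_symm hu x).mono (chartInterior_subset_target x)).rpow_const_of_ne
    fun y _ => (hpos _).ne').smul h.contDiffOn :), fun z hz =>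
      (h.isPosForm z hz).smul (Real.rpow_pos_of_pos (hpos _) _)⟩

end Metric

end

/-! ### Local expansion of `σ_k` into null Lagrangians. -/

section

set_option maxSynthPendingDepth 3

section Expansion

variable {n : ℕ}

/-- The Schouten tensor of a conformal metric in terms of the value `t`, the differential `d` and
the covariant Hessian `h` of the conformal factor. -/
noncomputable def conformalSchouten (G : Eucl n →L[ℝ] Eucl n →L[ℝ] ℝ)
    (A : Eucl n →ₗ[ℝ] Eucl n →ₗ[ℝ] ℝ) (t : ℝ) (d : Eucl n →L[ℝ] ℝ)
    (h : Eucl n →L[ℝ] Eucl n →L[ℝ] ℝ) : Eucl n →ₗ[ℝ] Eucl n →ₗ[ℝ] ℝ :=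
  LinearMap.mk₂ ℝ (fun v w => -(2 / ((n : ℝ) - 2)) * t⁻¹ * h v w
    + 2 * (n : ℝ) / ((n : ℝ) - 2) ^ 2 * (t⁻¹) ^ 2 * (d v * d w)
    - 2 / ((n : ℝ) - 2) ^ 2 * (t⁻¹) ^ 2 * d (G.inverse d) * G v w + A v w)
    (fun _ _ _ => by simp; ring) (fun _ _ _ => by simp; ring)
    (fun _ _ _ => by simp; ring) (fun _ _ _ => by simp; ring)

theorem conformalSchouten_apply (G : Eucl n →L[ℝ] Eucl n →L[ℝ] ℝ)
    (A : Eucl n →ₗ[ℝ] Eucl n →ₗ[ℝ] ℝ) (t : ℝ) (d : Eucl n →L[ℝ] ℝ)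
    (h : Eucl n →L[ℝ] Eucl n →L[ℝ] ℝ) (v w : Eucl n) :
    conformalSchouten G A t d h v w = -(2 / ((n : ℝ) - 2)) * t⁻¹ * h v w
    + 2 * (n : ℝ) / ((n : ℝ) - 2) ^ 2 * (t⁻¹) ^ 2 * (d v * d w)
    - 2 / ((n : ℝ) - 2) ^ 2 * (t⁻¹) ^ 2 * d (G.inverse d) * G v w + A v w := rfl

theorem IsPosForm.inverse_bilinearComp {B : Eucl n →L[ℝ] Eucl n →L[ℝ] ℝ} (hB : IsPosForm B)
    (e : Eucl n ≃L[ℝ] Eucl n) (ℓ : Eucl n →L[ℝ] ℝ) :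
    (B.bilinearComp (e : Eucl n →L[ℝ] Eucl n) (e : Eucl n →L[ℝ] Eucl n)).inverse
      (ℓ.comp (e : Eucl n →L[ℝ] Eucl n)) = e.symm (B.inverse ℓ) := by
  have hB' := hB.comp (e : Eucl n →L[ℝ] Eucl n) e.injective
  refine hB'.ext_right fun x => ?_
  rw [hB'.apply_inverse]
  simp [hB.apply_inverse]

variable {H : Type*} [TopologicalSpace H] {I : ModelWithCorners ℝ (Eucl n) H}
  {M : Type*} [TopologicalSpace M] [ChartedSpace H M] [IsManifold I ∞ M]
  (g : ContMDiffRiemannianMetric I ∞ (Eucl n) (TangentSpace I (M := M)))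

/-- The squared norm of a covector field, computed in coordinates. -/
theorem covInner_eq (D D' : CovField I M) {x : M} {y : Eucl n}
    (hy : y ∈ (extChartAt I x).target) :
    covInner I g ((extChartAt I x).symm y) (D ((extChartAt I x).symm y))
        (D' ((extChartAt I x).symm y))
      = coordCov I D x y ((coordBilin I g.inner x y).inverse (coordCov I D' x y)) := by
  obtain ⟨e, he⟩ := exists_frame_equiv hy
  have h1 : coordCov I D' x y = (rawCov D' ((extChartAt I x).symm y)).comp
    (e : Eucl n →L[ℝ] Eucl n) := by rw [he]; rfl
  have h2 : coordCov I D x y = (rawCov D ((extChartAt I x).symm y)).comp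
    (e : Eucl n →L[ℝ] Eucl n) := by rw [he]; rfl
  rw [coordBilin_eq_bilinearComp, ← he, h1, h2, (isPosForm_rawBilin g _).inverse_bilinearComp]
  simp only [ContinuousLinearMap.comp_apply, ContinuousLinearEquiv.coe_coe,
    ContinuousLinearEquiv.apply_symm_apply]
  rfl

/-- The conformal law replaces the curvature of `g_u` by the expression `conformalSchouten`, the
same one to which the weak version reduces, so both can be expanded alike. -/
theorem sigmaSchouten_eq (hn : 3 ≤ n) (k : ℕ) {u : M → ℝ} (hu : ContMDiff I 𝓘(ℝ, ℝ) ∞ u)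
    (hpos : ∀ p, 0 < u p) {x : M} {y : Eucl n} (hy : y ∈ chartInterior I x) :
    sigmaSchouten I g k u ((extChartAt I x).symm y)
      = (eigenvaluesRel (fun v w => coordBilin I (conformalMetric I g u) x y v w) fun v w =>
          conformalSchouten (coordBilin I g.inner x y) (schoutenForm (coordBilin I g.inner x) y)
            (u ((extChartAt I x).symm y))
            (fderiv ℝ (fun z => u ((extChartAt I x).symm z)) y)
            (covHess (coordBilin I g.inner x) (fun z => u ((extChartAt I x).symm z)) y)
            v w).esymm k := by
  have hyt := chartInterior_subset_target x hy
  refine sigma_eq k hyt _ _ fun v w => ?_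
  rw [schouten_eq (isMetricOn_conformalMetric g hu hpos) hy]
  have h := (isMetricOn_coordBilin g x).schoutenForm_rpow_smul (by simpa using hn)
    ((contDiffOn_comp_symm hu x).mono (chartInterior_subset_target x)) (fun z _ => hpos _) hy v w
  rw [finrank_euclideanSpace_fin] at h
  rw [coordBilin_conformalMetric, h, conformalSchouten_apply]
  rfl

theorem sigmaWeakSchouten_eq (k : ℕ) (u : M → ℝ) (du : CovField I M) (Hu : BilinField I M)
    {x : M} {y : Eucl n} (hy : y ∈ chartInterior I x) :
    sigmaWeakSchouten I g k u du Hu ((extChartAt I x).symm y)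
      = (eigenvaluesRel (fun v w => coordBilin I (conformalMetric I g u) x y v w) fun v w =>
          conformalSchouten (coordBilin I g.inner x y) (schoutenForm (coordBilin I g.inner x) y)
            (u ((extChartAt I x).symm y)) (coordCov I du x y) (coordBilin I Hu x y)
            v w).esymm k := by
  have hyt := chartInterior_subset_target x hy
  refine sigma_eq k hyt _ _ fun v w => ?_
  rw [conformalSchouten_apply, ← covInner_eq g du du hyt, ← schouten_eq (isMetricOn_coordBilin g) hy]
  rfl

/-- The coefficient of the second derivatives in the Schouten tensor of a conformal metric. -/
noncomputable def leadCoef (n : ℕ) (t : ℝ) : ℝ := -(2 / ((n : ℝ) - 2)) * t⁻¹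

/-- The lower order terms in the Schouten tensor of a conformal metric. -/
noncomputable def lowerTerm (x : M) (y : Eucl n) (t : ℝ) (d : Eucl n →L[ℝ] ℝ) (i j : Fin n) : ℝ :=
  2 / ((n : ℝ) - 2) * t⁻¹
      * d (christoffel (coordBilin I g.inner x) (range I) y (basisVec i) (basisVec j))
    + 2 * (n : ℝ) / ((n : ℝ) - 2) ^ 2 * (t⁻¹) ^ 2 * (d (basisVec i) * d (basisVec j))
    - 2 / ((n : ℝ) - 2) ^ 2 * (t⁻¹) ^ 2 * d ((coordBilin I g.inner x y).inverse d)
      * coordBilin I g.inner x y (basisVec i) (basisVec j)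
    + schoutenCoord (coordBilin I g.inner x) (range I) y (basisVec i) (basisVec j)

/-- The matrix of the metric `t ^ (4 / (n - 2)) g`. -/
noncomputable def conformalGram (x : M) (y : Eucl n) (t : ℝ) : Matrix (Fin n) (Fin n) ℝ :=
  gramMatrix fun v w => t ^ (4 / ((n : ℝ) - 2)) * coordBilin I g.inner x y v w

/-- The coefficients of the null Lagrangians in the expansion of `σ_k`. -/
noncomputable def sigmaCoef (x : M) (S : Finset (Fin n)) (r : Fin n → Fin n ⊕ Fin n)
    (q : Eucl n × ℝ × (Eucl n →L[ℝ] ℝ)) : ℝ :=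
  ∏ i, rowCoef S (conformalGram g x q.1 q.2.1)⁻¹ (lowerTerm g x q.1 q.2.1 q.2.2)
    (leadCoef n q.2.1) i (r i)

/-- The covariant Hessian is the coordinate Hessian minus a Christoffel term linear in `d`. That
term is moved to `lowerTerm`, leaving a scalar multiple of `D` as the only second-order part.
Symmetry of `h` makes the relative eigenvalues real. -/
theorem esymm_conformalSchouten {k : ℕ} (hk : k ≤ n) {u : M → ℝ} (hpos : ∀ p, 0 < u p) {x : M}
    {y : Eucl n} (hy : y ∈ chartInterior I x) (d : Eucl n →L[ℝ] ℝ)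
    (h : Eucl n →L[ℝ] Eucl n →L[ℝ] ℝ) (hs : ∀ v w, h v w = h w v) {D : Fin n → Fin n → ℝ}
    (hD : ∀ i j, h (basisVec i) (basisVec j) = D i j
      - d (christoffel (coordBilin I g.inner x) (range I) y (basisVec i) (basisVec j))) :
    (eigenvaluesRel (fun v w => coordBilin I (conformalMetric I g u) x y v w) fun v w =>
      conformalSchouten (coordBilin I g.inner x y) (schoutenForm (coordBilin I g.inner x) y)
        (u ((extChartAt I x).symm y)) d h v w).esymm k
      = ∑ S ∈ Finset.univ.powersetCard k, ∑ r ∈ Finset.univ.filter (fun r => rowDeg r ≤ k),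
          sigmaCoef g x S r (y, u ((extChartAt I x).symm y), d) * nullLagr r D := by
  have hG := isMetricOn_coordBilin g x
  have hp := hG.isPosForm y hy
  refine (esymm_eigenvaluesRel (F := lowerTerm g x y (u ((extChartAt I x).symm y)) d)
    (a := leadCoef n (u ((extChartAt I x).symm y))) ?_ ?_ hk fun i j => ?_ :)
  · rw [coordBilin_conformalMetric]
    exact (hp.smul (Real.rpow_pos_of_pos (hpos _) _)).posDef_gramMatrix
  · ext i j
    simp only [gramMatrix, Matrix.conjTranspose_apply, Matrix.of_apply, conformalSchouten_apply,
      star_trivial]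
    rw [hs (basisVec j), hp.symm (basisVec j), hG.schoutenForm_symm hy (basisVec j)]
    ring
  · rw [conformalSchouten_apply, lowerTerm, leadCoef, hD,
      hG.schoutenCoord_eq hy (chartInterior_subset_range x)]
    ring

theorem sigmaSchouten_eq_sum (hn : 3 ≤ n) {k : ℕ} (hk : k ≤ n) {u : M → ℝ}
    (hu : ContMDiff I 𝓘(ℝ, ℝ) ∞ u) (hpos : ∀ p, 0 < u p) {x : M} {y : Eucl n}
    (hy : y ∈ chartInterior I x) :
    sigmaSchouten I g k u ((extChartAt I x).symm y)
      = ∑ S ∈ Finset.univ.powersetCard k, ∑ r ∈ Finset.univ.filter (fun r => rowDeg r ≤ k),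
          sigmaCoef g x S r (y, u ((extChartAt I x).symm y),
            fderiv ℝ (fun z => u ((extChartAt I x).symm z)) y)
            * nullLagr r (hess (fun z => u ((extChartAt I x).symm z)) y) := by
  have hG := isMetricOn_coordBilin g x
  have hf : ContDiffOn ℝ ∞ (fun z => u ((extChartAt I x).symm z)) (chartInterior I x) :=
    (contDiffOn_comp_symm hu x).mono (chartInterior_subset_target x)
  rw [sigmaSchouten_eq g hn k hu hpos hy]
  refine esymm_conformalSchouten g hk hpos hy _ _ (hG.covHess_symm hf hy) fun i j => ?_
  rw [covHess_apply, christoffel_eq_chris (range_mem_nhds hy), hG.fderiv_fderiv_fun_symm hf hy]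
  congr 1
  exact (congrArg (fun L : Eucl n →L[ℝ] ℝ => L (basisVec j))
    (hG.hasFDerivAt_fderiv_fun_apply hf hy (basisVec i)).fderiv).symm

/-- The second derivatives, in the chart at `x`, of a function with gradient `du` and covariant
Hessian `Hu`. -/
noncomputable def coordHess (du : CovField I M) (Hu : BilinField I M) (x : M) (y : Eucl n)
    (a b : Fin n) : ℝ :=
  coordBilin I Hu x y (basisVec b) (basisVec a)
    + coordCov I du x y (christoffel (coordBilin I g.inner x) (range I) y (basisVec b) (basisVec a))

/-- Symmetry is a hypothesis at the single point `y`, since weak Hessians are symmetric only almost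
everywhere; it passes to `Hu` because the Christoffel symbols are symmetric. -/
theorem sigmaWeakSchouten_eq_sum {k : ℕ} (hk : k ≤ n) {u : M → ℝ} (hpos : ∀ p, 0 < u p)
    (du : CovField I M) (Hu : BilinField I M) {x : M} {y : Eucl n} (hy : y ∈ chartInterior I x)
    (hs : ∀ a b, coordHess g du Hu x y a b = coordHess g du Hu x y b a) :
    sigmaWeakSchouten I g k u du Hu ((extChartAt I x).symm y)
      = ∑ S ∈ Finset.univ.powersetCard k, ∑ r ∈ Finset.univ.filter (fun r => rowDeg r ≤ k),
          sigmaCoef g x S r (y, u ((extChartAt I x).symm y), coordCov I du x y)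
            * nullLagr r (coordHess g du Hu x y) := by
  have hΓ : ∀ i j : Fin n, christoffel (coordBilin I g.inner x) (range I) y (basisVec i) (basisVec j)
      = christoffel (coordBilin I g.inner x) (range I) y (basisVec j) (basisVec i) := by
    intro i j
    rw [christoffel_eq_chris (range_mem_nhds hy), christoffel_eq_chris (range_mem_nhds hy),
      (isMetricOn_coordBilin g x).chris_symm hy]
  have hb : ∀ i j, coordBilin I Hu x y (basisVec i) (basisVec j)
      = coordBilin I Hu x y (basisVec j) (basisVec i) := by
    intro i j
    have := hs i j
    rw [coordHess, coordHess, hΓ] at this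
    linarith
  rw [sigmaWeakSchouten_eq g k u du Hu hy]
  refine esymm_conformalSchouten g hk hpos hy _ _ (fun v w => ?_) fun i j => ?_
  · rw [eq_sum_basisVec v, eq_sum_basisVec w]
    simp only [map_sum, map_smul, sum_apply, smul_apply, smul_eq_mul, Finset.mul_sum]
    rw [Finset.sum_comm]
    refine Finset.sum_congr rfl fun i _ => Finset.sum_congr rfl fun j _ => ?_
    rw [hb]
    ring
  · rw [hs, coordHess]
    ring

theorem continuousOn_coordBilin (x : M) :
    ContinuousOn (coordBilin I g.inner x) (extChartAt I x).target :=
  (contDiffOn_coordBilin g x).continuousOn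

theorem continuousOn_schoutenCoord (x : M) (v w : Eucl n) :
    ContinuousOn (fun y => schoutenCoord (coordBilin I g.inner x) (range I) y v w)
      (extChartAt I x).target := fun y hy =>
  (continuousWithinAt_schoutenCoord I.uniqueDiffOn (extChartAt_target_subset_range x hy)
    (by filter_upwards [extChartAt_target_mem_nhdsWithin_of_mem hy] with z hz using
      ⟨contDiffWithinAt_coordBilin g hz, isPosForm_coordBilin g hz⟩) v w).mono
    (extChartAt_target_subset_range x)

theorem continuousOn_christoffel (x : M) (v w : Eucl n) :
    ContinuousOn (fun y => christoffel (coordBilin I g.inner x) (range I) y v w)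
      (extChartAt I x).target := fun _ hy =>
  (contDiffWithinAt_christoffel I.uniqueDiffOn (extChartAt_target_subset_range x hy)
    (contDiffWithinAt_coordBilin g hy) (isPosForm_coordBilin g hy) contDiffWithinAt_const
    contDiffWithinAt_const).continuousWithinAt.mono (extChartAt_target_subset_range x)

theorem continuousOn_inverse_coordBilin (x : M) :
    ContinuousOn (fun y => (coordBilin I g.inner x y).inverse) (extChartAt I x).target :=
  fun _ hy => (contDiffWithinAt_inverse (contDiffOn_coordBilin g x _ hy)
    (isPosForm_coordBilin g hy)).continuousWithinAt

/-- The coefficients are continuous up to the boundary. -/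
theorem continuousOn_sigmaCoef (x : M) (S : Finset (Fin n)) (r : Fin n → Fin n ⊕ Fin n) :
    ContinuousOn (sigmaCoef g x S r) ((extChartAt I x).target ×ˢ Ioi 0 ×ˢ univ) := by
  set T : Set (Eucl n × ℝ × (Eucl n →L[ℝ] ℝ)) := (extChartAt I x).target ×ˢ Ioi 0 ×ˢ univ with hT
  have hm : MapsTo Prod.fst T (extChartAt I x).target := fun q hq => hq.1
  have hpos : ∀ q ∈ T, 0 < q.2.1 := fun q hq => hq.2.1
  have ht : ContinuousOn (fun q : Eucl n × ℝ × (Eucl n →L[ℝ] ℝ) => q.2.1) T := by fun_prop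
  have hti : ContinuousOn (fun q : Eucl n × ℝ × (Eucl n →L[ℝ] ℝ) => q.2.1⁻¹) T :=
    ht.inv₀ fun q hq => (hpos q hq).ne'
  have hd : ContinuousOn (fun q : Eucl n × ℝ × (Eucl n →L[ℝ] ℝ) => q.2.2) T := by fun_prop
  have hG : ContinuousOn (fun q : Eucl n × ℝ × (Eucl n →L[ℝ] ℝ) =>
      coordBilin I g.inner x q.1) T := (continuousOn_coordBilin g x).comp continuousOn_fst hm
  have hGv : ∀ v w, ContinuousOn (fun q : Eucl n × ℝ × (Eucl n →L[ℝ] ℝ) =>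
      coordBilin I g.inner x q.1 v w) T := fun v w =>
    (hG.clm_apply continuousOn_const).clm_apply continuousOn_const
  have hdv : ∀ v : Eucl n, ContinuousOn (fun q : Eucl n × ℝ × (Eucl n →L[ℝ] ℝ) => q.2.2 v) T :=
    fun v => hd.clm_apply continuousOn_const
  have hlow : ∀ i j, ContinuousOn (fun q : Eucl n × ℝ × (Eucl n →L[ℝ] ℝ) =>
      lowerTerm g x q.1 q.2.1 q.2.2 i j) T := by
    intro i j
    have h1 : ContinuousOn (fun q : Eucl n × ℝ × (Eucl n →L[ℝ] ℝ) =>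
        q.2.2 (christoffel (coordBilin I g.inner x) (range I) q.1 (basisVec i) (basisVec j))) T :=
      hd.clm_apply ((continuousOn_christoffel g x _ _).comp continuousOn_fst hm)
    have h2 : ContinuousOn (fun q : Eucl n × ℝ × (Eucl n →L[ℝ] ℝ) =>
        q.2.2 ((coordBilin I g.inner x q.1).inverse q.2.2)) T :=
      hd.clm_apply (((continuousOn_inverse_coordBilin g x).comp continuousOn_fst hm).clm_apply hd)
    have h3 : ContinuousOn (fun q : Eucl n × ℝ × (Eucl n →L[ℝ] ℝ) =>
        schoutenCoord (coordBilin I g.inner x) (range I) q.1 (basisVec i) (basisVec j)) T :=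
      (continuousOn_schoutenCoord g x _ _).comp continuousOn_fst hm
    exact ((((continuousOn_const.mul hti).mul h1).add ((continuousOn_const.mul (hti.pow 2)).mul
      ((hdv _).mul (hdv _)))).sub (((continuousOn_const.mul (hti.pow 2)).mul h2).mul
        (hGv _ _))).add h3
  have hlead : ContinuousOn (fun q : Eucl n × ℝ × (Eucl n →L[ℝ] ℝ) => leadCoef n q.2.1) T :=
    continuousOn_const.mul hti
  have hgram : ContinuousOn (fun q : Eucl n × ℝ × (Eucl n →L[ℝ] ℝ) =>
      conformalGram g x q.1 q.2.1) T := by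
    refine continuousOn_pi.2 fun i => continuousOn_pi.2 fun j => ?_
    exact (ht.rpow_const fun q hq => Or.inl (hpos q hq).ne').mul (hGv _ _)
  -- By Cramer's formula the inverse is the adjugate divided by the determinant, which is nonzero
  -- because the conformal Gram matrix is positive definite.
  have hinv : ∀ i j, ContinuousOn (fun q : Eucl n × ℝ × (Eucl n →L[ℝ] ℝ) =>
      (conformalGram g x q.1 q.2.1)⁻¹ i j) T := by
    intro i j q hq
    have h1 : IsUnit (conformalGram g x q.1 q.2.1).det := by
      refine ((IsPosForm.posDef_gramMatrix ((isPosForm_coordBilin g hq.1).smul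
        (Real.rpow_pos_of_pos (hpos q hq) (4 / ((n : ℝ) - 2))))).isUnit.map Matrix.detMonoidHom)
    have h2 : ContinuousWithinAt (fun q : Eucl n × ℝ × (Eucl n →L[ℝ] ℝ) =>
        ((conformalGram g x q.1 q.2.1).det)⁻¹ * (conformalGram g x q.1 q.2.1).adjugate i j) T q :=
      ((continuous_id.matrix_det.comp_continuousOn hgram q hq).inv₀ h1.ne_zero).mul
        (continuousOn_pi.1 (continuousOn_pi.1 (continuous_id.matrix_adjugate.comp_continuousOn hgram) i)
          j q hq)
    refine h2.congr (fun q _ => ?_) ?_ <;>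
    rw [Matrix.inv_def, Ring.inverse_eq_inv', Matrix.smul_apply, smul_eq_mul]
  refine continuousOn_finsetProd _ fun i _ => ?_
  rcases r i with l | b
  · by_cases hi : i ∈ S
    · simp only [rowCoef, hi, if_true]
      exact (hinv i l).mul hlead
    · simp only [rowCoef, hi, if_false]
      exact continuousOn_const
  · by_cases hi : i ∈ S
    · simp only [rowCoef, hi, if_true]
      exact continuousOn_finsetSum _ fun l _ => (hinv i l).mul (hlow l b)
    · simp only [rowCoef, hi, if_false]
      exact continuousOn_const

end Expansion

end

/-! ### The Riemannian volume in charts. -/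

section

set_option maxSynthPendingDepth 3

section Volume

variable {n : ℕ} {H : Type*} [TopologicalSpace H] {I : ModelWithCorners ℝ (Eucl n) H}
  {M : Type*} [TopologicalSpace M] [ChartedSpace H M] [IsManifold I ∞ M]
  (g : ContMDiffRiemannianMetric I ∞ (Eucl n) (TangentSpace I (M := M)))

theorem measurableSet_target (x : M) : MeasurableSet (extChartAt I x).target := by
  rw [extChartAt_target]
  exact ((chartAt H x).open_target.preimage I.continuous_symm).measurableSet.inter
    I.isClosed_range.measurableSet

/-- Boundary points of the target lie on the frontier of the range of the model, and the frontier of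
a convex set is a null set. -/
theorem restrict_target (x : M) : (volume : Measure (Eucl n)).restrict (extChartAt I x).target
    = volume.restrict (chartInterior I x) := by
  refine Measure.restrict_congr_set (ae_eq_set.2 ⟨measure_mono_null ?_
    (I.convex_range.addHaar_frontier volume), ?_⟩)
  · rintro y ⟨hy, hy'⟩
    rw [I.isClosed_range.frontier_eq]
    refine ⟨extChartAt_target_subset_range x hy, fun h => hy' ?_⟩
    have h1 := extChartAt_target_mem_nhdsWithin_of_mem hy
    rw [nhdsWithin_eq_nhds.2 (mem_interior_iff_mem_nhds.1 h)] at h1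
    exact mem_interior_iff_mem_nhds.2 h1
  · rw [sdiff_eq_empty.2 (chartInterior_subset_target x), measure_empty]

/-- The density `√(det g_{ij})` of the Riemannian volume. -/
noncomputable def volDensity (x : M) (y : Eucl n) : ℝ :=
  Real.sqrt (gramMatrix fun v w => coordBilin I g.inner x y v w).det

theorem volDensity_pos {x : M} {y : Eucl n} (hy : y ∈ (extChartAt I x).target) :
    0 < volDensity g x y :=
  Real.sqrt_pos.2 (isPosForm_coordBilin g hy).posDef_gramMatrix.det_pos

theorem continuousOn_volDensity (x : M) :
    ContinuousOn (volDensity g x) (extChartAt I x).target := by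
  refine Real.continuous_sqrt.comp_continuousOn (continuous_id.matrix_det.comp_continuousOn ?_)
  exact continuousOn_pi.2 fun i => continuousOn_pi.2 fun j =>
    ((continuousOn_coordBilin g x).clm_apply continuousOn_const).clm_apply continuousOn_const

/-- The Riemannian volume in coordinates. -/
noncomputable def coordVolume (x : M) : Measure (Eucl n) :=
  (volume.restrict (chartInterior I x)).withDensity fun y => ENNReal.ofReal (volDensity g x y)

theorem coordVolume_absolutelyContinuous (x : M) :
    coordVolume g x ≪ volume.restrict (chartInterior I x) :=
  withDensity_absolutelyContinuous _ _

theorem aemeasurable_volDensity (x : M) : AEMeasurable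
    (fun y => ENNReal.ofReal (volDensity g x y)) (volume.restrict (chartInterior I x)) :=
  (((continuousOn_volDensity g x).mono (chartInterior_subset_target x)).aemeasurable
    (isOpen_chartInterior x).measurableSet).ennreal_ofReal

theorem absolutelyContinuous_coordVolume (x : M) :
    volume.restrict (chartInterior I x) ≪ coordVolume g x := by
  refine withDensity_absolutelyContinuous' (aemeasurable_volDensity g x) ?_
  filter_upwards [ae_restrict_mem (isOpen_chartInterior x).measurableSet] with y hy
  simpa using volDensity_pos g (chartInterior_subset_target x hy)

theorem ae_coordVolume_iff (x : M) {p : Eucl n → Prop} :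
    (∀ᵐ y ∂coordVolume g x, p y) ↔ ∀ᵐ y ∂volume.restrict (chartInterior I x), p y :=
  ⟨fun h => absolutelyContinuous_coordVolume g x h, fun h => coordVolume_absolutelyContinuous g x h⟩

theorem ae_mem_chartInterior (x : M) : ∀ᵐ y ∂coordVolume g x, y ∈ chartInterior I x :=
  (ae_coordVolume_iff g x).2 (ae_restrict_mem (isOpen_chartInterior x).measurableSet)

variable [MeasurableSpace M] [BorelSpace M]

theorem chartVolume_eq_map (x : M) :
    chartVolume I g x = (coordVolume g x).map (extChartAt I x).symm := by
  rw [coordVolume, ← restrict_target]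
  rfl

theorem continuousOn_symm_chartInterior (x : M) :
    ContinuousOn (extChartAt I x).symm (chartInterior I x) :=
  (continuousOn_extChartAt_symm x).mono (chartInterior_subset_target x)

theorem aemeasurable_symm (x : M) : AEMeasurable (extChartAt I x).symm (coordVolume g x) :=
  ((continuousOn_symm_chartInterior x).aemeasurable
    (isOpen_chartInterior x).measurableSet).mono_ac (coordVolume_absolutelyContinuous g x)

theorem measurableSet_inter_symm (x : M) {A : Set M} (hA : MeasurableSet A) :
    MeasurableSet (chartInterior I x ∩ (extChartAt I x).symm ⁻¹' A) := by
  have h := MeasurableSet.subtype_image (isOpen_chartInterior (I := I) x).measurableSet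
    ((continuousOn_iff_continuous_domRestrict.1
      (continuousOn_symm_chartInterior (I := I) x)).measurable hA)
  convert h using 1
  ext y
  simp [and_comm]

theorem chartVolume_apply (x : M) {A : Set M} (hA : MeasurableSet A) :
    chartVolume I g x A = ∫⁻ y in chartInterior I x ∩ (extChartAt I x).symm ⁻¹' A,
      ENNReal.ofReal (volDensity g x y) := by
  rw [chartVolume_eq_map, Measure.map_apply_of_aemeasurable (aemeasurable_symm g x) hA]
  have h1 : coordVolume g x ((extChartAt I x).symm ⁻¹' A)
      = coordVolume g x (chartInterior I x ∩ (extChartAt I x).symm ⁻¹' A) := by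
    refine measure_congr ?_
    filter_upwards [ae_mem_chartInterior g x] with y hy
    exact propext ⟨fun h => ⟨hy, h⟩, fun h => h.2⟩
  rw [h1, coordVolume, withDensity_apply _ (measurableSet_inter_symm x hA),
    Measure.restrict_restrict (measurableSet_inter_symm x hA)]
  congr 2
  exact inter_eq_left.2 inter_subset_left

theorem chartVolume_compl_source (x : M) : chartVolume I g x (extChartAt I x).sourceᶜ = 0 := by
  rw [chartVolume_apply g x (isOpen_extChartAt_source x).measurableSet.compl]
  have : chartInterior I x ∩ (extChartAt I x).symm ⁻¹' (extChartAt I x).sourceᶜ = ∅ := by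
    refine eq_empty_of_forall_notMem fun y hy => hy.2 ?_
    exact (extChartAt I x).map_target (chartInterior_subset_target x hy.1)
  rw [this]
  simp

/-- The two Gram matrices are congruent by the Jacobian of the transition map, so their determinants
differ by its squared determinant. -/
theorem volDensity_transition {x x' : M} {y : Eucl n} (hy : y ∈ overlap I x x') :
    volDensity g x y = |(fderiv ℝ (transition I x x') y).det|
      * volDensity g x' (transition I x x' y) := by
  have hdet : (Matrix.of fun i j => (fderiv ℝ (transition I x x') y : Eucl n →ₗ[ℝ] Eucl n)
      (basisVec j) i).det = (fderiv ℝ (transition I x x') y).det := by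
    have h1 : (Matrix.of fun i j => (fderiv ℝ (transition I x x') y : Eucl n →ₗ[ℝ] Eucl n)
        (basisVec j) i) = LinearMap.toMatrix (EuclideanSpace.basisFun (Fin n) ℝ).toBasis
        (EuclideanSpace.basisFun (Fin n) ℝ).toBasis
        (fderiv ℝ (transition I x x') y : Eucl n →ₗ[ℝ] Eucl n) := by
      ext i j
      simp [LinearMap.toMatrix_apply, basisVec]
    rw [h1, LinearMap.det_toMatrix]
  have h2 := gramMatrix_comp (LinearMap.mk₂ ℝ
    (fun v w => coordBilin I g.inner x' (transition I x x' y) v w)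
    (by simp) (by simp) (by simp) (by simp))
    (fderiv ℝ (transition I x x') y : Eucl n →ₗ[ℝ] Eucl n)
  simp only [LinearMap.mk₂_apply, ContinuousLinearMap.coe_coe] at h2 hdet
  have h3 : (gramMatrix fun v w => coordBilin I g.inner x y v w).det
      = (fderiv ℝ (transition I x x') y).det ^ 2 *
        (gramMatrix fun v w => coordBilin I g.inner x' (transition I x x' y) v w).det := by
    simp only [coordBilin_eq g.inner hy]
    rw [h2, Matrix.det_mul, Matrix.det_mul, Matrix.det_transpose, hdet]
    ring
  rw [volDensity, volDensity, h3, Real.sqrt_mul (sq_nonneg _), Real.sqrt_sq_eq_abs]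

/-- Change of variables along the transition map, whose Jacobian is absorbed by the density. -/
theorem chartVolume_congr {x x' : M} {A : Set M} (hA : MeasurableSet A)
    (hx : A ⊆ (extChartAt I x).source) (hx' : A ⊆ (extChartAt I x').source) :
    chartVolume I g x A = chartVolume I g x' A := by
  have hsub : chartInterior I x ∩ (extChartAt I x).symm ⁻¹' A ⊆ overlap I x x' :=
    fun y hy => ⟨hy.1, hx' hy.2⟩
  have himg : transition I x x' '' (chartInterior I x ∩ (extChartAt I x).symm ⁻¹' A)
      = chartInterior I x' ∩ (extChartAt I x').symm ⁻¹' A := by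
    refine subset_antisymm (image_subset_iff.2 fun y hy => ⟨transition_mem_chartInterior (hsub hy),
      ?_⟩) fun y hy => ?_
    · rw [mem_preimage, symm_transition (hsub hy)]
      exact hy.2
    · have ho : y ∈ overlap I x' x := ⟨hy.1, hx hy.2⟩
      refine ⟨transition I x' x y, ⟨transition_mem_chartInterior ho, ?_⟩, transition_transition ho⟩
      rw [mem_preimage, symm_transition ho]
      exact hy.2
  rw [chartVolume_apply g x hA, chartVolume_apply g x' hA, ← himg,
    lintegral_image_eq_lintegral_abs_det_fderiv_mul volume (measurableSet_inter_symm x hA)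
      (fun y hy => (differentiableAt_transition (hsub hy)).hasFDerivAt.hasFDerivWithinAt)
      ((injOn_transition x x').mono hsub)]
  refine setLIntegral_congr_fun (measurableSet_inter_symm x hA) fun y hy => ?_
  rw [← ENNReal.ofReal_mul (abs_nonneg _), volDensity_transition g (hsub hy)]

/-- On the domain of a chart, the Riemannian volume is `√(det g_{ij}) dy`. -/
theorem restrict_riemannianVolume (x : M) :
    (riemannianVolume I g).restrict (extChartAt I x).source = chartVolume I g x := by
  have hs := (isOpen_extChartAt_source (I := I) x).measurableSet
  -- A supremum of measures is not computed set by set, so it is bounded by one explicit measure: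
  -- the chart measure plus infinite mass at each point outside the chart. A set meeting the outside
  -- is bounded trivially, and inside the chart any two chart measures agree.
  have hle : riemannianVolume I g
      ≤ chartVolume I g x + ((⊤ : ℝ≥0∞) • Measure.count).restrict (extChartAt I x).sourceᶜ := by
    refine iSup_le fun x' => Measure.le_iff.2 fun A hA => ?_
    rw [Measure.add_apply, Measure.restrict_apply hA]
    rcases (A ∩ (extChartAt I x).sourceᶜ).eq_empty_or_nonempty with h0 | h0
    · have hAx : A ⊆ (extChartAt I x).source := fun p hp => by
        by_contra hps
        exact (h0 ▸ (⟨hp, hps⟩ : p ∈ A ∩ (extChartAt I x).sourceᶜ) : p ∈ (∅ : Set M))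
      have hs' := (isOpen_extChartAt_source (I := I) x').measurableSet
      have h1 : chartVolume I g x' A = chartVolume I g x' (A ∩ (extChartAt I x').source) := by
        refine le_antisymm ?_ (measure_mono inter_subset_left)
        calc chartVolume I g x' A ≤ chartVolume I g x' (A ∩ (extChartAt I x').source)
              + chartVolume I g x' (extChartAt I x').sourceᶜ :=
              (measure_mono fun p hp => by
                by_cases h : p ∈ (extChartAt I x').source
                · exact Or.inl ⟨hp, h⟩
                · exact Or.inr h).trans (measure_union_le _ _)
          _ = _ := by rw [chartVolume_compl_source, add_zero]
      rw [h1, chartVolume_congr g (hA.inter hs') inter_subset_right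
        (inter_subset_left.trans hAx)]
      exact (measure_mono inter_subset_left).trans le_self_add
    · rw [Measure.smul_apply, smul_eq_mul, ENNReal.top_mul (Measure.count_ne_zero h0), add_top]
      exact le_top
  refine Measure.ext fun A hA => ?_
  rw [Measure.restrict_apply hA]
  refine le_antisymm ?_ ?_
  · refine (Measure.le_iff.1 hle _ (hA.inter hs)).trans ?_
    rw [Measure.add_apply, Measure.restrict_apply (hA.inter hs)]
    have : A ∩ (extChartAt I x).source ∩ (extChartAt I x).sourceᶜ = ∅ := by
      rw [inter_assoc, inter_compl_self, inter_empty]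
    rw [this, measure_empty, add_zero]
    exact measure_mono inter_subset_left
  · calc chartVolume I g x A ≤ chartVolume I g x (A ∩ (extChartAt I x).source)
          + chartVolume I g x (extChartAt I x).sourceᶜ :=
          (measure_mono fun p hp => by
            by_cases h : p ∈ (extChartAt I x).source
            · exact Or.inl ⟨hp, h⟩
            · exact Or.inr h).trans (measure_union_le _ _)
      _ = chartVolume I g x (A ∩ (extChartAt I x).source) := by
          rw [chartVolume_compl_source, add_zero]
      _ ≤ _ := Measure.le_iff.1 (le_iSup (chartVolume I g) x) _ (hA.inter hs)

theorem ae_mem_source (x : M) : ∀ᵐ p ∂chartVolume I g x, p ∈ (extChartAt I x).source := by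
  rw [← restrict_riemannianVolume]
  exact ae_restrict_mem (isOpen_extChartAt_source x).measurableSet

theorem aemeasurable_extChartAt (x : M) : AEMeasurable (extChartAt I x) (chartVolume I g x) := by
  rw [← restrict_riemannianVolume]
  exact (continuousOn_extChartAt x).aemeasurable (isOpen_extChartAt_source x).measurableSet

theorem coordVolume_eq_map (x : M) :
    coordVolume g x = (chartVolume I g x).map (extChartAt I x) := by
  have h := aemeasurable_extChartAt g x
  rw [chartVolume_eq_map] at h ⊢
  rw [AEMeasurable.map_map_of_aemeasurable h (aemeasurable_symm g x)]
  conv_lhs => rw [← Measure.map_id (μ := coordVolume g x)]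
  refine Measure.map_congr ?_
  filter_upwards [ae_mem_chartInterior g x] with y hy
  exact ((extChartAt I x).right_inv (chartInterior_subset_target x hy)).symm

theorem aestronglyMeasurable_chartVolume_iff (x : M) {f : M → ℝ} :
    AEStronglyMeasurable f (chartVolume I g x)
      ↔ AEStronglyMeasurable (fun y => f ((extChartAt I x).symm y))
          (volume.restrict (chartInterior I x)) := by
  constructor
  · intro h
    rw [chartVolume_eq_map] at h
    exact (h.comp_aemeasurable (aemeasurable_symm g x)).mono_ac
      (absolutelyContinuous_coordVolume g x)
  · intro h
    have h1 := h.mono_ac (coordVolume_absolutelyContinuous g x)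
    rw [coordVolume_eq_map] at h1
    refine (h1.comp_aemeasurable (aemeasurable_extChartAt g x)).congr ?_
    filter_upwards [ae_mem_source g x] with p hp
    simp only [Function.comp_apply]
    rw [(extChartAt I x).left_inv hp]

theorem integrable_chartVolume_iff (x : M) {f : M → ℝ}
    (hf : AEStronglyMeasurable f (chartVolume I g x)) :
    Integrable f (chartVolume I g x)
      ↔ IntegrableOn (fun y => volDensity g x y * f ((extChartAt I x).symm y))
          (chartInterior I x) := by
  rw [chartVolume_eq_map] at hf ⊢
  rw [integrable_map_measure hf (aemeasurable_symm g x), coordVolume,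
    integrable_withDensity_iff_integrable_smul₀' (aemeasurable_volDensity g x) (by simp)]
  simp only [ENNReal.toReal_ofReal (Real.sqrt_nonneg _), volDensity, smul_eq_mul,
    Function.comp_apply]
  rfl

theorem integral_chartVolume (x : M) {f : M → ℝ} :
    ∫ p, f p ∂chartVolume I g x
      = ∫ y in chartInterior I x, volDensity g x y * f ((extChartAt I x).symm y) := by
  by_cases hf : AEStronglyMeasurable f (chartVolume I g x)
  · rw [chartVolume_eq_map] at hf ⊢
    rw [integral_map (aemeasurable_symm g x) hf, coordVolume,
      integral_withDensity_eq_integral_toReal_smul₀ (aemeasurable_volDensity g x) (by simp)]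
    simp only [ENNReal.toReal_ofReal (Real.sqrt_nonneg _), volDensity, smul_eq_mul]
  -- Both integrals are zero by convention when `f` is not measurable: the density is positive and
  -- could otherwise be divided out.
  · rw [integral_non_aestronglyMeasurable hf, integral_non_aestronglyMeasurable]
    intro h
    refine hf ((aestronglyMeasurable_chartVolume_iff g x).2 ?_)
    have h1 : AEStronglyMeasurable (fun y => (volDensity g x y)⁻¹)
        (volume.restrict (chartInterior I x)) :=
      ((((continuousOn_volDensity g x).mono (chartInterior_subset_target x)).aemeasurable
        (isOpen_chartInterior x).measurableSet).inv).aestronglyMeasurable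
    refine (h1.mul h).congr ?_
    filter_upwards [ae_restrict_mem (isOpen_chartInterior x).measurableSet] with y hy
    have := (volDensity_pos g (chartInterior_subset_target x hy)).ne'
    simp only [Pi.mul_apply]
    field_simp

end Volume

end

/-! ### Norms and inner products of forms. -/

section

set_option maxSynthPendingDepth 3

section FormNorms

variable {n : ℕ}

open scoped InnerProductSpace Matrix in
/-- An orthonormal frame of a positive definite form. -/
theorem IsPosForm.exists_orthonormal {B : Eucl n →L[ℝ] Eucl n →L[ℝ] ℝ} (hB : IsPosForm B) :
    ∃ J : Eucl n ≃L[ℝ] Eucl n, ∀ v w, B (J v) (J w) = inner ℝ v w := by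
  -- The inverse of the square root of the Gram matrix has orthonormal columns with respect to `B`.
  obtain ⟨P, hP, hPP, hPu⟩ := exists_isHermitian_sq_eq hB.posDef_gramMatrix
  set Q : Matrix (Fin n) (Fin n) ℝ := P⁻¹ with hQ
  have hQu : IsUnit Q := Matrix.isUnit_nonsing_inv_iff.2 ((Matrix.isUnit_iff_isUnit_det _).2 hPu)
  set L : Eucl n →ₗ[ℝ] Eucl n := Matrix.toLin (EuclideanSpace.basisFun (Fin n) ℝ).toBasis
    (EuclideanSpace.basisFun (Fin n) ℝ).toBasis Q with hL
  have hLQ : (Matrix.of fun i j => L (basisVec j) i) = Q := by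
    ext i j
    have := congrFun (congrFun (LinearMap.toMatrix_toLin (EuclideanSpace.basisFun (Fin n) ℝ).toBasis
      (EuclideanSpace.basisFun (Fin n) ℝ).toBasis Q) i) j
    rw [LinearMap.toMatrix_apply] at this
    simpa [basisVec] using this
  have hgram : (gramMatrix fun v w => B (L v) (L w)) = 1 := by
    have h1 := gramMatrix_comp (LinearMap.mk₂ ℝ (fun v w => B v w)
      (by simp) (by simp) (by simp) (by simp)) L
    simp only [LinearMap.mk₂_apply] at h1
    rw [h1, hLQ, ← hPP]
    have hQt : Qᵀ = Q := by
      have : Pᵀ = P := by simpa using hP.eq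
      rw [hQ, Matrix.transpose_nonsing_inv, this]
    rw [hQt, hQ, ← Matrix.mul_assoc, Matrix.nonsing_inv_mul _ hPu, one_mul,
      Matrix.mul_nonsing_inv _ hPu]
  have hBL : ∀ v w, B (L v) (L w) = inner ℝ v w := by
    intro v w
    have h2 : ∀ i j, B (L (basisVec i)) (L (basisVec j)) = (1 : Matrix (Fin n) (Fin n) ℝ) i j :=
      fun i j => congrFun (congrFun hgram i) j
    conv_lhs => rw [eq_sum_basisVec v, eq_sum_basisVec w]
    simp only [map_sum, map_smul, sum_apply, smul_apply, smul_eq_mul, h2, Matrix.one_apply]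
    simp [PiLp.inner_apply, mul_comm]
  have hinj : Function.Injective L := by
    rw [injective_iff_map_eq_zero]
    intro v hv
    have := hBL v v
    rw [hv, map_zero] at this
    exact (inner_self_eq_zero (𝕜 := ℝ)).1 (by rw [← this])
  exact ⟨(LinearEquiv.ofInjectiveEndo L hinj).toContinuousLinearEquiv, hBL⟩

/-- The inner product of bilinear forms with respect to `G`. -/
noncomputable def formInner (G A B : Eucl n →L[ℝ] Eucl n →L[ℝ] ℝ) : ℝ :=
  ∑ i : Fin n, A (G.inverse (EuclideanSpace.proj i)) (G.inverse (B (basisVec i)))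

/-- As a trace the pairing is visibly independent of the basis, which gives its invariance under a
change of frame. -/
theorem formInner_eq_trace {G : Eucl n →L[ℝ] Eucl n →L[ℝ] ℝ} (hG : IsPosForm G)
    (A B : Eucl n →L[ℝ] Eucl n →L[ℝ] ℝ) :
    formInner G A B = LinearMap.trace ℝ (Eucl n)
      (G.inverse.comp (A.flip.comp (G.inverse.comp B)) : Eucl n →ₗ[ℝ] Eucl n) := by
  rw [formInner, trace_eq_sum]
  exact Finset.sum_congr rfl fun i _ =>
    hG.inverse_symm (A.flip (G.inverse (B (basisVec i)))) (EuclideanSpace.proj i)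

theorem formInner_comp {G : Eucl n →L[ℝ] Eucl n →L[ℝ] ℝ} (hG : IsPosForm G)
    (A B : Eucl n →L[ℝ] Eucl n →L[ℝ] ℝ) (e : Eucl n ≃L[ℝ] Eucl n) :
    formInner (G.bilinearComp (e : Eucl n →L[ℝ] Eucl n) (e : Eucl n →L[ℝ] Eucl n))
      (A.bilinearComp (e : Eucl n →L[ℝ] Eucl n) (e : Eucl n →L[ℝ] Eucl n))
      (B.bilinearComp (e : Eucl n →L[ℝ] Eucl n) (e : Eucl n →L[ℝ] Eucl n)) = formInner G A B := by
  have hG' := hG.comp (e : Eucl n →L[ℝ] Eucl n) e.injective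
  rw [formInner_eq_trace hG, formInner_eq_trace hG', ← LinearMap.trace_conj' _ e.toLinearEquiv]
  congr 1
  ext v
  have h1 : ∀ C : Eucl n →L[ℝ] Eucl n →L[ℝ] ℝ, ∀ x,
      C.bilinearComp (e : Eucl n →L[ℝ] Eucl n) (e : Eucl n →L[ℝ] Eucl n) x
        = (C (e x)).comp (e : Eucl n →L[ℝ] Eucl n) := fun C x => rfl
  have h2 : ∀ C : Eucl n →L[ℝ] Eucl n →L[ℝ] ℝ, ∀ x,
      (C.bilinearComp (e : Eucl n →L[ℝ] Eucl n) (e : Eucl n →L[ℝ] Eucl n)).flip x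
        = (C.flip (e x)).comp (e : Eucl n →L[ℝ] Eucl n) := fun C x => rfl
  change (e ((G.bilinearComp _ _).inverse ((A.bilinearComp _ _).flip ((G.bilinearComp _ _).inverse
    ((B.bilinearComp _ _) (e.symm v))))) : Eucl n) _ = (G.inverse (A.flip (G.inverse (B v)))) _
  rw [h1 B, hG.inverse_bilinearComp, h2 A, hG.inverse_bilinearComp]
  simp

/-- In a `G`-orthonormal frame the norm is the Frobenius norm of the matrix of components, so
Cauchy–Schwarz then bounds single components. -/
theorem formInner_self {G : Eucl n →L[ℝ] Eucl n →L[ℝ] ℝ} (hG : IsPosForm G)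
    {J : Eucl n ≃L[ℝ] Eucl n} (hJ : ∀ v w, G (J v) (J w) = inner ℝ v w)
    (A : Eucl n →L[ℝ] Eucl n →L[ℝ] ℝ) :
    formInner G A A = ∑ i, ∑ j, A (J (basisVec i)) (J (basisVec j)) ^ 2 := by
  have hG' := hG.comp (J : Eucl n →L[ℝ] Eucl n) J.injective
  have hinv : ∀ ℓ : Eucl n →L[ℝ] ℝ,
      (G.bilinearComp (J : Eucl n →L[ℝ] Eucl n) (J : Eucl n →L[ℝ] Eucl n)).inverse ℓ
        = ∑ i, ℓ (basisVec i) • (basisVec i : Eucl n) := by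
    intro ℓ
    refine hG'.ext_right fun x => ?_
    rw [hG'.apply_inverse]
    have : ∀ v w, (G.bilinearComp (J : Eucl n →L[ℝ] Eucl n) (J : Eucl n →L[ℝ] Eucl n)) v w
      = inner ℝ v w := hJ
    rw [this, sum_inner]
    conv_lhs => rw [eq_sum_basisVec x]
    simp [inner_smul_left, basisVec, EuclideanSpace.inner_single_left, mul_comm]
  rw [← formInner_comp hG A A J, formInner]
  refine Finset.sum_congr rfl fun i _ => ?_
  rw [hinv, hinv]
  have : ∑ j, (EuclideanSpace.proj i : Eucl n →L[ℝ] ℝ) (basisVec j) • (basisVec j : Eucl n)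
      = basisVec i := by
    ext l
    simp [basisVec]
  rw [this, map_sum]
  refine Finset.sum_congr rfl fun j _ => ?_
  rw [map_smul, smul_eq_mul, ← sq]
  rfl

theorem abs_apply_apply_le {G : Eucl n →L[ℝ] Eucl n →L[ℝ] ℝ} (hG : IsPosForm G)
    (A : Eucl n →L[ℝ] Eucl n →L[ℝ] ℝ) (v w : Eucl n) :
    |A v w| ≤ √(formInner G A A) * (√(G v v) * √(G w w)) := by
  obtain ⟨J, hJ⟩ := hG.exists_orthonormal
  rw [formInner_self hG hJ]
  obtain ⟨v, rfl⟩ := J.surjective v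
  obtain ⟨w, rfl⟩ := J.surjective w
  rw [hJ, hJ, real_inner_self_eq_norm_sq, real_inner_self_eq_norm_sq,
    Real.sqrt_sq (norm_nonneg _), Real.sqrt_sq (norm_nonneg _), EuclideanSpace.norm_eq,
    EuclideanSpace.norm_eq, ← Real.sqrt_mul (by positivity), ← Real.sqrt_mul (by positivity)]
  have h1 : A (J v) (J w) = ∑ q : Fin n × Fin n,
      A (J (basisVec q.1)) (J (basisVec q.2)) * (v q.1 * w q.2) := by
    conv_lhs => rw [eq_sum_basisVec v, eq_sum_basisVec w]
    rw [Fintype.sum_prod_type]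
    simp only [map_sum, map_smul, sum_apply, smul_apply, smul_eq_mul, Finset.mul_sum]
    rw [Finset.sum_comm]
    exact Finset.sum_congr rfl fun i _ => Finset.sum_congr rfl fun j _ => by ring
  refine Real.abs_le_sqrt ?_
  rw [h1]
  refine (Finset.sum_mul_sq_le_sq_mul_sq _ _ _).trans (le_of_eq ?_)
  have h2 : ∑ i, ∑ j, (v i * w j) ^ 2 = (∑ i, v i ^ 2) * ∑ j, w j ^ 2 := by
    rw [Finset.sum_mul_sum]
    simp only [mul_pow]
  rw [Fintype.sum_prod_type, Fintype.sum_prod_type, h2]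
  simp only [Real.norm_eq_abs, sq_abs]

theorem abs_apply_le_sqrt {G : Eucl n →L[ℝ] Eucl n →L[ℝ] ℝ} (hG : IsPosForm G)
    (d : Eucl n →L[ℝ] ℝ) (v : Eucl n) :
    |d v| ≤ √(d (G.inverse d)) * √(G v v) := by
  obtain ⟨J, hJ⟩ := hG.exists_orthonormal
  obtain ⟨v, rfl⟩ := J.surjective v
  obtain ⟨w, hw⟩ := J.surjective (G.inverse d)
  have hd : ∀ x, d x = G (J w) x := fun x => by rw [hw, hG.apply_inverse]
  rw [← hw, hd, hd, hJ, hJ, hJ, real_inner_self_eq_norm_sq, real_inner_self_eq_norm_sq,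
    Real.sqrt_sq (norm_nonneg _), Real.sqrt_sq (norm_nonneg _)]
  exact abs_real_inner_le_norm _ _

/-- The form `G(v, ·) ⊗ G(w, ·)`. -/
noncomputable def dualForm (G : Eucl n →L[ℝ] Eucl n →L[ℝ] ℝ) (v w : Eucl n) :
    Eucl n →L[ℝ] Eucl n →L[ℝ] ℝ := (G v).smulRight (G w)

/-- Raising both indices of `G(v, ·) ⊗ G(w, ·)` returns `v` and `w`. Pairing with such forms
isolates one component of a tensor. -/
theorem formInner_dualForm {G : Eucl n →L[ℝ] Eucl n →L[ℝ] ℝ} (hG : IsPosForm G)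
    (A : Eucl n →L[ℝ] Eucl n →L[ℝ] ℝ) (v w : Eucl n) :
    formInner G A (dualForm G v w) = A v w := by
  have h1 : v = ∑ i, G v (basisVec i) • G.inverse (EuclideanSpace.proj i) := by
    rw [← hG.inverse_apply v]
    simp only [← map_smul, ← map_sum]
    congr 1
    ext x
    rw [hG.inverse_apply]
    conv_lhs => rw [eq_sum_basisVec x]
    simp [mul_comm]
  conv_rhs => rw [h1]
  simp only [formInner, dualForm, ContinuousLinearMap.smulRight_apply, map_smul, hG.inverse_apply,
    map_sum, sum_apply, smul_apply]

variable {H : Type*} [TopologicalSpace H] {I : ModelWithCorners ℝ (Eucl n) H}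
  {M : Type*} [TopologicalSpace M] [ChartedSpace H M] [IsManifold I ∞ M]
  (g : ContMDiffRiemannianMetric I ∞ (Eucl n) (TangentSpace I (M := M)))

theorem bilinInner_eq_formInner (A B : BilinField I M) (p : M) :
    bilinInner I g p (A p) (B p)
      = formInner (rawBilin g.inner p) (rawBilin A p) (rawBilin B p) := rfl

/-- The inner product of fields of bilinear forms, computed in coordinates. -/
theorem bilinInner_eq (A B : BilinField I M) {x : M} {y : Eucl n}
    (hy : y ∈ (extChartAt I x).target) :
    bilinInner I g ((extChartAt I x).symm y) (A ((extChartAt I x).symm y))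
        (B ((extChartAt I x).symm y))
      = formInner (coordBilin I g.inner x y) (coordBilin I A x y) (coordBilin I B x y) := by
  obtain ⟨e, he⟩ := exists_frame_equiv hy
  rw [bilinInner_eq_formInner, coordBilin_eq_bilinearComp, coordBilin_eq_bilinearComp,
    coordBilin_eq_bilinearComp, ← he, formInner_comp (isPosForm_rawBilin g _)]

end FormNorms

end

/-! ### Integrability of coordinate components and uniqueness of weak derivatives. -/

section

set_option maxSynthPendingDepth 3

section Elementary

variable {n : ℕ}

theorem norm_pow_le_sum {k : ℕ} (hk : k ≠ 0) (h : Fin n → Fin n → ℝ) :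
    ‖h‖ ^ k ≤ ∑ a, ∑ b, |h a b| ^ k := by
  set S := ∑ a, ∑ b, |h a b| ^ k with hS
  have hS0 : 0 ≤ S := by positivity
  have h1 : ∀ a b, |h a b| ^ k ≤ S := fun a b =>
    (Finset.single_le_sum (f := fun b => |h a b| ^ k) (fun _ _ => by positivity)
      (Finset.mem_univ b)).trans
      (Finset.single_le_sum (f := fun a => ∑ b, |h a b| ^ k) (fun _ _ => by positivity)
        (Finset.mem_univ a))
  have h2 : (S ^ ((k : ℝ)⁻¹)) ^ k = S := Real.rpow_inv_natCast_pow hS0 hk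
  rw [← h2]
  refine pow_le_pow_left₀ (norm_nonneg _) ?_ k
  have h3 : 0 ≤ S ^ ((k : ℝ)⁻¹) := Real.rpow_nonneg hS0 _
  refine (pi_norm_le_iff_of_nonneg h3).2 fun a => (pi_norm_le_iff_of_nonneg h3).2 fun b => ?_
  refine le_of_pow_le_pow_left₀ hk h3 ?_
  rw [h2, Real.norm_eq_abs]
  exact h1 a b

/-- Weak derivatives are unique. -/
theorem HasWeakPDeriv.ae_eq {V : Set (Eucl n)} (hV : IsOpen V) {b : Fin n}
    {f h₁ h₂ : Eucl n → ℝ} (H₁ : HasWeakPDeriv V b f h₁) (H₂ : HasWeakPDeriv V b f h₂)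
    (hi₁ : LocallyIntegrableOn h₁ V) (hi₂ : LocallyIntegrableOn h₂ V) :
    ∀ᵐ y ∂volume.restrict V, h₁ y = h₂ y := by
  have hint : ∀ {h : Eucl n → ℝ}, LocallyIntegrableOn h V → ∀ {η : Eucl n → ℝ}, Continuous η →
      HasCompactSupport η → tsupport η ⊆ V → Integrable fun y => h y * η y := by
    intro h hi η hη hc hs
    have h1 : IntegrableOn (fun y => h y * η y) (tsupport η) :=
      (hi.integrableOn_compact_subset hs hc.isCompact).mul_continuousOn hη.continuousOn hc.isCompact
    rw [integrableOn_iff_integrable_of_support_subset] at h1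
    · exact h1
    · exact (Function.support_mul_subset_right h η).trans subset_closure
  have h := hV.ae_eq_zero_of_integral_contDiff_smul_eq_zero (hi₁.sub hi₂) fun η hη hc hs => ?_
  · rw [ae_restrict_iff' hV.measurableSet]
    filter_upwards [h] with y hy hyV
    have := hy hyV
    simp only [Pi.sub_apply] at this
    linarith
  · have e := (H₁ η hη hc hs).symm.trans (H₂ η hη hc hs)
    have e1 := integral_sub (hint hi₁ hη.continuous hc hs) (hint hi₂ hη.continuous hc hs)
    rw [neg_inj.1 e, sub_self] at e1
    rw [← e1]
    exact integral_congr_ae (ae_of_all _ fun y => by simp only [Pi.sub_apply, smul_eq_mul]; ring)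

theorem integrableOn_of_abs_pow {X : Type*} [MeasurableSpace X] {μ : Measure X} {s : Set X}
    {f : X → ℝ} {k : ℕ} (hk : 1 ≤ k) (hs : μ s ≠ ⊤) (hf : AEStronglyMeasurable f (μ.restrict s))
    (hi : IntegrableOn (fun y => |f y| ^ k) s μ) : IntegrableOn f s μ := by
  have : IsFiniteMeasure (μ.restrict s) := ⟨by simpa using hs.lt_top⟩
  exact ((integrable_const (1 : ℝ)).add hi).mono' hf
    (ae_of_all _ fun y => le_one_add_pow (abs_nonneg _) hk)

end Elementary

section Coordinates

variable {n : ℕ} {H : Type*} [TopologicalSpace H] {I : ModelWithCorners ℝ (Eucl n) H}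
  {M : Type*} [TopologicalSpace M] [ChartedSpace H M] [IsManifold I ∞ M]
  (g : ContMDiffRiemannianMetric I ∞ (Eucl n) (TangentSpace I (M := M)))
  [MeasurableSpace M] [BorelSpace M] [T2Space M] [CompactSpace M]

/-- Integration over a compact part of a chart is controlled by integration over the manifold. -/
theorem exists_integral_comp_symm_le {x : M} {K : Set (Eucl n)} (hK : IsCompact K)
    (hKt : K ⊆ (extChartAt I x).target) : ∃ C : ℝ, 0 ≤ C ∧ ∀ f : M → ℝ,
      Integrable f (riemannianVolume I g) →
      IntegrableOn (fun y => f ((extChartAt I x).symm y)) (K ∩ chartInterior I x) ∧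
      ∫ y in K ∩ chartInterior I x, |f ((extChartAt I x).symm y)|
        ≤ C * ∫ p, |f p| ∂riemannianVolume I g := by
  -- The constant bounds the reciprocal of the volume density on `K`, where the density is
  -- continuous and positive up to the boundary.
  obtain ⟨C, hC⟩ := hK.exists_bound_of_continuousOn (f := fun y => (volDensity g x y)⁻¹)
    (((continuousOn_volDensity g x).mono hKt).inv₀ fun y hy => (volDensity_pos g (hKt hy)).ne')
  refine ⟨max C 0, le_max_right _ _, fun f hf => ?_⟩
  have hsm : MeasurableSet (K ∩ chartInterior I x) :=
    hK.measurableSet.inter (isOpen_chartInterior x).measurableSet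
  have h0 : Integrable f (chartVolume I g x) := by
    rw [← restrict_riemannianVolume]
    exact hf.restrict
  have h1 := ((integrable_chartVolume_iff g x h0.aestronglyMeasurable).1 h0)
  have hm := ((aestronglyMeasurable_chartVolume_iff g x).1 h0.aestronglyMeasurable)
  have h1' : IntegrableOn (fun y => |volDensity g x y * f ((extChartAt I x).symm y)|)
    (chartInterior I x) := h1.abs
  have hb : ∀ y ∈ K ∩ chartInterior I x, |f ((extChartAt I x).symm y)|
      ≤ max C 0 * |volDensity g x y * f ((extChartAt I x).symm y)| := by
    intro y hy
    have hp := volDensity_pos g (hKt hy.1)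
    have h2 := (hC y hy.1).trans (le_max_left C 0)
    rw [Real.norm_eq_abs, abs_of_pos (by positivity)] at h2
    rw [abs_mul, abs_of_pos hp, ← mul_assoc]
    refine le_mul_of_one_le_left (abs_nonneg _) ?_
    have := mul_le_mul_of_nonneg_right h2 hp.le
    rwa [inv_mul_cancel₀ hp.ne'] at this
  have h3 : IntegrableOn (fun y => f ((extChartAt I x).symm y)) (K ∩ chartInterior I x) :=
    ((h1'.mono_set inter_subset_right).const_mul (max C 0)).mono'
      (hm.mono_measure (Measure.restrict_mono inter_subset_right le_rfl))
      ((ae_restrict_iff' hsm).2 (ae_of_all _ hb))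
  refine ⟨h3, ?_⟩
  calc ∫ y in K ∩ chartInterior I x, |f ((extChartAt I x).symm y)|
      ≤ ∫ y in K ∩ chartInterior I x,
          max C 0 * |volDensity g x y * f ((extChartAt I x).symm y)| :=
        setIntegral_mono_on h3.abs ((h1'.mono_set inter_subset_right).const_mul (max C 0)) hsm hb
    _ = max C 0 * ∫ y in K ∩ chartInterior I x,
          |volDensity g x y * f ((extChartAt I x).symm y)| := integral_const_mul _ _
    _ ≤ max C 0 * ∫ y in chartInterior I x,
          |volDensity g x y * f ((extChartAt I x).symm y)| := by
        refine mul_le_mul_of_nonneg_left ?_ (le_max_right _ _)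
        exact setIntegral_mono_set h1' (ae_of_all _ fun y => abs_nonneg _)
          inter_subset_right.eventuallyLE
    _ = max C 0 * ∫ p, |f p| ∂chartVolume I g x := by
        rw [integral_chartVolume]
        congr 1
        exact integral_congr_ae (ae_of_all _ fun y => by
          simp only [abs_mul, abs_of_nonneg (Real.sqrt_nonneg _), volDensity])
    _ ≤ max C 0 * ∫ p, |f p| ∂riemannianVolume I g := by
        refine mul_le_mul_of_nonneg_left ?_ (le_max_right _ _)
        rw [← restrict_riemannianVolume]
        exact setIntegral_le_integral hf.abs (ae_of_all _ fun y => abs_nonneg _)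

theorem continuousOn_sqrt_coordBilin {x : M} {v : Eucl n → Eucl n} {s : Set (Eucl n)}
    (hs : s ⊆ (extChartAt I x).target) (hv : ContinuousOn v s) :
    ContinuousOn (fun y => √(coordBilin I g.inner x y (v y) (v y))) s :=
  Real.continuous_sqrt.comp_continuousOn
    ((((continuousOn_coordBilin g x).mono hs).clm_apply hv).clm_apply hv)

variable {g} {k : ℕ}

theorem MemLpCov.aestronglyMeasurable_apply {q : ℝ≥0∞} {D : CovField I M} (hD : MemLpCov I g q D)
    (x : M) {v : Eucl n → Eucl n} (hv : ContinuousOn v (extChartAt I x).target) :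
    AEStronglyMeasurable (fun y => coordCov I D x y (v y)) (volume.restrict (chartInterior I x)) := by
  have h := hD.1 x
  have h' := hv.aestronglyMeasurable (μ := volume) (measurableSet_target x)
  rw [restrict_target] at h h'
  exact isBoundedBilinearMap_apply.continuous.comp_aestronglyMeasurable (h.prodMk h')

theorem MemLpBilin.aestronglyMeasurable_apply {q : ℝ≥0∞} {B : BilinField I M}
    (hB : MemLpBilin I g q B) (x : M) (v w : Eucl n) :
    AEStronglyMeasurable (fun y => coordBilin I B x y v w) (volume.restrict (chartInterior I x)) := by
  have h := hB.1 x
  rw [restrict_target] at h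
  exact (h.apply_continuousLinearMap v).apply_continuousLinearMap w

/-- Pointwise, a component is at most the Riemannian norm of `D` times the length of `v`, which is
bounded on `K`. The vector `v` may vary because Christoffel vectors are inserted later. -/
theorem MemLpCov.integrableOn_pow (hk : 1 ≤ k) {D : CovField I M} (hD : MemLpCov I g k D) {x : M}
    {K : Set (Eucl n)} (hK : IsCompact K) (hKt : K ⊆ (extChartAt I x).target)
    {v : Eucl n → Eucl n} (hv : ContinuousOn v (extChartAt I x).target) :
    IntegrableOn (fun y => |coordCov I D x y (v y)| ^ k) (K ∩ chartInterior I x) := by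
  obtain ⟨C, hC⟩ := hK.exists_bound_of_continuousOn
    (continuousOn_sqrt_coordBilin g hKt (hv.mono hKt))
  have h1 := hD.2.integrable_norm_pow (by omega)
  obtain ⟨_, _, h⟩ := exists_integral_comp_symm_le g hK hKt
  refine ((h _ h1).1.const_mul (C ^ k)).mono' ?_ ?_
  · exact (((hD.aestronglyMeasurable_apply x hv).norm.pow k)).mono_measure
      (Measure.restrict_mono inter_subset_right le_rfl)
  · refine (ae_restrict_iff' (hK.measurableSet.inter (isOpen_chartInterior x).measurableSet)).2
      (ae_of_all _ fun y hy => ?_)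
    rw [Real.norm_eq_abs, abs_of_nonneg (by positivity), ← mul_pow]
    refine pow_le_pow_left₀ (abs_nonneg _) ?_ k
    have h3 := abs_apply_le_sqrt (isPosForm_coordBilin g (hKt hy.1)) (coordCov I D x y) (v y)
    rw [← covInner_eq g D D (hKt hy.1)] at h3
    rw [mul_comm C, Real.norm_eq_abs, abs_of_nonneg (Real.sqrt_nonneg _)]
    refine h3.trans (mul_le_mul_of_nonneg_left ?_ (Real.sqrt_nonneg _))
    exact (le_abs_self _).trans (hC y hy.1)

theorem MemLpBilin.integrableOn_pow (hk : 1 ≤ k) {B : BilinField I M} (hB : MemLpBilin I g k B)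
    {x : M} {K : Set (Eucl n)} (hK : IsCompact K) (hKt : K ⊆ (extChartAt I x).target)
    (v w : Eucl n) :
    IntegrableOn (fun y => |coordBilin I B x y v w| ^ k) (K ∩ chartInterior I x) := by
  obtain ⟨C, hC⟩ := hK.exists_bound_of_continuousOn
    ((continuousOn_sqrt_coordBilin g hKt (v := fun _ => v) continuousOn_const).mul
      (continuousOn_sqrt_coordBilin g hKt (v := fun _ => w) continuousOn_const))
  have h1 := hB.2.integrable_norm_pow (by omega)
  obtain ⟨_, _, h⟩ := exists_integral_comp_symm_le g hK hKt
  refine ((h _ h1).1.const_mul (C ^ k)).mono' ?_ ?_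
  · exact ((hB.aestronglyMeasurable_apply x v w).norm.pow k).mono_measure
      (Measure.restrict_mono inter_subset_right le_rfl)
  · refine (ae_restrict_iff' (hK.measurableSet.inter (isOpen_chartInterior x).measurableSet)).2
      (ae_of_all _ fun y hy => ?_)
    rw [Real.norm_eq_abs, abs_of_nonneg (by positivity), ← mul_pow]
    refine pow_le_pow_left₀ (abs_nonneg _) ?_ k
    have h3 := abs_apply_apply_le (isPosForm_coordBilin g (hKt hy.1)) (coordBilin I B x y) v w
    rw [← bilinInner_eq g B B (hKt hy.1)] at h3
    rw [mul_comm C, Real.norm_eq_abs, abs_of_nonneg (Real.sqrt_nonneg _)]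
    refine h3.trans (mul_le_mul_of_nonneg_left ?_ (Real.sqrt_nonneg _))
    exact (le_abs_self _).trans (hC y hy.1)

end Coordinates

end

/-! ### Weak gradients and Hessians of functions in charts. -/

section

set_option maxSynthPendingDepth 3

section WeakDerivatives

variable {n : ℕ}

/-- Weak second derivatives of a `C¹` function may be taken in any order. -/
theorem HasWeakPDeriv.swap {V : Set (Eucl n)} (hV : IsOpen V) {f h : Eucl n → ℝ}
    (hf : ContDiffOn ℝ 1 f V) {a b : Fin n} (hh : HasWeakPDeriv V b (pderiv a f) h) :
    HasWeakPDeriv V a (pderiv b f) h := by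
  -- Once both derivatives rest on the smooth test function they commute.
  have key : ∀ c d : Fin n, ∀ η : Eucl n → ℝ, ContDiff ℝ ∞ η → HasCompactSupport η →
      tsupport η ⊆ V → ∫ y, pderiv c f y * pderiv d η y = -∫ y, f y * pderiv c (pderiv d η) y := by
    intro c d η hη hc hs
    have h1 : ContDiff ℝ 1 (pderiv d η) :=
      ((contDiff_infty.1 hη 2).fderiv_right (m := 1) le_rfl).clm_apply
        contDiff_const
    rw [← integral_mul_pderiv hV hf h1 (hasCompactSupport_pderiv hc d)
      ((tsupport_pderiv_subset d η).trans hs) c]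
    simp only [mul_comm]
  intro η hη hc hs
  rw [← hh η hη hc hs, key b a η hη hc hs, key a b η hη hc hs]
  congr 2
  ext y
  rw [pderiv_comm isOpen_univ (contDiff_infty.1 hη 2).contDiffOn (mem_univ y)]

theorem HasWeakPDeriv.congr_left {V : Set (Eucl n)} (hV : IsOpen V) {b : Fin n}
    {f f' h : Eucl n → ℝ} (hh : HasWeakPDeriv V b f h)
    (hff : ∀ᵐ y ∂volume.restrict V, f y = f' y) : HasWeakPDeriv V b f' h := by
  intro η hη hc hs
  rw [← hh η hη hc hs]
  refine integral_congr_ae ?_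
  rw [ae_restrict_iff' hV.measurableSet] at hff
  filter_upwards [hff] with y hy
  by_cases hyV : y ∈ V
  · rw [hy hyV]
  · have : pderiv b η y = 0 := by
      by_contra h
      exact hyV (hs (tsupport_pderiv_subset b η (subset_tsupport _ h)))
    rw [this, mul_zero, mul_zero]

theorem ext_basisVec {d d' : Eucl n →L[ℝ] ℝ} (h : ∀ a, d (basisVec a) = d' (basisVec a)) :
    d = d' := by
  ext v
  rw [eq_sum_basisVec v]
  simp only [map_sum, map_smul, h]

end WeakDerivatives

section Charts

variable {n : ℕ} {H : Type*} [TopologicalSpace H] {I : ModelWithCorners ℝ (Eucl n) H}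
  {M : Type*} [TopologicalSpace M] [ChartedSpace H M] [IsManifold I ∞ M]
  {g : ContMDiffRiemannianMetric I ∞ (Eucl n) (TangentSpace I (M := M))}
  [MeasurableSpace M] [BorelSpace M] [T2Space M] [CompactSpace M] {k : ℕ}
  {u : M → ℝ} {du : CovField I M} {Hu : BilinField I M}

theorem integrableOn_compact_of_pow (hk : 1 ≤ k) {V : Set (Eucl n)} (hV : IsOpen V)
    {f : Eucl n → ℝ} (hf : AEStronglyMeasurable f (volume.restrict V))
    (h : ∀ K ⊆ V, IsCompact K → IntegrableOn (fun y => |f y| ^ k) K) : LocallyIntegrableOn f V := by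
  rw [locallyIntegrableOn_iff hV.isLocallyClosed]
  exact fun K hKV hK => integrableOn_of_abs_pow hk hK.measure_lt_top.ne
    (hf.mono_measure (Measure.restrict_mono hKV le_rfl)) (h K hKV hK)

theorem MemLpCov.locallyIntegrableOn (hk : 1 ≤ k) {D : CovField I M} (hD : MemLpCov I g k D)
    (x : M) {v : Eucl n → Eucl n} (hv : ContinuousOn v (extChartAt I x).target) :
    LocallyIntegrableOn (fun y => coordCov I D x y (v y)) (chartInterior I x) :=
  integrableOn_compact_of_pow hk (isOpen_chartInterior x) (hD.aestronglyMeasurable_apply x hv)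
    fun K hKV hK => by
      have := hD.integrableOn_pow hk hK (hKV.trans (chartInterior_subset_target x)) hv
      rwa [inter_eq_left.2 hKV] at this

theorem MemLpBilin.locallyIntegrableOn (hk : 1 ≤ k) {B : BilinField I M} (hB : MemLpBilin I g k B)
    (x : M) (v w : Eucl n) :
    LocallyIntegrableOn (fun y => coordBilin I B x y v w) (chartInterior I x) :=
  integrableOn_compact_of_pow hk (isOpen_chartInterior x) (hB.aestronglyMeasurable_apply x v w)
    fun K hKV hK => by
      have := hB.integrableOn_pow hk hK (hKV.trans (chartInterior_subset_target x)) v w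
      rwa [inter_eq_left.2 hKV] at this

theorem HasWeakHessian.locallyIntegrableOn_coordHess (h : HasWeakHessian I g k u du Hu)
    (hk : 1 ≤ k) (x : M) (a b : Fin n) :
    LocallyIntegrableOn (fun y => coordHess g du Hu x y a b) (chartInterior I x) :=
  (h.memLp_hess.locallyIntegrableOn hk x _ _).add
    (h.memLp_grad.locallyIntegrableOn hk x (continuousOn_christoffel g x _ _))

theorem contDiffOn_chartInterior {m : WithTop ℕ∞} [IsManifold I m M] (hu : ContMDiff I 𝓘(ℝ, ℝ) m u)
    (x : M) : ContDiffOn ℝ m (fun y => u ((extChartAt I x).symm y)) (chartInterior I x) :=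
  (contDiffOn_comp_symm hu x).mono (chartInterior_subset_target x)

/-- The weak gradient of a `C¹` function is its derivative. -/
theorem HasWeakHessian.coordCov_ae (h : HasWeakHessian I g k u du Hu) (hk : 1 ≤ k)
    (hu : ContMDiff I 𝓘(ℝ, ℝ) 1 u) (x : M) : ∀ᵐ y ∂volume.restrict (chartInterior I x),
      coordCov I du x y = fderiv ℝ (fun z => u ((extChartAt I x).symm z)) y := by
  have hV := isOpen_chartInterior (I := I) x
  have hf := contDiffOn_chartInterior hu x
  have h1 : ∀ a : Fin n, ∀ᵐ y ∂volume.restrict (chartInterior I x),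
      coordCov I du x y (basisVec a) = pderiv a (fun z => u ((extChartAt I x).symm z)) y := fun a =>
    HasWeakPDeriv.ae_eq hV (fun η hη hc hs => h.weak_grad x η hη hc hs _)
      (hasWeakPDeriv_pderiv hV hf a)
      (h.memLp_grad.locallyIntegrableOn hk x continuousOn_const)
      ((continuousOn_pderiv hV hf a).locallyIntegrableOn hV.measurableSet)
  filter_upwards [ae_all_iff.2 h1] with y hy using ext_basisVec hy

theorem HasWeakHessian.hasWeakPDeriv (h : HasWeakHessian I g k u du Hu) (hk : 1 ≤ k)
    (hu : ContMDiff I 𝓘(ℝ, ℝ) 1 u) (x : M) (a b : Fin n) :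
    HasWeakPDeriv (chartInterior I x) b (pderiv a fun z => u ((extChartAt I x).symm z))
      fun y => coordHess g du Hu x y a b := by
  refine HasWeakPDeriv.congr_left (isOpen_chartInterior x)
    (f := fun y => coordCov I du x y (basisVec a))
    (fun η hη hc hs => h.weak_hess x η hη hc hs _ _) ?_
  filter_upwards [h.coordCov_ae hk hu x] with y hy
  rw [hy, pderiv]

/-- The weak Hessian of a `C¹` function is symmetric. -/
theorem HasWeakHessian.coordHess_symm (h : HasWeakHessian I g k u du Hu) (hk : 1 ≤ k)
    (hu : ContMDiff I 𝓘(ℝ, ℝ) 1 u) (x : M) : ∀ᵐ y ∂volume.restrict (chartInterior I x),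
      ∀ a b, coordHess g du Hu x y a b = coordHess g du Hu x y b a := by
  have hV := isOpen_chartInterior (I := I) x
  refine ae_all_iff.2 fun a => ae_all_iff.2 fun b => ?_
  exact HasWeakPDeriv.ae_eq hV (h.hasWeakPDeriv hk hu x a b)
    ((h.hasWeakPDeriv hk hu x b a).swap hV (contDiffOn_chartInterior hu x))
    (h.locallyIntegrableOn_coordHess hk x a b) (h.locallyIntegrableOn_coordHess hk x b a)

/-- The weak Hessian of a smooth function is its Hessian. -/
theorem HasWeakHessian.coordHess_ae (h : HasWeakHessian I g k u du Hu) (hk : 1 ≤ k)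
    (hu : ContMDiff I 𝓘(ℝ, ℝ) ∞ u) (x : M) : ∀ᵐ y ∂volume.restrict (chartInterior I x),
      coordHess g du Hu x y = hess (fun z => u ((extChartAt I x).symm z)) y := by
  have hV := isOpen_chartInterior (I := I) x
  have hf : ContDiffOn ℝ 2 (fun z => u ((extChartAt I x).symm z)) (chartInterior I x) :=
    contDiffOn_infty.1 (contDiffOn_chartInterior hu x) 2
  have h1 : ∀ a b, ∀ᵐ y ∂volume.restrict (chartInterior I x), coordHess g du Hu x y a b
      = hess (fun z => u ((extChartAt I x).symm z)) y a b := fun a b =>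
    HasWeakPDeriv.ae_eq hV
      (h.hasWeakPDeriv hk (hu.of_le (by exact_mod_cast le_top)) x a b)
      (hasWeakPDeriv_pderiv hV (contDiffOn_pderiv hV (m := 1) (by exact_mod_cast hf) a) b)
      (h.locallyIntegrableOn_coordHess hk x a b)
      ((contDiffOn_hess hV (m := 0) (by exact_mod_cast hf) a b).continuousOn.locallyIntegrableOn
        hV.measurableSet)
  filter_upwards [ae_all_iff.2 fun a => ae_all_iff.2 (h1 a)] with y hy
  ext a b
  exact hy a b

theorem norm_coordHess_pow_le (hk : 1 ≤ k) (du : CovField I M) (Hu : BilinField I M) (x : M)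
    (y : Eucl n) : ‖coordHess g du Hu x y‖ ^ k ≤ ∑ a, ∑ b, 2 ^ (k - 1) *
      (|coordBilin I Hu x y (basisVec b) (basisVec a)| ^ k
        + |coordCov I du x y (christoffel (coordBilin I g.inner x) (range I) y
            (basisVec b) (basisVec a))| ^ k) := by
  refine (norm_pow_le_sum (by omega) _).trans ?_
  refine Finset.sum_le_sum fun a _ => Finset.sum_le_sum fun b _ => ?_
  exact (pow_le_pow_left₀ (abs_nonneg _) (abs_add_le _ _) k).trans
    (add_pow_le (abs_nonneg _) (abs_nonneg _) k)

theorem HasWeakHessian.aestronglyMeasurable_coordHess (h : HasWeakHessian I g k u du Hu) (x : M) :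
    AEStronglyMeasurable (coordHess g du Hu x) (volume.restrict (chartInterior I x)) := by
  have h1 : ∀ a b, AEMeasurable (fun y => coordHess g du Hu x y a b)
      (volume.restrict (chartInterior I x)) := fun a b =>
    ((h.memLp_hess.aestronglyMeasurable_apply x _ _).add
      (h.memLp_grad.aestronglyMeasurable_apply x (continuousOn_christoffel g x _ _))).aemeasurable
  exact (aemeasurable_pi_lambda _ fun a =>
    aemeasurable_pi_lambda _ fun b => h1 a b).aestronglyMeasurable

theorem HasWeakHessian.integrableOn_coordHess_pow (h : HasWeakHessian I g k u du Hu) (hk : 1 ≤ k)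
    {x : M} {K : Set (Eucl n)} (hK : IsCompact K) (hKt : K ⊆ (extChartAt I x).target) :
    IntegrableOn (fun y => ‖coordHess g du Hu x y‖ ^ k) (K ∩ chartInterior I x) := by
  have h1 : IntegrableOn (fun y => ∑ a, ∑ b, 2 ^ (k - 1) *
      (|coordBilin I Hu x y (basisVec b) (basisVec a)| ^ k
        + |coordCov I du x y (christoffel (coordBilin I g.inner x) (range I) y
            (basisVec b) (basisVec a))| ^ k)) (K ∩ chartInterior I x) :=
    integrable_finsetSum _ fun a _ => integrable_finsetSum _ fun b _ =>
      ((h.memLp_hess.integrableOn_pow hk hK hKt (basisVec b) (basisVec a)).add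
        (h.memLp_grad.integrableOn_pow hk hK hKt
          (continuousOn_christoffel g x (basisVec b) (basisVec a)))).const_mul (2 ^ (k - 1))
  refine h1.mono' ?_ (ae_of_all _ fun y => ?_)
  · exact ((h.aestronglyMeasurable_coordHess x).norm.pow k).mono_measure
      (Measure.restrict_mono inter_subset_right le_rfl)
  · rw [Real.norm_eq_abs, abs_of_nonneg (by positivity)]
    exact norm_coordHess_pow_le hk du Hu x y

/-- Enclosing `V` in a compact part of the chart, possibly touching the boundary, turns the global
integrability of the weak derivatives into integrability of coordinate expressions over `V`. -/
theorem HasWeakHessian.hasWeakHess (h : HasWeakHessian I g k u du Hu) (hk : 1 ≤ k)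
    (hu : ContMDiff I 𝓘(ℝ, ℝ) 1 u) {x : M} {K V : Set (Eucl n)} (hK : IsCompact K)
    (hKt : K ⊆ (extChartAt I x).target) (hVK : V ⊆ K)
    (hVi : V ⊆ chartInterior I x) :
    HasWeakHess V k (fun z => u ((extChartAt I x).symm z)) (coordHess g du Hu x) := by
  have hVKi : V ⊆ K ∩ chartInterior I x := subset_inter hVK hVi
  refine ⟨(contDiffOn_chartInterior hu x).mono hVi, ?_, fun a => ?_, ?_, ?_, fun a b η hη hc hs =>
    h.hasWeakPDeriv hk hu x a b η hη hc (hs.trans hVi)⟩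
  · exact (((contDiffOn_comp_symm hu x).continuousOn.mono hKt).integrableOn_compact hK).mono_set hVK
  · have h1 : IntegrableOn (fun y => coordCov I du x y (basisVec a)) (K ∩ chartInterior I x) :=
      integrableOn_of_abs_pow hk
        ((measure_mono inter_subset_left).trans_lt hK.measure_lt_top).ne
        ((h.memLp_grad.aestronglyMeasurable_apply x continuousOn_const).mono_measure
          (Measure.restrict_mono inter_subset_right le_rfl))
        (h.memLp_grad.integrableOn_pow hk hK hKt continuousOn_const)
    refine (h1.mono_set hVKi).congr ?_
    filter_upwards [ae_mono (Measure.restrict_mono hVi le_rfl) (h.coordCov_ae hk hu x)] with y hy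
    rw [hy, pderiv]
  · exact (h.aestronglyMeasurable_coordHess x).mono_measure (Measure.restrict_mono hVi le_rfl)
  · exact (h.integrableOn_coordHess_pow hk hK hKt).mono_set hVKi

end Charts

end

/-! ### Boundedness of weakly bounded sequences in `L^k`. -/

section

set_option maxSynthPendingDepth 3

section UniformBoundedness

variable {X : Type*} [MeasurableSpace X] {μ : Measure X}

/-- The extremal function of Hölder duality for `p = m + 1`. The conjugate exponent is `r = 1 +
1/m`, so `r m = m + 1`; for `m = 0` it is infinite and the function is a sign, of size at most one.
-/
theorem eLpNorm_sign_mul_pow_le (m : ℕ) (r : ℝ≥0∞)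
    [hr : ENNReal.HolderConjugate ((m + 1 : ℕ) : ℝ≥0∞) r] (a : X → ℝ) :
    eLpNorm (fun x => SignType.sign (a x) * |a x| ^ m) r μ
      ≤ eLpNorm a ((m + 1 : ℕ) : ℝ≥0∞) μ ^ m := by
  have hb : ∀ x, |(SignType.sign (a x) : ℝ)| ≤ 1 := by
    intro x
    rcases lt_trichotomy (a x) 0 with h | h | h
    · rw [sign_neg h]; simp
    · rw [h, sign_zero]; simp
    · rw [sign_pos h]; simp
  have hre : r = 1 + (m : ℝ≥0∞)⁻¹ := by
    have := ENNReal.HolderConjugate.conj_eq (p := ((m + 1 : ℕ) : ℝ≥0∞)) (q := r)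
    rw [this]
    congr 2
    push_cast
    exact ENNReal.add_sub_cancel_right ENNReal.one_ne_top
  rcases Nat.eq_zero_or_pos m with rfl | hm
  · rw [pow_zero]
    have hr' : r = ⊤ := by simpa using hre
    have := eLpNorm_le_of_ae_bound (μ := μ) (p := r)
      (f := fun x => (SignType.sign (a x) : ℝ) * |a x| ^ 0) (C := 1)
      (ae_of_all _ fun x => by simpa using hb x)
    simpa [hr'] using this
  · have h1 : eLpNorm (fun x => ‖a x‖ ^ (m : ℝ)) r μ = eLpNorm a ((m + 1 : ℕ) : ℝ≥0∞) μ ^ m := by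
      rw [eLpNorm_norm_rpow a (by exact_mod_cast hm), ENNReal.rpow_natCast]
      congr 2
      rw [hre, ENNReal.ofReal_natCast, add_mul, one_mul,
        ENNReal.inv_mul_cancel (by exact_mod_cast hm.ne') (by simp)]
      push_cast
      rfl
    rw [← h1]
    refine eLpNorm_mono fun x => ?_
    rw [Real.rpow_natCast, norm_mul, norm_pow, norm_pow, norm_norm]
    simp only [Real.norm_eq_abs, abs_abs]
    exact mul_le_of_le_one_left (by positivity) (hb x)

/-- A sequence which is weakly bounded in `L^k` is bounded in `L^k`. -/
theorem exists_integral_abs_pow_le {m : ℕ} {r : ℝ≥0∞}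
    [hr : ENNReal.HolderConjugate ((m + 1 : ℕ) : ℝ≥0∞) r] {a : ℕ → X → ℝ}
    (ha : ∀ j, MemLp (a j) ((m + 1 : ℕ) : ℝ≥0∞) μ)
    (hb : ∀ f : X → ℝ, MemLp f r μ → ∃ C, ∀ j, |∫ x, a j x * f x ∂μ| ≤ C) :
    ∃ C, ∀ j, ∫ x, |a j x| ^ (m + 1) ∂μ ≤ C := by
  have : Fact (1 ≤ ((m + 1 : ℕ) : ℝ≥0∞)) := ⟨by exact_mod_cast Nat.le_add_left 1 m⟩
  have : Fact (1 ≤ r) := ⟨ENNReal.HolderConjugate.one_le r ((m + 1 : ℕ) : ℝ≥0∞)⟩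
  set B := (ContinuousLinearMap.mul ℝ ℝ).lpPairing μ ((m + 1 : ℕ) : ℝ≥0∞) r with hB
  set T : ℕ → Lp ℝ r μ →L[ℝ] ℝ := fun j => B ((ha j).toLp (a j)) with hT
  have hTa : ∀ j, ∀ f : X → ℝ, ∀ hf : MemLp f r μ, T j (hf.toLp f) = ∫ x, a j x * f x ∂μ := by
    intro j f hf
    rw [hT, hB, ContinuousLinearMap.lpPairing_eq_integral]
    refine integral_congr_ae ?_
    filter_upwards [(ha j).coeFn_toLp, hf.coeFn_toLp] with x h1 h2
    rw [h1, h2]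
    rfl
  -- Each `a j` is regarded as a functional on the complete space `L^r`; pointwise boundedness
  -- implies a uniform bound on the operator norms.
  obtain ⟨C, hC⟩ := banach_steinhaus (g := T) fun f => by
    obtain ⟨C, hC⟩ := hb f (Lp.memLp f)
    refine ⟨C, fun j => ?_⟩
    rw [← Lp.toLp_coeFn f (Lp.memLp f), hTa]
    exact hC j
  refine ⟨C ^ (m + 1), fun j => ?_⟩
  have hC0 : 0 ≤ C := (norm_nonneg _).trans (hC 0)
  set N := (eLpNorm (a j) ((m + 1 : ℕ) : ℝ≥0∞) μ).toReal with hN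
  have hN0 : 0 ≤ N := ENNReal.toReal_nonneg
  have hfm : AEStronglyMeasurable (fun x => (SignType.sign (a j x) : ℝ) * |a j x| ^ m) μ := by
    refine AEStronglyMeasurable.mul ?_ ((ha j).1.norm.pow m)
    have h1 : Measurable fun t : ℝ => (SignType.sign t : ℝ) := by
      have : (fun t : ℝ => (SignType.sign t : ℝ))
          = fun t => if 0 < t then 1 else if t < 0 then -1 else 0 := by
        ext t
        rw [sign_apply]
        split_ifs <;> simp
      rw [this]
      exact Measurable.ite measurableSet_Ioi measurable_const
        (Measurable.ite measurableSet_Iio measurable_const measurable_const)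
    exact (h1.comp_aemeasurable (ha j).1.aemeasurable).aestronglyMeasurable
  have hle := eLpNorm_sign_mul_pow_le (μ := μ) m r (a j)
  have hfin : eLpNorm (a j) ((m + 1 : ℕ) : ℝ≥0∞) μ ^ m ≠ ⊤ := ENNReal.pow_ne_top (ha j).2.ne
  have hf : MemLp (fun x => (SignType.sign (a j x) : ℝ) * |a j x| ^ m) r μ :=
    ⟨hfm, hle.trans_lt hfin.lt_top⟩
  have h1 : T j (hf.toLp _) = ∫ x, |a j x| ^ (m + 1) ∂μ := by
    rw [hTa]
    refine integral_congr_ae (ae_of_all _ fun x => ?_)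
    show a j x * (SignType.sign (a j x) * |a j x| ^ m) = |a j x| ^ (m + 1)
    rw [← mul_assoc, self_mul_sign, pow_succ']
  have h2 : ∫ x, |a j x| ^ (m + 1) ∂μ = N ^ (m + 1) := by
    have h3 := (ha j).eLpNorm_eq_integral_rpow_norm (by simp) (by simp)
    rw [hN, h3, ENNReal.toReal_ofReal (by positivity), ENNReal.toReal_natCast,
      Real.rpow_inv_natCast_pow (by positivity) (by simp)]
    simp only [Real.norm_eq_abs, Real.rpow_natCast]
  -- Testing against the extremal function, whose norm is at most `N ^ m`, yields `N ^ (m + 1) ≤ C N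
  -- ^ m`, hence `N ≤ C`.
  have h4 : N ^ (m + 1) ≤ C * N ^ m := by
    rw [← h2, ← h1]
    refine (le_abs_self _).trans ((T j).le_of_opNorm_le (hC j) _ |>.trans ?_)
    refine mul_le_mul_of_nonneg_left ?_ hC0
    rw [Lp.norm_toLp, hN, ← ENNReal.toReal_pow]
    exact ENNReal.toReal_mono hfin hle
  rw [h2]
  refine pow_le_pow_left₀ hN0 ?_ _
  rcases hN0.eq_or_lt with h | h
  · rw [← h]; exact hC0
  · exact le_of_mul_le_mul_right (by rwa [pow_succ'] at h4) (pow_pos h m)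

end UniformBoundedness

end

/-! ### Test fields that isolate one coordinate component of a tensor. -/

section

set_option maxSynthPendingDepth 3

section TestFields

variable {n : ℕ} {H : Type*} [TopologicalSpace H] {I : ModelWithCorners ℝ (Eucl n) H}
  {M : Type*} [TopologicalSpace M] [ChartedSpace H M] [IsManifold I ∞ M]
  (g : ContMDiffRiemannianMetric I ∞ (Eucl n) (TangentSpace I (M := M)))

theorem eq_sum_smulRight (A : Eucl n →L[ℝ] Eucl n →L[ℝ] ℝ) :
    A = ∑ i, ∑ j, A (basisVec i) (basisVec j) •
      (EuclideanSpace.proj i : Eucl n →L[ℝ] ℝ).smulRight (EuclideanSpace.proj j : Eucl n →L[ℝ] ℝ) := by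
  ext v w
  conv_lhs => rw [eq_sum_basisVec v, eq_sum_basisVec w]
  simp only [map_sum, map_smul, sum_apply, smul_apply, smul_eq_mul, Finset.mul_sum,
    ContinuousLinearMap.smulRight_apply, EuclideanSpace.coe_proj]
  rw [Finset.sum_comm]
  exact Finset.sum_congr rfl fun i _ => Finset.sum_congr rfl fun j _ => by ring

/-- The component along two coordinate directions of the chart at `x`, as a function on `M`
supported in `Q`. -/
noncomputable def component (Q : Set M) (x : M) (v w : Eucl n) (B : BilinField I M) (p : M) : ℝ :=
  Q.indicator (fun p => rawBilin B p (frame I x (extChartAt I x p) v)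
    (frame I x (extChartAt I x p) w)) p

/-- The field of bilinear forms dual to the component along two coordinate directions. -/
noncomputable def dualField (Q : Set M) (x : M) (v w : Eucl n) (f : M → ℝ) : BilinField I M :=
  fun p => (Q.indicator f p) • dualForm (rawBilin g.inner p) (frame I x (extChartAt I x p) v)
    (frame I x (extChartAt I x p) w)

variable {Q : Set M} {x : M} (v w : Eucl n)

theorem component_of_mem (B : BilinField I M) {p : M} (hp : p ∈ Q) (hQ : Q ⊆ (extChartAt I x).source) :
    component Q x v w B p = coordBilin I B x (extChartAt I x p) v w := by
  rw [component, indicator_of_mem hp, coordBilin_apply, (extChartAt I x).left_inv (hQ hp)]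

/-- Pairing with the dual field multiplies a single component by `f`, which reduces weak boundedness
of tensor fields to that of scalar functions. -/
theorem bilinInner_dualField (B : BilinField I M) (f : M → ℝ) (p : M) :
    bilinInner I g p (B p) (dualField g Q x v w f p) = component Q x v w B p * f p := by
  rw [bilinInner_eq_formInner g B (dualField g Q x v w f)]
  have h1 : rawBilin (dualField g Q x v w f) p = (Q.indicator f p) •
    dualForm (rawBilin g.inner p) (frame I x (extChartAt I x p) v)
      (frame I x (extChartAt I x p) w) := rfl
  have h2 : ∀ (G A T : Eucl n →L[ℝ] Eucl n →L[ℝ] ℝ) (c : ℝ),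
      formInner G A (c • T) = c * formInner G A T := by
    intro G A T c
    simp only [formInner, smul_apply, map_smul, smul_eq_mul, Finset.mul_sum]
  rw [h1, h2, formInner_dualForm (isPosForm_rawBilin g p), component]
  by_cases hp : p ∈ Q
  · rw [indicator_of_mem hp, indicator_of_mem hp, mul_comm]
  · simp [hp]

theorem bilinInner_dualField_self (f : M → ℝ) (p : M) :
    bilinInner I g p (dualField g Q x v w f p) (dualField g Q x v w f p)
      = component Q x v v g.inner p * component Q x w w g.inner p * f p ^ 2 := by
  rw [bilinInner_dualField]
  by_cases hp : p ∈ Q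
  · simp only [component, indicator_of_mem hp]
    have : rawBilin (dualField g Q x v w f) p = (f p) •
        dualForm (rawBilin g.inner p) (frame I x (extChartAt I x p) v)
          (frame I x (extChartAt I x p) w) := by
      show (Q.indicator f p) • _ = _
      rw [indicator_of_mem hp]
    rw [this]
    simp only [dualForm, smul_apply, ContinuousLinearMap.smulRight_apply, smul_eq_mul]
    ring
  · simp [component, hp]

variable [MeasurableSpace M] [BorelSpace M] [T2Space M] [CompactSpace M] {v w}

theorem continuousOn_component (hQ : Q ⊆ (extChartAt I x).source) :
    ContinuousOn (component Q x v w g.inner) Q := by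
  refine ContinuousOn.congr (f := fun p => coordBilin I g.inner x (extChartAt I x p) v w) ?_
    fun p hp => component_of_mem v w _ hp hQ
  exact ((((continuousOn_coordBilin g x).comp (continuousOn_extChartAt x) fun p hp =>
    (extChartAt I x).map_source hp).clm_apply continuousOn_const).clm_apply
      continuousOn_const).mono hQ

theorem aestronglyMeasurable_component_inner (hQm : MeasurableSet Q) (hQ : Q ⊆ (extChartAt I x).source) :
    AEStronglyMeasurable (component Q x v w g.inner) (riemannianVolume I g) := by
  have h : component Q x v w g.inner = Q.indicator (component Q x v w g.inner) := by
    ext p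
    by_cases hp : p ∈ Q <;> simp [component, hp]
  rw [h, aestronglyMeasurable_indicator_iff hQm]
  exact ((continuousOn_component g hQ).aemeasurable hQm).aestronglyMeasurable

theorem aestronglyMeasurable_component {k : ℝ≥0∞} {B : BilinField I M} (hB : MemLpBilin I g k B)
    (hQm : MeasurableSet Q) (hQ : Q ⊆ (extChartAt I x).source) :
    AEStronglyMeasurable (component Q x v w B) (riemannianVolume I g) := by
  have h1 : AEStronglyMeasurable (fun p => coordBilin I B x (extChartAt I x p) v w)
      (chartVolume I g x) := by
    rw [aestronglyMeasurable_chartVolume_iff]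
    refine (hB.aestronglyMeasurable_apply x v w).congr ?_
    filter_upwards [ae_restrict_mem (isOpen_chartInterior x).measurableSet] with y hy
    rw [(extChartAt I x).right_inv (chartInterior_subset_target x hy)]
  have h : component Q x v w B
      = Q.indicator (fun p => coordBilin I B x (extChartAt I x p) v w) := by
    ext p
    by_cases hp : p ∈ Q
    · rw [component_of_mem v w B hp hQ, indicator_of_mem hp]
    · simp [component, hp]
  rw [h, aestronglyMeasurable_indicator_iff hQm]
  rw [← restrict_riemannianVolume] at h1
  exact h1.mono_measure (Measure.restrict_mono hQ le_rfl)

theorem memLp_component {k : ℝ≥0∞} {B : BilinField I M} (hB : MemLpBilin I g k B)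
    (hQm : IsCompact Q) (hQm' : MeasurableSet Q) (hQ : Q ⊆ (extChartAt I x).source) :
    MemLp (component Q x v w B) k (riemannianVolume I g) := by
  obtain ⟨C, hC⟩ := hQm.exists_bound_of_continuousOn
    (((Real.continuous_sqrt.comp_continuousOn (continuousOn_component g (v := v) (w := v) hQ))).mul
      (Real.continuous_sqrt.comp_continuousOn (continuousOn_component g (v := w) (w := w) hQ)))
  refine hB.2.of_le_mul (c := max C 0) (aestronglyMeasurable_component g hB hQm' hQ)
    (ae_of_all _ fun p => ?_)
  rw [Real.norm_eq_abs, Real.norm_eq_abs, abs_of_nonneg (Real.sqrt_nonneg _)]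
  by_cases hp : p ∈ Q
  · have h1 := abs_apply_apply_le (isPosForm_rawBilin g p) (rawBilin B p)
      (frame I x (extChartAt I x p) v) (frame I x (extChartAt I x p) w)
    have h2 := (le_abs_self _).trans (hC p hp)
    simp only [Pi.mul_apply, Function.comp_apply, component, indicator_of_mem hp] at h2 ⊢
    rw [bilinInner_eq_formInner, mul_comm]
    exact h1.trans (mul_le_mul_of_nonneg_left (h2.trans (le_max_left _ _)) (Real.sqrt_nonneg _))
  · simp only [component, indicator_of_notMem hp, abs_zero]
    exact mul_nonneg (le_max_right _ _) (Real.sqrt_nonneg _)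

theorem coordBilin_dualField (f : M → ℝ) {x' : M} {y : Eucl n} (hy : y ∈ overlap I x' x)
    (v' w' : Eucl n) : coordBilin I (dualField g Q x v w f) x' y v' w'
      = Q.indicator f ((extChartAt I x').symm y) *
        (coordBilin I g.inner x (transition I x' x y) v (fderiv ℝ (transition I x' x) y v') *
          coordBilin I g.inner x (transition I x' x y) w (fderiv ℝ (transition I x' x) y w')) := by
  rw [coordBilin_apply, coordBilin_apply, coordBilin_apply, symm_transition hy, frame_eq hy]
  rfl

/-- Measurability is required in every chart. On the overlap with the chart at `x` the transition
formula expresses the field by `f` and continuous functions; elsewhere the field vanishes, because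
`Q` lies in the chart at `x`. -/
theorem aestronglyMeasurable_dualField {r : ℝ≥0∞} (hQm : MeasurableSet Q)
    (hQ : Q ⊆ (extChartAt I x).source) {f : M → ℝ} (hf : MemLp f r (riemannianVolume I g)) (x' : M) :
    AEStronglyMeasurable (coordBilin I (dualField g Q x v w f) x')
      (volume.restrict (extChartAt I x').target) := by
  have key : ∀ i j : Fin n, AEStronglyMeasurable
      (fun y => coordBilin I (dualField g Q x v w f) x' y (basisVec i) (basisVec j))
      (volume.restrict (chartInterior I x')) := by
    intro i j
    have ho := (isOpen_overlap (I := I) x' x).measurableSet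
    have h1 : AEStronglyMeasurable (fun y => Q.indicator f ((extChartAt I x').symm y) *
        (coordBilin I g.inner x (transition I x' x y) v
            (fderiv ℝ (transition I x' x) y (basisVec i)) *
          coordBilin I g.inner x (transition I x' x y) w
            (fderiv ℝ (transition I x' x) y (basisVec j))))
        (volume.restrict (overlap I x' x)) := by
      refine AEStronglyMeasurable.mul ?_ ?_
      · have h2 : AEStronglyMeasurable (Q.indicator f) (chartVolume I g x') := by
          rw [← restrict_riemannianVolume]
          exact (hf.1.indicator hQm).restrict
        exact ((aestronglyMeasurable_chartVolume_iff g x').1 h2).mono_measure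
          (Measure.restrict_mono inter_subset_left le_rfl)
      · have h3 : ContinuousOn (fun y => coordBilin I g.inner x (transition I x' x y))
            (overlap I x' x) :=
          (continuousOn_coordBilin g x).comp (contDiffOn_transition x' x).continuousOn
            fun y hy => transition_mem_target hy
        have h4 : ContinuousOn (fderiv ℝ (transition I x' x)) (overlap I x' x) :=
          (contDiffOn_transition x' x).continuousOn_fderiv_of_isOpen (isOpen_overlap x' x) (by simp)
        exact ContinuousOn.aestronglyMeasurable
          (((h3.clm_apply continuousOn_const).clm_apply (h4.clm_apply continuousOn_const)).mul
          ((h3.clm_apply continuousOn_const).clm_apply (h4.clm_apply continuousOn_const))) ho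
    have h5 := (aestronglyMeasurable_indicator_iff ho).2 h1
    refine (h5.mono_measure Measure.restrict_le_self).congr ?_
    filter_upwards [ae_restrict_mem (isOpen_chartInterior x').measurableSet] with y hy
    by_cases hyo : y ∈ overlap I x' x
    · rw [indicator_of_mem hyo, coordBilin_dualField g f hyo]
    · have hyQ : (extChartAt I x').symm y ∉ Q := fun h => hyo ⟨hy, hQ h⟩
      rw [indicator_of_notMem hyo, coordBilin_apply]
      have : rawBilin (dualField g Q x v w f) ((extChartAt I x').symm y) = 0 := by
        show (Q.indicator f _) • _ = _
        rw [indicator_of_notMem hyQ, zero_smul]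
      rw [this]
      rfl
  rw [restrict_target]
  have h6 : coordBilin I (dualField g Q x v w f) x' = fun y => ∑ i : Fin n, ∑ j : Fin n,
      coordBilin I (dualField g Q x v w f) x' y (basisVec i) (basisVec j) •
      (EuclideanSpace.proj i : Eucl n →L[ℝ] ℝ).smulRight (EuclideanSpace.proj j : Eucl n →L[ℝ] ℝ) :=
    funext fun y => eq_sum_smulRight _
  rw [h6]
  exact Finset.aestronglyMeasurable_fun_sum _ fun i _ =>
    Finset.aestronglyMeasurable_fun_sum _ fun j _ => (key i j).smul_const _

theorem memLpBilin_dualField {r : ℝ≥0∞} (hQc : IsCompact Q) (hQm : MeasurableSet Q)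
    (hQ : Q ⊆ (extChartAt I x).source) {f : M → ℝ} (hf : MemLp f r (riemannianVolume I g)) :
    MemLpBilin I g r (dualField g Q x v w f) := by
  refine ⟨aestronglyMeasurable_dualField g hQm hQ hf, ?_⟩
  obtain ⟨C, hC⟩ := hQc.exists_bound_of_continuousOn
    (Real.continuous_sqrt.comp_continuousOn ((continuousOn_component g (v := v) (w := v) hQ).mul
      (continuousOn_component g (v := w) (w := w) hQ)))
  simp only [bilinInner_dualField_self]
  refine hf.of_le_mul (c := max C 0) ?_ (ae_of_all _ fun p => ?_)
  · exact Real.continuous_sqrt.comp_aestronglyMeasurable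
      (((aestronglyMeasurable_component_inner g hQm hQ).mul
        (aestronglyMeasurable_component_inner g hQm hQ)).mul (hf.1.pow 2))
  · rw [Real.norm_eq_abs, abs_of_nonneg (Real.sqrt_nonneg _), Real.sqrt_mul' _ (sq_nonneg _),
      Real.sqrt_sq_eq_abs, Real.norm_eq_abs]
    refine mul_le_mul_of_nonneg_right ?_ (abs_nonneg _)
    by_cases hp : p ∈ Q
    · exact ((le_abs_self _).trans (hC p hp)).trans (le_max_left _ _)
    · simp [component, hp]

end TestFields

end

/-! ### Uniform `L^k` bounds for Hessians in charts. -/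

section

set_option maxSynthPendingDepth 3

section Bounds

variable {n : ℕ} {H : Type*} [TopologicalSpace H] {I : ModelWithCorners ℝ (Eucl n) H}
  {M : Type*} [TopologicalSpace M] [ChartedSpace H M] [IsManifold I ∞ M]

theorem coordDeriv_eq_fderiv (u : M → ℝ) {x : M} {y : Eucl n} (hy : y ∈ chartInterior I x) :
    coordDeriv I u x y = fderiv ℝ (fun z => u ((extChartAt I x).symm z)) y :=
  fderivWithin_of_mem_nhds (range_mem_nhds hy)

theorem continuousOn_coordDeriv {u : M → ℝ} (hu : ContMDiff I 𝓘(ℝ, ℝ) 1 u) (x : M) :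
    ContinuousOn (coordDeriv I u x) (extChartAt I x).target := by
  intro y hy
  have h1 : ContDiffWithinAt ℝ 1 (fun z => u ((extChartAt I x).symm z)) (range I) y :=
    (contDiffOn_comp_symm hu x y hy).mono_of_mem_nhdsWithin (extChartAt_target_mem_nhdsWithin_of_mem hy)
  exact (h1.fderivWithin_right I.uniqueDiffOn (m := 0) (by simp)
    (extChartAt_target_subset_range x hy)).continuousWithinAt.mono (extChartAt_target_subset_range x)

variable {g : ContMDiffRiemannianMetric I ∞ (Eucl n) (TangentSpace I (M := M))}
  [MeasurableSpace M] [BorelSpace M] [T2Space M] [CompactSpace M] {k : ℕ}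

/-- The coordinate components of a weakly bounded sequence of fields of bilinear forms are bounded
in `L^k` on compact parts of charts. -/
theorem exists_integral_coordBilin_pow_le (hk : 1 ≤ k) {r : ℝ≥0∞}
    (hr : ENNReal.HolderConjugate (k : ℝ≥0∞) r) {B : ℕ → BilinField I M}
    (hB : ∀ j, MemLpBilin I g k (B j))
    (hb : ∀ T : BilinField I M, MemLpBilin I g r T →
      ∃ C, ∀ j, |∫ p, bilinInner I g p (B j p) (T p) ∂riemannianVolume I g| ≤ C)
    {x : M} {K : Set (Eucl n)} (hK : IsCompact K) (hKt : K ⊆ (extChartAt I x).target)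
    (v w : Eucl n) :
    ∃ C, ∀ j, ∫ y in K ∩ chartInterior I x, |coordBilin I (B j) x y v w| ^ k ≤ C := by
  obtain ⟨m, rfl⟩ : ∃ m, k = m + 1 := ⟨k - 1, by omega⟩
  -- The compact part `K` of the chart carried to the manifold, where the test fields are supported.
  set Q := (extChartAt I x).symm '' K with hQdef
  have hQc : IsCompact Q := hK.image_of_continuousOn ((continuousOn_extChartAt_symm x).mono hKt)
  have hQm := hQc.isClosed.measurableSet
  have hQ : Q ⊆ (extChartAt I x).source := by
    rintro _ ⟨y, hy, rfl⟩
    exact (extChartAt I x).map_target (hKt hy)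
  have ha : ∀ j, MemLp (component Q x v w (B j)) ((m + 1 : ℕ) : ℝ≥0∞) (riemannianVolume I g) :=
    fun j => memLp_component g (hB j) hQc hQm hQ
  obtain ⟨C, hC⟩ := exists_integral_abs_pow_le (r := r) ha fun f hf => by
    obtain ⟨C, hC⟩ := hb _ (memLpBilin_dualField g hQc hQm hQ (v := v) (w := w) hf)
    exact ⟨C, fun j => by simpa only [bilinInner_dualField] using hC j⟩
  obtain ⟨C', hC'0, hC'⟩ := exists_integral_comp_symm_le g hK hKt
  refine ⟨C' * C, fun j => ?_⟩
  have hi : Integrable (fun p => |component Q x v w (B j) p| ^ (m + 1)) (riemannianVolume I g) := by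
    simpa only [Real.norm_eq_abs] using (ha j).integrable_norm_pow (by simp)
  have h1 := (hC' _ hi).2
  have h2 : ∫ y in K ∩ chartInterior I x, |coordBilin I (B j) x y v w| ^ (m + 1)
      = ∫ y in K ∩ chartInterior I x,
        |(|component Q x v w (B j) ((extChartAt I x).symm y)| ^ (m + 1))| := by
    refine setIntegral_congr_fun (hK.measurableSet.inter (isOpen_chartInterior x).measurableSet)
      fun y hy => ?_
    have hyQ : (extChartAt I x).symm y ∈ Q := mem_image_of_mem _ hy.1
    beta_reduce
    rw [component_of_mem v w _ hyQ hQ, (extChartAt I x).right_inv (hKt hy.1), abs_pow,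
      abs_abs]
  rw [h2]
  refine h1.trans (mul_le_mul_of_nonneg_left ?_ hC'0)
  simpa only [abs_pow, abs_abs] using hC j

theorem exists_forall_le_of_eventually_le {a : ℕ → ℝ} {C : ℝ} (h : ∀ᶠ j in atTop, a j ≤ C) :
    ∃ C', ∀ j, a j ≤ C' := by
  have h1 : IsBoundedUnder (· ≤ ·) atTop a := ⟨C, by simpa using h⟩
  obtain ⟨C', hC'⟩ := h1.bddAbove_range
  exact ⟨C', fun j => hC' ⟨j, rfl⟩⟩

/-- The Hessians, in a chart, of a sequence which converges in `C¹` and weakly in `W^{2,k}` are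
bounded in `L^k`. -/
theorem exists_integral_hess_pow_le (hk : 1 ≤ k) {α : ℝ} {v : ℕ → M → ℝ} {u : M → ℝ}
    (hv : ∀ j, ContMDiff I 𝓘(ℝ, ℝ) ∞ (v j)) (hu : ContMDiff I 𝓘(ℝ, ℝ) 1 u)
    (hconv : TendstoC1Holder I α v u) (hweak : TendstoWeaklyW2 I g k v u)
    {x : M} {K : Set (Eucl n)} (hK : IsCompact K) (hKt : K ⊆ (extChartAt I x).target) :
    (∀ j, IntegrableOn (fun y => ‖hess (fun z => v j ((extChartAt I x).symm z)) y‖ ^ k)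
      (K ∩ chartInterior I x)) ∧
    ∃ C, ∀ j, ∫ y in K ∩ chartInterior I x,
      ‖hess (fun z => v j ((extChartAt I x).symm z)) y‖ ^ k ≤ C := by
  obtain ⟨hvW, ⟨du, Hu, hHu⟩, hw⟩ := hweak
  choose dv Hv hHv using hvW
  set V := chartInterior I x with hV
  have hVm : MeasurableSet V := (isOpen_chartInterior x).measurableSet
  have hae : ∀ j, ∀ᵐ y ∂volume.restrict (K ∩ V), ‖coordHess g (dv j) (Hv j) x y‖ ^ k
      = ‖hess (fun z => v j ((extChartAt I x).symm z)) y‖ ^ k := fun j => by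
    filter_upwards [ae_mono (Measure.restrict_mono inter_subset_right le_rfl)
      ((hHv j).coordHess_ae hk (hv j) x)] with y hy
    rw [hy]
  refine ⟨fun j => ((hHv j).integrableOn_coordHess_pow hk hK hKt).congr (hae j), ?_⟩
  have hr := ENNReal.HolderConjugate.conjExponent (p := (k : ℝ≥0∞)) (by exact_mod_cast hk)
  -- Convergence of the pairings with each test field is used only through their boundedness.
  have hb : ∀ T : BilinField I M, MemLpBilin I g (ENNReal.conjExponent k) T →
      ∃ C, ∀ j, |∫ p, bilinInner I g p (Hv j p) (T p) ∂riemannianVolume I g| ≤ C := fun T hT => by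
    obtain ⟨C, hC⟩ := ((hw dv Hv du Hu hHv hHu _ hr).2.2 T hT).abs.bddAbove_range
    exact ⟨C, fun j => hC ⟨j, rfl⟩⟩
  choose A hA using fun a b : Fin n => exists_integral_coordBilin_pow_le hk hr
    (fun j => (hHv j).memLp_hess) hb hK hKt (basisVec b) (basisVec a)
  obtain ⟨D, hD⟩ := hK.exists_bound_of_continuousOn ((continuousOn_coordDeriv hu x).mono hKt)
  choose G hG using fun a b : Fin n => hK.exists_bound_of_continuousOn
    ((continuousOn_christoffel g x (basisVec b) (basisVec a)).mono hKt)
  refine exists_forall_le_of_eventually_le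
    (C := ∑ a, ∑ b, 2 ^ (k - 1) * (A a b + ((1 + D) * G a b) ^ k * volume.real (K ∩ V))) ?_
  -- For large `j` the gradients on `K` are within one of the limit gradient, which bounds the
  -- Christoffel part of the Hessian; the finitely many remaining indices are absorbed by a larger
  -- constant.
  filter_upwards [hconv x K hK hKt 1 one_pos] with j hj
  rw [← integral_congr_ae (hae j)]
  have hi1 : ∀ a b, IntegrableOn
      (fun y => |coordBilin I (Hv j) x y (basisVec b) (basisVec a)| ^ k) (K ∩ V) := fun a b =>
    (hHv j).memLp_hess.integrableOn_pow hk hK hKt _ _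
  have hi2 : ∀ a b : Fin n, IntegrableOn (fun y => |coordCov I (dv j) x y (christoffel
      (coordBilin I g.inner x) (range I) y (basisVec b) (basisVec a))| ^ k) (K ∩ V) := fun a b =>
    (hHv j).memLp_grad.integrableOn_pow hk hK hKt (continuousOn_christoffel g x _ _)
  have hfin : volume (K ∩ V) ≠ ⊤ := ((measure_mono inter_subset_left).trans_lt hK.measure_lt_top).ne
  have hb2 : ∀ a b : Fin n, ∫ y in K ∩ V, |coordCov I (dv j) x y (christoffel
      (coordBilin I g.inner x) (range I) y (basisVec b) (basisVec a))| ^ k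
      ≤ ((1 + D) * G a b) ^ k * volume.real (K ∩ V) := fun a b => by
    have h1 : ∀ᵐ y ∂volume.restrict (K ∩ V), |coordCov I (dv j) x y (christoffel
        (coordBilin I g.inner x) (range I) y (basisVec b) (basisVec a))| ^ k
        ≤ ((1 + D) * G a b) ^ k := by
      filter_upwards [ae_mono (Measure.restrict_mono inter_subset_right le_rfl)
        ((hHv j).coordCov_ae hk ((hv j).of_le (by exact_mod_cast le_top)) x),
        ae_restrict_mem (hK.measurableSet.inter hVm)] with y hy hyK
      rw [hy, ← coordDeriv_eq_fderiv _ hyK.2]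
      refine pow_le_pow_left₀ (abs_nonneg _) ?_ k
      have h2 : ‖coordDeriv I (v j) x y‖ ≤ 1 + D := by
        have := norm_add_le (coordDeriv I (v j) x y - coordDeriv I u x y) (coordDeriv I u x y)
        rw [sub_add_cancel] at this
        exact this.trans (add_le_add (hj.2.1 y hyK.1) (hD y hyK.1))
      exact ((coordDeriv I (v j) x y).le_opNorm _).trans
        (mul_le_mul h2 (hG a b y hyK.1) (norm_nonneg _) ((norm_nonneg _).trans h2))
    have h3 := integral_mono_ae (hi2 a b) (integrableOn_const hfin) h1
    rwa [setIntegral_const, smul_eq_mul, mul_comm] at h3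
  have hi3 : ∀ a b : Fin n, IntegrableOn (fun y => 2 ^ (k - 1) *
      (|coordBilin I (Hv j) x y (basisVec b) (basisVec a)| ^ k
        + |coordCov I (dv j) x y (christoffel (coordBilin I g.inner x) (range I) y
          (basisVec b) (basisVec a))| ^ k)) (K ∩ V) := fun a b =>
    ((hi1 a b).add (hi2 a b)).const_mul _
  calc ∫ y in K ∩ V, ‖coordHess g (dv j) (Hv j) x y‖ ^ k
      ≤ ∫ y in K ∩ V, ∑ a, ∑ b, 2 ^ (k - 1) *
        (|coordBilin I (Hv j) x y (basisVec b) (basisVec a)| ^ k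
          + |coordCov I (dv j) x y (christoffel (coordBilin I g.inner x) (range I) y
            (basisVec b) (basisVec a))| ^ k) :=
        integral_mono ((hHv j).integrableOn_coordHess_pow hk hK hKt)
          (integrable_finsetSum _ fun a _ => integrable_finsetSum _ fun b _ => hi3 a b)
          fun y => norm_coordHess_pow_le hk _ _ x y
    _ = ∑ a, ∑ b, 2 ^ (k - 1) *
        ((∫ y in K ∩ V, |coordBilin I (Hv j) x y (basisVec b) (basisVec a)| ^ k)
          + ∫ y in K ∩ V, |coordCov I (dv j) x y (christoffel (coordBilin I g.inner x) (range I) y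
            (basisVec b) (basisVec a))| ^ k) := by
        rw [integral_finsetSum _ fun a _ => integrable_finsetSum _ fun b _ => hi3 a b]
        refine Finset.sum_congr rfl fun a _ => ?_
        rw [integral_finsetSum _ fun b _ => hi3 a b]
        refine Finset.sum_congr rfl fun b _ => ?_
        rw [integral_const_mul, integral_add (hi1 a b) (hi2 a b)]
    _ ≤ _ := Finset.sum_le_sum fun a _ => Finset.sum_le_sum fun b _ =>
        mul_le_mul_of_nonneg_left (add_le_add (hA a b j) (hb2 a b)) (by positivity)

end Bounds

end

/-! ### Uniform convergence of coefficients and the integrand in a chart. -/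

section

set_option maxSynthPendingDepth 3

section UniformConvergence

variable {X Y : Type*} [TopologicalSpace X]

/-- Composition with a continuous function preserves uniform convergence on compact sets to a
continuous limit. -/
theorem tendstoUniformlyOn_comp_of_isCompact [TopologicalSpace Y] {K : Set X} (hK : IsCompact K)
    {Ω : Set Y} {Φ : Y → ℝ} (hΦ : ContinuousOn Φ Ω) {q : X → Y} {Q : ℕ → X → Y}
    (hqΩ : MapsTo q K Ω) (hQΩ : ∀ j, MapsTo (Q j) K Ω) (hq : ContinuousOn q K)
    (hQ : ∀ x ∈ K, Tendsto (fun z : ℕ × X => Q z.1 z.2) (atTop ×ˢ 𝓝[K] x) (𝓝 (q x))) :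
    TendstoUniformlyOn (fun j x => Φ (Q j x)) (fun x => Φ (q x)) atTop K := by
  rw [← tendstoLocallyUniformlyOn_iff_tendstoUniformlyOn_of_compact hK,
    tendstoLocallyUniformlyOn_iff_forall_tendsto]
  intro x hx
  have hsnd : Tendsto (Prod.snd : ℕ × X → X) (atTop ×ˢ 𝓝[K] x) (𝓝[K] x) := tendsto_snd
  have hmem : ∀ᶠ z : ℕ × X in atTop ×ˢ 𝓝[K] x, z.2 ∈ K :=
    hsnd.eventually self_mem_nhdsWithin
  have h1 : Tendsto (fun z : ℕ × X => Φ (q z.2)) (atTop ×ˢ 𝓝[K] x) (𝓝 (Φ (q x))) :=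
    Tendsto.comp (hΦ (q x) (hqΩ hx)) (tendsto_nhdsWithin_iff.2 ⟨(hq x hx).tendsto.comp hsnd,
      hmem.mono fun z hz => hqΩ hz⟩)
  have h2 : Tendsto (fun z : ℕ × X => Φ (Q z.1 z.2)) (atTop ×ˢ 𝓝[K] x) (𝓝 (Φ (q x))) :=
    Tendsto.comp (hΦ (q x) (hqΩ hx)) (tendsto_nhdsWithin_iff.2 ⟨hQ x hx,
      hmem.mono fun z hz => hQΩ _ hz⟩)
  exact (h1.prodMk_nhds h2).mono_right (nhds_le_uniformity _)

theorem tendsto_of_uniform [PseudoMetricSpace Y] {K : Set X} {q : X → Y} {Q : ℕ → X → Y}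
    (hq : ContinuousOn q K) (h : ∀ ε : ℝ, 0 < ε → ∀ᶠ j in atTop, ∀ x ∈ K, dist (Q j x) (q x) ≤ ε)
    {x : X} (hx : x ∈ K) :
    Tendsto (fun z : ℕ × X => Q z.1 z.2) (atTop ×ˢ 𝓝[K] x) (𝓝 (q x)) := by
  rw [Metric.tendsto_nhds]
  intro ε hε
  have hsnd : Tendsto (Prod.snd : ℕ × X → X) (atTop ×ˢ 𝓝[K] x) (𝓝[K] x) := tendsto_snd
  filter_upwards [(h (ε / 2) (half_pos hε)).prod_inl (𝓝[K] x),
    hsnd.eventually self_mem_nhdsWithin,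
    hsnd.eventually ((Metric.tendsto_nhds.1 (hq x hx)) (ε / 2) (half_pos hε))] with z h1 h2 h3
  have := dist_triangle (Q z.1 z.2) (q z.2) (q x)
  linarith [h1 z.2 h2]

/-- Extension by zero of a function which is continuous on `T` and vanishes off a compact subset of
`T` and on `T \ V`, where `V` is open. -/
theorem continuous_indicator_of_eq_zero {V T S : Set X} (hV : IsOpen V) (hVT : V ⊆ T)
    (hS : IsClosed S) (hST : S ⊆ T) {c : X → ℝ} (hc : ContinuousOn c T)
    (h0 : ∀ y ∈ T, y ∉ V → c y = 0) (h0' : ∀ y ∈ T, y ∉ S → c y = 0) :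
    Continuous (V.indicator c) := by
  have hVc : ∀ y ∈ T, V.indicator c y = c y := fun y hy => by
    by_cases hyV : y ∈ V
    · exact indicator_of_mem hyV c
    · rw [indicator_of_notMem hyV, h0 y hy hyV]
  rw [continuous_iff_continuousAt]
  intro y
  by_cases hyV : y ∈ V
  · refine (hc.continuousAt (mem_of_superset (hV.mem_nhds hyV) hVT)).congr ?_
    filter_upwards [hV.mem_nhds hyV] with z hz
    exact (indicator_of_mem hz c).symm
  -- A point of `S` outside `V` may lie on the boundary of the chart; continuity there is glued from
  -- continuity within `T` and the zero function off `T`.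
  by_cases hyS : y ∈ S
  · have h1 : ContinuousWithinAt (V.indicator c) T y :=
      (hc y (hST hyS)).congr hVc (hVc y (hST hyS))
    have h2 : ContinuousWithinAt (V.indicator c) Tᶜ y :=
      (continuousWithinAt_const (b := (0 : ℝ))).congr
        (fun z hz => indicator_of_notMem (fun h => hz (hVT h)) c) (indicator_of_notMem hyV c)
    have h3 := h1.union h2
    rwa [union_compl_self, continuousWithinAt_univ] at h3
  · refine (continuousAt_const (y := (0 : ℝ))).congr ?_
    filter_upwards [hS.isOpen_compl.mem_nhds hyS] with z hz
    by_cases hzV : z ∈ V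
    · rw [indicator_of_mem hzV, h0' z (hVT hzV) hz]
    · rw [indicator_of_notMem hzV]

end UniformConvergence

section Local

variable {n : ℕ} {H : Type*} [TopologicalSpace H] {I : ModelWithCorners ℝ (Eucl n) H}
  {M : Type*} [TopologicalSpace M] [ChartedSpace H M] [IsManifold I ∞ M]
  (g : ContMDiffRiemannianMetric I ∞ (Eucl n) (TangentSpace I (M := M)))

/-- The coefficients of the local expansion of the integrand, as a function of the position, of the
value and of the differential of the conformal factor. -/
noncomputable def integrandCoef (x : M) (ψ : M → ℝ) (γ : ℝ) (S : Finset (Fin n))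
    (r : Fin n → Fin n ⊕ Fin n) (q : Eucl n × ℝ × (Eucl n →L[ℝ] ℝ)) : ℝ :=
  volDensity g x q.1 * ψ ((extChartAt I x).symm q.1) * q.2.1 ^ γ * sigmaCoef g x S r q

theorem continuousOn_integrandCoef (x : M) {ψ : M → ℝ} (hψ : Continuous ψ) (γ : ℝ)
    (S : Finset (Fin n)) (r : Fin n → Fin n ⊕ Fin n) :
    ContinuousOn (integrandCoef g x ψ γ S r) ((extChartAt I x).target ×ˢ Ioi 0 ×ˢ univ) := by
  have hm : MapsTo Prod.fst ((extChartAt I x).target ×ˢ Ioi (0 : ℝ) ×ˢ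
    (univ : Set (Eucl n →L[ℝ] ℝ))) (extChartAt I x).target := fun q hq => hq.1
  refine ((((continuousOn_volDensity g x).comp continuousOn_fst hm).mul ?_).mul ?_).mul
    (continuousOn_sigmaCoef g x S r)
  · exact hψ.comp_continuousOn ((continuousOn_extChartAt_symm x).comp continuousOn_fst hm)
  · exact ContinuousOn.rpow_const (by fun_prop) fun q hq => Or.inl (ne_of_gt hq.2.1)

/-- The one-jet of a function in the chart at `x`. -/
noncomputable def chartJet (u : M → ℝ) (x : M) (y : Eucl n) : Eucl n × ℝ × (Eucl n →L[ℝ] ℝ) :=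
  (y, u ((extChartAt I x).symm y), coordDeriv I u x y)

theorem continuousOn_chartJet {u : M → ℝ} (hu : ContMDiff I 𝓘(ℝ, ℝ) 1 u) (x : M) :
    ContinuousOn (chartJet (I := I) u x) (extChartAt I x).target :=
  continuousOn_id.prodMk ((contDiffOn_comp_symm hu x).continuousOn.prodMk
    (continuousOn_coordDeriv hu x))

theorem mapsTo_chartJet {u : M → ℝ} (hu : ∀ p, 0 < u p) (x : M) :
    MapsTo (chartJet (I := I) u x) (extChartAt I x).target
      ((extChartAt I x).target ×ˢ Ioi 0 ×ˢ univ) :=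
  fun _ hy => ⟨hy, hu _, mem_univ _⟩

variable {g} [MeasurableSpace M] [BorelSpace M] [T2Space M] [CompactSpace M] {k : ℕ}

/-- The part of the interior of the chart at `x` lying over `U`. -/
def chartPart (I : ModelWithCorners ℝ (Eucl n) H) (x : M) (U : Set M) : Set (Eucl n) :=
  chartInterior I x ∩ (extChartAt I x).symm ⁻¹' U

theorem isOpen_chartPart (x : M) {U : Set M} (hU : IsOpen U) : IsOpen (chartPart I x U) :=
  ((continuousOn_extChartAt_symm x).mono (chartInterior_subset_target x)).isOpen_inter_preimage
    (isOpen_chartInterior x) hU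

theorem chartPart_subset_image (x : M) {U : Set M} :
    chartPart I x U ⊆ extChartAt I x '' closure U := fun _ hy =>
  ⟨_, subset_closure hy.2, (extChartAt I x).right_inv (chartInterior_subset_target x hy.1)⟩

theorem isCompact_image_closure {x : M} {U : Set M} (hU : closure U ⊆ (extChartAt I x).source) :
    IsCompact (extChartAt I x '' closure U) :=
  isClosed_closure.isCompact.image_of_continuousOn ((continuousOn_extChartAt x).mono hU)

theorem image_closure_subset_target {x : M} {U : Set M}
    (hU : closure U ⊆ (extChartAt I x).source) :
    extChartAt I x '' closure U ⊆ (extChartAt I x).target := by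
  rintro _ ⟨p, hp, rfl⟩
  exact (extChartAt I x).map_source (hU hp)

/-- The integral of an expression which is polynomial in the second derivatives, in a chart. -/
theorem integral_eq_sum_of_tsupport_subset {x : M} {U : Set M} (hU : IsOpen U)
    (hUs : closure U ⊆ (extChartAt I x).source) {ψ : M → ℝ} (hψ : Continuous ψ)
    (hψU : tsupport ψ ⊆ U) (γ : ℝ) {u : M → ℝ} (hu : ContMDiff I 𝓘(ℝ, ℝ) 1 u) (hpos : ∀ p, 0 < u p)
    {F : M → ℝ} {A : Eucl n → Fin n → Fin n → ℝ}
    (hA : AEStronglyMeasurable A (volume.restrict (chartPart I x U)))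
    (hAk : IntegrableOn (fun y => ‖A y‖ ^ k) (chartPart I x U))
    (hF : ∀ᵐ y ∂volume.restrict (chartInterior I x), F ((extChartAt I x).symm y)
      = ∑ S ∈ Finset.univ.powersetCard k, ∑ r ∈ Finset.univ.filter (fun r => rowDeg r ≤ k),
          sigmaCoef g x S r (chartJet (I := I) u x y) * nullLagr r (A y)) :
    Integrable (fun p => u p ^ γ * F p * ψ p) (riemannianVolume I g) ∧
    ∫ p, u p ^ γ * F p * ψ p ∂riemannianVolume I g
      = ∑ S ∈ Finset.univ.powersetCard k, ∑ r ∈ Finset.univ.filter (fun r => rowDeg r ≤ k),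
        ∫ y in chartPart I x U,
          integrandCoef g x ψ γ S r (chartJet (I := I) u x y) * nullLagr r (A y) := by
  set V := chartInterior I x with hV
  set V' := chartPart I x U with hV'
  have hVm : MeasurableSet V := (isOpen_chartInterior x).measurableSet
  have hV'm : MeasurableSet V' := (isOpen_chartPart x hU).measurableSet
  set K := extChartAt I x '' closure U with hK
  have hKc : IsCompact K := isCompact_image_closure hUs
  have hKt : K ⊆ (extChartAt I x).target := image_closure_subset_target hUs
  have hV'K : V' ⊆ K := chartPart_subset_image x
  have hV'f : volume V' ≠ ⊤ := ((measure_mono hV'K).trans_lt hKc.measure_lt_top).ne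
  have hcc : ∀ S r, ContinuousOn (fun y => integrandCoef g x ψ γ S r (chartJet (I := I) u x y))
      (extChartAt I x).target := fun S r =>
    (continuousOn_integrandCoef g x hψ γ S r).comp (continuousOn_chartJet hu x)
      (mapsTo_chartJet hpos x)
  have hi : ∀ S, ∀ r ∈ Finset.univ.filter (fun r : Fin n → Fin n ⊕ Fin n => rowDeg r ≤ k),
      IntegrableOn (fun y => integrandCoef g x ψ γ S r (chartJet (I := I) u x y)
        * nullLagr r (A y)) V' := by
    intro S r hr
    obtain ⟨B, hB⟩ := hKc.exists_bound_of_continuousOn ((hcc S r).mono hKt)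
    exact (integrableOn_mul_nullLagr hV'm hV'f (Finset.mem_filter.1 hr).2 hA hAk
      (((hcc S r).mono (hV'K.trans hKt)).aestronglyMeasurable hV'm)
      fun y hy => hB y (hV'K hy)).1
  set P : Eucl n → ℝ := fun y => ∑ S ∈ Finset.univ.powersetCard k,
    ∑ r ∈ Finset.univ.filter (fun r => rowDeg r ≤ k),
      integrandCoef g x ψ γ S r (chartJet (I := I) u x y) * nullLagr r (A y) with hP
  have hPi : IntegrableOn P V' := integrable_finsetSum _ fun S _ => integrable_finsetSum _ (hi S)
  set f : M → ℝ := fun p => u p ^ γ * F p * ψ p with hf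
  have hψ0 : ∀ p ∉ U, ψ p = 0 := fun p hp => image_eq_zero_of_notMem_tsupport fun h => hp (hψU h)
  -- The test function is supported over `U`, so the expansion is needed only on the bounded set
  -- `V'`, where the `L^k` bound for `A` is available.
  have hae : ∀ᵐ y ∂volume.restrict V, V'.indicator P y
      = volDensity g x y * f ((extChartAt I x).symm y) := by
    filter_upwards [hF, ae_restrict_mem hVm] with y hy hyV
    by_cases hyU : y ∈ V'
    · rw [indicator_of_mem hyU, hP, hf]
      beta_reduce
      rw [hy]
      simp only [Finset.mul_sum, Finset.sum_mul, integrandCoef, chartJet]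
      exact Finset.sum_congr rfl fun S _ => Finset.sum_congr rfl fun r _ => by ring
    · rw [indicator_of_notMem hyU, hf]
      beta_reduce
      rw [hψ0 _ fun h => hyU ⟨hyV, h⟩]
      ring
  have hVV' : V' ⊆ V := inter_subset_left
  have hPV : IntegrableOn (V'.indicator P) V := by
    rw [IntegrableOn, integrable_indicator_iff hV'm, IntegrableOn, Measure.restrict_restrict hV'm,
      inter_eq_left.2 hVV']
    exact hPi
  have hfi : IntegrableOn (fun y => volDensity g x y * f ((extChartAt I x).symm y)) V :=
    hPV.congr hae
  have hfm : AEStronglyMeasurable f (chartVolume I g x) := by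
    rw [aestronglyMeasurable_chartVolume_iff]
    have h1 : AEStronglyMeasurable (fun y => (volDensity g x y)⁻¹) (volume.restrict V) :=
      ((((continuousOn_volDensity g x).mono (chartInterior_subset_target x)).inv₀ fun y hy =>
        (volDensity_pos g (chartInterior_subset_target x hy)).ne')).aestronglyMeasurable hVm
    refine (h1.mul hfi.aestronglyMeasurable).congr ?_
    filter_upwards [ae_restrict_mem hVm] with y hy
    have := (volDensity_pos g (chartInterior_subset_target x hy)).ne'
    simp only [Pi.mul_apply]
    field_simp
  have hsupp : Function.support f ⊆ (extChartAt I x).source := by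
    intro p hp
    refine hUs (subset_closure ?_)
    by_contra h
    exact hp (by rw [hf]; beta_reduce; rw [hψ0 p h, mul_zero])
  constructor
  · rw [← integrableOn_iff_integrable_of_support_subset hsupp, IntegrableOn,
      restrict_riemannianVolume, integrable_chartVolume_iff g x hfm]
    exact hfi
  · rw [← setIntegral_eq_integral_of_forall_compl_eq_zero (s := (extChartAt I x).source)
      fun p hp => Function.notMem_support.1 fun h => hp (hsupp h), restrict_riemannianVolume,
      integral_chartVolume, ← integral_congr_ae hae, setIntegral_indicator hV'm,
      inter_eq_right.2 hVV', hP, integral_finsetSum _ fun S _ => integrable_finsetSum _ (hi S)]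
    exact Finset.sum_congr rfl fun S _ => integral_finsetSum _ (hi S)

end Local

end

/-! ### Convergence in one chart and globalization. -/

section

set_option maxSynthPendingDepth 3

section Convergence

variable {n : ℕ} {H : Type*} [TopologicalSpace H] {I : ModelWithCorners ℝ (Eucl n) H}
  {M : Type*} [TopologicalSpace M] [ChartedSpace H M] [IsManifold I ∞ M]
  {g : ContMDiffRiemannianMetric I ∞ (Eucl n) (TangentSpace I (M := M))}

theorem tendsto_chartJet {α : ℝ} {v : ℕ → M → ℝ} {u : M → ℝ} (hu : ContMDiff I 𝓘(ℝ, ℝ) 1 u)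
    (hconv : TendstoC1Holder I α v u) {x : M} {K : Set (Eucl n)} (hK : IsCompact K)
    (hKt : K ⊆ (extChartAt I x).target) : ∀ y ∈ K,
      Tendsto (fun z : ℕ × Eucl n => chartJet (I := I) (v z.1) x z.2) (atTop ×ˢ 𝓝[K] y)
        (𝓝 (chartJet (I := I) u x y)) := by
  refine fun y hy => tendsto_of_uniform (Q := fun j z => chartJet (I := I) (v j) x z)
    ((continuousOn_chartJet hu x).mono hKt) (fun ε hε => ?_) hy
  filter_upwards [hconv x K hK hKt ε hε] with j hj z hz
  simp only [chartJet, Prod.dist_eq, dist_self]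
  refine max_le hε.le (max_le ?_ ?_)
  · rw [Real.dist_eq]
    exact hj.1 z hz
  · rw [dist_eq_norm]
    exact hj.2.1 z hz

/-- Points of a chart domain over which a function vanishing on the boundary and supported in `U`
is nonzero lie in the interior of the chart. -/
theorem eq_zero_of_notMem_chartPart {x : M} {U : Set M} {ψ : M → ℝ} (hψU : tsupport ψ ⊆ U)
    (hψ₀ : ∀ p ∈ I.boundary M, ψ p = 0) {y : Eucl n} (hy : y ∈ (extChartAt I x).target)
    (hyU : y ∉ chartPart I x U) : ψ ((extChartAt I x).symm y) = 0 := by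
  by_contra h
  have hyU' : (extChartAt I x).symm y ∈ U := hψU (subset_tsupport _ h)
  have hb : (extChartAt I x).symm y ∉ I.boundary M := fun hb => h (hψ₀ _ hb)
  have hint : I.IsInteriorPoint ((extChartAt I x).symm y) := by
    rwa [ModelWithCorners.boundary, Set.mem_ofPred_eq,
      ModelWithCorners.isBoundaryPoint_iff_not_isInteriorPoint, not_not] at hb
  rw [isInteriorPoint_iff_mem_chartInterior ((extChartAt I x).map_target hy),
    (extChartAt I x).right_inv hy] at hint
  exact hyU ⟨hint, hyU'⟩

variable [MeasurableSpace M] [BorelSpace M] [T2Space M] [CompactSpace M] {k : ℕ}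

/-- Convergence of the integrals of `σ_k` against a test function supported in one chart. -/
theorem tendsto_integral_of_tsupport_subset (hn : 3 ≤ n) (hk : 1 ≤ k) (hkn : k ≤ n) {α : ℝ}
    {v : ℕ → M → ℝ} (hv : ∀ j, ContMDiff I 𝓘(ℝ, ℝ) ∞ (v j)) (hvpos : ∀ j p, 0 < v j p)
    {u : M → ℝ} (hu : ContMDiff I 𝓘(ℝ, ℝ) 1 u) (hupos : ∀ p, 0 < u p)
    (hconv : TendstoC1Holder I α v u) (hweak : TendstoWeaklyW2 I g (k : ℝ≥0∞) v u)
    {du : CovField I M} {Hu : BilinField I M} (hHu : HasWeakHessian I g (k : ℝ≥0∞) u du Hu)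
    {x : M} {ψ : M → ℝ} (hψ : Continuous ψ) (hψs : tsupport ψ ⊆ (extChartAt I x).source)
    (hψ₀ : ∀ p ∈ I.boundary M, ψ p = 0) (γ : ℝ) :
    (∀ j, Integrable (fun p => v j p ^ γ * sigmaSchouten I g k (v j) p * ψ p)
      (riemannianVolume I g)) ∧
    Integrable (fun p => u p ^ γ * sigmaWeakSchouten I g k u du Hu p * ψ p)
      (riemannianVolume I g) ∧
    Tendsto (fun j => ∫ p, v j p ^ γ * sigmaSchouten I g k (v j) p * ψ p ∂riemannianVolume I g)
      atTop (𝓝 (∫ p, u p ^ γ * sigmaWeakSchouten I g k u du Hu p * ψ p ∂riemannianVolume I g)) := by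
  -- The intermediate set `U` keeps the region of integration inside a compact part of the chart
  -- while still containing the support of `ψ`.
  obtain ⟨U, hU, hψU, hUs, -⟩ := exists_open_between_and_isCompact_closure
    (isClosed_tsupport ψ).isCompact (isOpen_extChartAt_source x) hψs
  set V' := chartPart I x U with hV'
  set K := extChartAt I x '' closure U with hK
  have hKc : IsCompact K := isCompact_image_closure hUs
  have hKt : K ⊆ (extChartAt I x).target := image_closure_subset_target hUs
  have hV'K : V' ⊆ K := chartPart_subset_image x
  have hV'V : V' ⊆ chartInterior I x := inter_subset_left
  have hV'KV : V' ⊆ K ∩ chartInterior I x := subset_inter hV'K hV'V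
  have hV'o : IsOpen V' := isOpen_chartPart x hU
  have hV'b : Bornology.IsBounded V' := hKc.isBounded.subset hV'K
  have hVm : MeasurableSet (chartInterior I x) := (isOpen_chartInterior x).measurableSet
  have hv1 : ∀ j, ContMDiff I 𝓘(ℝ, ℝ) 1 (v j) := fun j => (hv j).of_le (by exact_mod_cast le_top)
  obtain ⟨hfi, C, hC⟩ := exists_integral_hess_pow_le hk hv hu hconv hweak hKc hKt
  have hfi' : ∀ j, IntegrableOn (fun y => ‖hess (fun z => v j ((extChartAt I x).symm z)) y‖ ^ k) V' :=
    fun j => (hfi j).mono_set hV'KV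
  have hf : ∀ j, ContDiffOn ℝ ∞ (fun z => v j ((extChartAt I x).symm z)) V' := fun j =>
    (contDiffOn_chartInterior (hv j) x).mono hV'V
  have hW := hHu.hasWeakHess hk hu hKc hKt hV'K hV'V
  have hrep := fun j => integral_eq_sum_of_tsupport_subset (k := k) hU hUs hψ hψU γ (hv1 j)
    (hvpos j) (F := sigmaSchouten I g k (v j))
    ((continuousOn_hess hV'o (contDiffOn_infty.1 (hf j) 2)).aestronglyMeasurable
      hV'o.measurableSet) (hfi' j) (by
        filter_upwards [ae_restrict_mem hVm] with y hy
        rw [sigmaSchouten_eq_sum g hn hkn (hv j) (hvpos j) hy, chartJet, coordDeriv_eq_fderiv _ hy])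
  have hrepu := integral_eq_sum_of_tsupport_subset (k := k) hU hUs hψ hψU γ hu hupos
    (F := sigmaWeakSchouten I g k u du Hu) hW.aestronglyMeasurable hW.integrableOn_pow (by
      filter_upwards [ae_restrict_mem hVm, hHu.coordCov_ae hk hu x, hHu.coordHess_symm hk hu x]
        with y hy hd hs
      rw [sigmaWeakSchouten_eq_sum g hkn hupos du Hu hy hs, chartJet, coordDeriv_eq_fderiv _ hy, hd])
  refine ⟨fun j => (hrep j).1, hrepu.1, ?_⟩
  simp only [(hrep _).2, hrepu.2]
  refine tendsto_finsetSum _ fun S _ => tendsto_finsetSum _ fun r hr => ?_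
  have hcont : ContinuousOn (fun y => integrandCoef g x ψ γ S r (chartJet (I := I) u x y))
      (extChartAt I x).target :=
    (continuousOn_integrandCoef g x hψ γ S r).comp (continuousOn_chartJet hu x)
      (mapsTo_chartJet hupos x)
  have hzero : ∀ y, ψ ((extChartAt I x).symm y) = 0 →
      integrandCoef g x ψ γ S r (chartJet (I := I) u x y) = 0 := fun y hy => by
    simp only [integrandCoef, chartJet, hy]
    ring
  have hSc : IsCompact (extChartAt I x '' tsupport ψ) :=
    (isClosed_tsupport ψ).isCompact.image_of_continuousOn ((continuousOn_extChartAt x).mono hψs)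
  -- The limit coefficient extends continuously by zero, because `ψ` vanishes on the boundary of the
  -- manifold and outside its compact support.
  have hc : Continuous
      (V'.indicator fun y => integrandCoef g x ψ γ S r (chartJet (I := I) u x y)) := by
    refine continuous_indicator_of_eq_zero hV'o (hV'V.trans (chartInterior_subset_target x))
      hSc.isClosed ?_ hcont (fun y hy hyV => hzero y (eq_zero_of_notMem_chartPart hψU hψ₀ hy hyV))
      fun y hy hyS => hzero y ?_
    · rintro _ ⟨p, hp, rfl⟩
      exact (extChartAt I x).map_source (hψs hp)
    · by_contra h
      exact hyS ⟨_, subset_tsupport _ h, (extChartAt I x).right_inv hy⟩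
  -- The coefficients are continuous functions of the one-jet, and the one-jets converge uniformly
  -- on `K`.
  have hunif := tendstoUniformlyOn_comp_of_isCompact hKc (continuousOn_integrandCoef g x hψ γ S r)
    ((mapsTo_chartJet hupos x).mono_left hKt) (fun j => (mapsTo_chartJet (hvpos j) x).mono_left hKt)
    ((continuousOn_chartJet hu x).mono hKt) (tendsto_chartJet hu hconv hKc hKt)
  have hlim := tendsto_integral_mul_nullLagr hV'o hV'b hk hW (Finset.mem_filter.1 hr).2
    (fun j => contDiffOn_infty.1 (hf j) 3) (fun ε hε => ?_) hfi' (C := C) (fun j => ?_) hc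
    (fun y hy => indicator_of_notMem hy _)
    (c' := fun j y => integrandCoef g x ψ γ S r (chartJet (I := I) (v j) x y)) (fun j => ?_)
    (fun ε hε => ?_)
  · have heq : ∫ y in V', V'.indicator (fun y => integrandCoef g x ψ γ S r
        (chartJet (I := I) u x y)) y * nullLagr r (coordHess g du Hu x y)
        = ∫ y in V', integrandCoef g x ψ γ S r (chartJet (I := I) u x y)
          * nullLagr r (coordHess g du Hu x y) :=
      setIntegral_congr_fun hV'o.measurableSet fun y hy => by
        rw [indicator_of_mem hy]
    rwa [heq] at hlim
  · filter_upwards [hconv x K hKc hKt ε hε] with j hj y hy l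
    rw [pderiv, pderiv, ← coordDeriv_eq_fderiv _ (hV'V hy), ← coordDeriv_eq_fderiv _ (hV'V hy),
      ← sub_apply]
    refine ((coordDeriv I (v j) x y - coordDeriv I u x y).le_opNorm _).trans ?_
    have : ‖(basisVec l : Eucl n)‖ = 1 := by simp [basisVec]
    rw [this, mul_one]
    exact hj.2.1 y (hV'K hy)
  · exact (setIntegral_mono_set (hfi j) (ae_of_all _ fun y => by positivity)
      hV'KV.eventuallyLE).trans (hC j)
  · exact (continuousOn_integrandCoef g x hψ γ S r).comp
      ((continuousOn_chartJet (hv1 j) x).mono (hV'K.trans hKt))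
      ((mapsTo_chartJet (hvpos j) x).mono_left (hV'K.trans hKt))
  · filter_upwards [Metric.tendstoUniformlyOn_iff.1 hunif ε hε] with j hj y hy
    rw [indicator_of_mem hy, abs_sub_comm, ← Real.dist_eq]
    exact (hj y (hV'K hy)).le

/-- Convergence of the integrals of `σ_k` against a test function vanishing on the boundary. -/
theorem tendsto_integral_sigma (hn : 3 ≤ n) (hk : 1 ≤ k) (hkn : k ≤ n) {α : ℝ}
    {v : ℕ → M → ℝ} (hv : ∀ j, ContMDiff I 𝓘(ℝ, ℝ) ∞ (v j)) (hvpos : ∀ j p, 0 < v j p)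
    {u : M → ℝ} (hu : ContMDiff I 𝓘(ℝ, ℝ) 1 u) (hupos : ∀ p, 0 < u p)
    (hconv : TendstoC1Holder I α v u) (hweak : TendstoWeaklyW2 I g (k : ℝ≥0∞) v u)
    {du : CovField I M} {Hu : BilinField I M} (hHu : HasWeakHessian I g (k : ℝ≥0∞) u du Hu)
    {φ : M → ℝ} (hφ : Continuous φ) (hφ₀ : ∀ p ∈ I.boundary M, φ p = 0) (γ : ℝ) :
    (∀ j, Integrable (fun p => v j p ^ γ * sigmaSchouten I g k (v j) p * φ p)
      (riemannianVolume I g)) ∧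
    Integrable (fun p => u p ^ γ * sigmaWeakSchouten I g k u du Hu p * φ p)
      (riemannianVolume I g) ∧
    Tendsto (fun j => ∫ p, v j p ^ γ * sigmaSchouten I g k (v j) p * φ p ∂riemannianVolume I g)
      atTop (𝓝 (∫ p, u p ^ γ * sigmaWeakSchouten I g k u du Hu p * φ p ∂riemannianVolume I g)) := by
  -- By compactness only finitely many functions of the partition are nonzero, and each product `ρ i
  -- * φ` is supported in one chart and still vanishes on the boundary.
  obtain ⟨ρ, hρ⟩ := PartitionOfUnity.exists_isSubordinate (isClosed_univ (X := M))
    (fun x : M => (extChartAt I x).source) (fun x => isOpen_extChartAt_source x)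
    fun p _ => mem_iUnion.2 ⟨p, mem_extChartAt_source p⟩
  have hfin : {i | (Function.support (ρ i)).Nonempty}.Finite :=
    ρ.locallyFinite.finite_nonempty_of_compact
  set s : Finset M := hfin.toFinset with hs
  have hsum : ∀ p, ∑ i ∈ s, ρ i p = 1 := fun p => by
    rw [← ρ.sum_eq_one (mem_univ p), finsum_eq_sum_of_support_subset]
    intro i hi
    rw [Finset.mem_coe, hs, Set.Finite.mem_toFinset]
    exact ⟨p, hi⟩
  have hloc := fun i => tendsto_integral_of_tsupport_subset hn hk hkn hv hvpos hu hupos hconv hweak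
    hHu (x := i) (ψ := fun p => ρ i p * φ p) ((ρ i).continuous.mul hφ)
    ((tsupport_mul_subset_left (f := ρ i) (g := φ)).trans (hρ i))
    (fun p hp => by simp [hφ₀ p hp]) γ
  have hsplit : ∀ f : M → ℝ, (fun p => f p * φ p) = fun p => ∑ i ∈ s, f p * (ρ i p * φ p) := by
    intro f
    funext p
    rw [← Finset.mul_sum, ← Finset.sum_mul, hsum, one_mul]
  have h1 := fun j => hsplit fun p => v j p ^ γ * sigmaSchouten I g k (v j) p
  have h2 := hsplit fun p => u p ^ γ * sigmaWeakSchouten I g k u du Hu p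
  refine ⟨fun j => ?_, ?_, ?_⟩
  · rw [h1]
    exact integrable_finsetSum _ fun i _ => (hloc i).1 j
  · rw [h2]
    exact integrable_finsetSum _ fun i _ => (hloc i).2.1
  · simp only [h1, h2]
    rw [integral_finsetSum _ fun i _ => (hloc i).2.1]
    simp only [integral_finsetSum s fun i _ => (hloc i).1 _]
    exact tendsto_finsetSum _ fun i _ => (hloc i).2.2

end Convergence

end

end SchoutenSigma

theorem mainTheorem9 {n k : ℕ} (hn : 3 ≤ n) (hk : 1 ≤ k) (hkn : k ≤ n)
    {H : Type*} [TopologicalSpace H] (I : ModelWithCorners ℝ (Eucl n) H)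
    {M : Type*} [TopologicalSpace M] [ChartedSpace H M] [IsManifold I ∞ M]
    [T2Space M] [CompactSpace M] [MeasurableSpace M] [BorelSpace M]
    (g : ContMDiffRiemannianMetric I ∞ (Eucl n) (TangentSpace I (M := M)))
    (α : ℝ) (hα₀ : 0 < α) (hα₁ : α < 1)
    (v : ℕ → M → ℝ) (hv : ∀ j, ContMDiff I 𝓘(ℝ, ℝ) ∞ (v j)) (hvpos : ∀ j p, 0 < v j p)
    (u : M → ℝ) (hu : MemC1Holder I α u) (hupos : ∀ p, 0 < u p)
    (hconv : TendstoC1Holder I α v u) (hweak : TendstoWeaklyW2 I g (k : ℝ≥0∞) v u)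
    (du : CovField I M) (Hu : BilinField I M) (hHu : HasWeakHessian I g (k : ℝ≥0∞) u du Hu)
    (φ : M → ℝ) (hφ : Continuous φ) (hφ₀ : ∀ p ∈ I.boundary M, φ p = 0) :
    ((∀ j, Integrable (fun p => sigmaSchouten I g k (v j) p * φ p) (riemannianVolume I g)) ∧
      Integrable (fun p => sigmaWeakSchouten I g k u du Hu p * φ p) (riemannianVolume I g) ∧
      Tendsto (fun j => ∫ p, sigmaSchouten I g k (v j) p * φ p ∂(riemannianVolume I g)) atTop
        (𝓝 (∫ p, sigmaWeakSchouten I g k u du Hu p * φ p ∂(riemannianVolume I g)))) ∧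
    (∀ γ : ℝ,
      (∀ j, Integrable (fun p => v j p ^ γ * sigmaSchouten I g k (v j) p * φ p)
        (riemannianVolume I g)) ∧
      Integrable (fun p => u p ^ γ * sigmaWeakSchouten I g k u du Hu p * φ p)
        (riemannianVolume I g) ∧
      Tendsto (fun j => ∫ p, v j p ^ γ * sigmaSchouten I g k (v j) p * φ p
          ∂(riemannianVolume I g)) atTop
        (𝓝 (∫ p, u p ^ γ * sigmaWeakSchouten I g k u du Hu p * φ p
          ∂(riemannianVolume I g)))) := by
  have key := tendsto_integral_sigma hn hk hkn hv hvpos hu.1 hupos hconv hweak hHu hφ hφ₀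
  refine ⟨?_, key⟩
  -- The unweighted statement is the case `γ = 0`.
  have h := key 0
  simp only [Real.rpow_zero, one_mul] at h
  exact h
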